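/- Let $S_x,S_y\subset\mathbb R^3$ be arbitrary non-degenerate flat triangles with vertices $\mathbf x_1,\mathbf x_2,\mathbf x_3$ and $\mathbf y_1,\mathbf y_2,\mathbf y_3$ and areas $A_x,A_y$ (in any relative position; they may touch, intersect or coincide), and let $$L=\int_{S_y}\int_{S_x}\frac{1}{|\mathbf x-\mathbf y|}\,dS(\mathbf x)\,dS(\mathbf y).$$ **Primitive boundary functions (PBFs).** For $P>0$ and $h_i\ge 0$ put $$F_4(P;h_4)=\frac{1}{3P^4}\left[(P^2-2h_4^2)\sqrt{P^2+h_4^2}+2h_4^3\right].$$ If $h_3h_4=0$, put $$F_3(P;0,0)=\frac1{6P},$$ $$F_3(P;h_3,0)=\frac1{6P^3}\left(PR_3-h_3^2\ln\frac{P+R_3}{h_3}\right),\quad R_3=\sqrt{P^2+h_3^2},\ h_3\ne0,$$ $$F_3(P;0,h_4)=\frac1{6P^3}\left(PR_4-3h_4^2\ln\frac{P+R_4}{h_4}+4h_4^2\frac{R_4-h_4}{P}\right),\quad R_4=\sqrt{P^2+h_4^2},\ h_4\neq0.$$ With $h=\sqrt{h_2^2+h_3^2+h_4^2}$, $R_2=\sqrt{P^2+h_2^2}$,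 $R_3=\sqrt{P^2+h_2^2+h_3^2}$, $R_4=\sqrt{P^2+h^2}$, $C_5=h+\frac{h_3^2}{h_2}\ln\frac{h_2+h}{h_3}$, $C_7=h+h_4^2\left(\frac3{h_2}\ln\frac{h_2+h}{h_4}-2\frac{h-h_4}{h_2^2}\right)$, and with all displayed parameters nonzero, put $$F_2(P;0,0,0)=\frac1{6P},\qquad F_2(P;h_2,0,0)=\frac{R_2-h_2}{6P^2},$$ $$F_2(P;0,h_3,0)=\frac1{6P^2}\left[R_3-2h_3+\frac{h_3^2}{P}\ln\frac{P+R_3}{h_3}\right],$$ $$F_2(P;h_2,h_3,0)=\frac1{6P^2}\left[R_3-C_5+\frac{h_3^2}{R_2}\ln\frac{R_2+R_3}{h_3}\right],$$ $$F_2(P;0,0,h_4)=\frac1{6P^2}\left[R_4-3h_4+h_4^2\left(\frac3P\ln\frac{P+R_4}{h_4}-2\frac{R_4-h_4}{P^2}\right)\right],$$ $$F_2(P;h_2,0,h_4)=\frac1{6P^2}\left[R_4-C_7+h_4^2\left(\frac3{R_2}\ln\frac{R_2+R_4}{h_4}-2\frac{R_4-h_4}{R_2^2}\right)\right].$$ Finally,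 with $h^2=h_1^2+h_2^2+h_3^2+h_4^2$, $R_4=\sqrt{P^2+h^2}$, $R_1=\sqrt{P^2+h_1^2}$, $R_2=\sqrt{P^2+h_2^2}$ and $$\Phi_1=\frac1P\ln\frac{P+R_4}{h},\quad \Phi_2(\eta)=\frac1P\arctan\frac{\eta P}{h^2+R_4\sqrt{h^2-\eta^2}},\quad \Phi_3=\frac1{R_1}\ln\frac{R_1+R_4}{\sqrt{h^2-h_1^2}},$$ $$\Phi_4(\eta)=\frac{\eta^2}{P^2h_2}\left(\frac{R_2}{h_2}\ln\frac{R_2+R_4}{\eta}-\ln\frac{h_2+h}{\eta}\right),$$ define $F_1=F_1(P;h_1,h_2,h_3,h_4)$ in the following seven cases, in each of which exactly the listed parameters are nonzero: - #1 ($h_1$): $F_1=\frac16\Phi_1$; - #2 ($h_2$): $F_1=\frac16\left(\Phi_1-\frac1{R_2+h_2}\right)$; - #3 ($h_1,h_2$): $F_1=\frac16\left[\Phi_1-\frac{h_2}{h_1}\Phi_2(h_1)\right]$; - #4 ($h_1,h_3$): $F_1=\frac16\left[\left(1-\frac{h_3^2}{h_1^2}\right)\Phi_1-\frac{2h_3}{h_1}\Phi_2(h_1)+\frac{h_3^2}{h_1^2}\Phi_3\right]$;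 - #5 ($h_2,h_3$): $F_1=\frac16\left[\frac{h^2}{h_2^2}\Phi_1-\frac1{R_4+h}-\Phi_4(h_3)\right]$; - #6 ($h_1,h_4$): $F_1=\frac16\left[\left(1-\frac{3h_4^2}{h_1^2}\right)\Phi_1-\left(3-\frac{h_4^2}{h_1^2}\right)\frac{h_4}{h_1}\Phi_2(h_1)+3\frac{h_4^2}{h_1^2}\Phi_3-\frac{h_4^2}{h_1^2(R_4+h_4)}\right]$; - #7 ($h_2,h_4$): $F_1=\frac16\left[\left(1+\frac{3h_4^2}{h_2^2}\right)\Phi_1-\frac{2h_4^3}{h_2^3}\Phi_2(h_2)-3\Phi_4(h_4)+\frac{2h_4^2-h_2^2}{h_2^2(R_4+h)}\right]$. **Projections.** For vectors $\mathbf a_1,\dots,\mathbf a_d,\mathbf e\in\mathbb R^3$ choose coefficients $s_{10},\dots,s_{d0}$ such that $\mathbf e_\parallel=\sum_i s_{i0}\mathbf a_i$ is the orthogonal projection of $\mathbf e$ on $\mathrm{span}(\mathbf a_1,\dots,\mathbf a_d)$, and put $h_d=|\mathbf e-\mathbf e_\parallel|$. The coefficients need not be unique; any choice is allowed, as a function of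 $(\mathbf a_1,\dots,\mathbf a_d,\mathbf e)$. **Recursive scheme.** At each stage $s_{i0}$, $h_d$, $\mathbf e_\parallel$ are those of the current vectors, and $h_{d+1},\dots,h_4$ are inherited. With $R$ the length of $\sum_i s_i\mathbf a_i+\mathbf e$, let $I_4$ be the integral of $1/R$ over the product of two standard triangles ($s_1,s_2\ge0$, $s_1+s_2\le1$, and likewise for $s_3,s_4$), $I_3$ the integral of $F_4(R;h_4)$ over the prism $s_1,s_2\ge0$, $s_1+s_2\le 1$, $0\le s_3\le1$, $I_2^{(s)}$ and $I_2^{(t)}$ the integrals of $F_3(R;h_3,h_4)$ over the unit square and the standard triangle, and $I_1$ the integral of $F_2(R;h_2,h_3,h_4)$ over $[0,1]$. Consider the following right-hand sides: $$\begin{aligned}I_4(\mathbf a_1,\mathbf a_2,\mathbf a_3,\mathbf a_4,\mathbf e)={}&-s_{40}I_3(\mathbf a_1,\mathbf a_2,\mathbf a_3,\mathbf e_\parallel)+(1+s_{30}+s_{40})I_3(\mathbf a_1,\mathbf a_2,\mathbf a_4-\mathbf a_3,\mathbf e_\parallel+\mathbf a_3)-s_{30}I_3(\mathbf a_1,\mathbf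 a_2,\mathbf a_4,\mathbf e_\parallel)\\&-s_{20}I_3(\mathbf a_3,\mathbf a_4,\mathbf a_1,\mathbf e_\parallel)+(1+s_{10}+s_{20})I_3(\mathbf a_3,\mathbf a_4,\mathbf a_2-\mathbf a_1,\mathbf e_\parallel+\mathbf a_1)-s_{10}I_3(\mathbf a_3,\mathbf a_4,\mathbf a_2,\mathbf e_\parallel),\end{aligned}\tag{4}$$ $$\begin{aligned}I_3(\mathbf a_1,\mathbf a_2,\mathbf a_3,\mathbf e)={}&(1+s_{10}+s_{20})I_2^{(s)}(\mathbf a_1-\mathbf a_2,\mathbf a_3,\mathbf e_\parallel+\mathbf a_2)-s_{10}I_2^{(s)}(\mathbf a_2,\mathbf a_3,\mathbf e_\parallel)-s_{20}I_2^{(s)}(\mathbf a_1,\mathbf a_3,\mathbf e_\parallel)\\&+(1+s_{30})I_2^{(t)}(\mathbf a_1,\mathbf a_2,\mathbf e_\parallel+\mathbf a_3)-s_{30}I_2^{(t)}(\mathbf a_1,\mathbf a_2,\mathbf e_\parallel),\end{aligned}\tag{3}$$ $$I_2^{(s)}(\mathbf a_1,\mathbf a_2,\mathbf e)=(1+s_{10})I_1(\mathbf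 a_2,\mathbf e_\parallel+\mathbf a_1)-s_{10}I_1(\mathbf a_2,\mathbf e_\parallel)+(1+s_{20})I_1(\mathbf a_1,\mathbf e_\parallel+\mathbf a_2)-s_{20}I_1(\mathbf a_1,\mathbf e_\parallel),\tag{2s}$$ $$I_2^{(t)}(\mathbf a_1,\mathbf a_2,\mathbf e)=-s_{10}I_1(\mathbf a_2,\mathbf e_\parallel)-s_{20}I_1(\mathbf a_1,\mathbf e_\parallel)+(1+s_{10}+s_{20})I_1(\mathbf a_1-\mathbf a_2,\mathbf e_\parallel+\mathbf a_2),\tag{2t}$$ $$I_1(\mathbf a_1,\mathbf e)=(1+s_{10})F_1(P(1);h_1,\dots,h_4)-s_{10}F_1(P(0);h_1,\dots,h_4),\qquad P(s)=|s+s_{10}|\,|\mathbf a_1|.\tag{1}$$ Terms with coefficient zero are omitted. **Theorem.** (a) The functions $F_d$ satisfy $F_d(P)=P^{-d}\int_0^P p^{d-1}G_d\big(\sqrt{p^2+h_d^2}\big)\,dp$ with $G_4(R)=1/R$ and $G_{d-1}=F_d$, for $d=4,3,2,1$, for all $P>0$ and $h_i\ge0$ (with $h_3h_4=0$ if $d\leq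 3$, and in the cases #1–#7 if $d=1$). (b) The Gram–Schmidt process applied to $\mathbf a_1,\dots,\mathbf a_d$ (with vanishing vectors skipped), giving $\mathbf u_1,\dots,\mathbf u_d$, followed by the back substitution $s_{j0}=\frac{1}{\mathbf u_j\cdot\mathbf a_j}\big(\mathbf u_j\cdot\mathbf e-\sum_{i>j}(\mathbf u_j\cdot\mathbf a_i)s_{i0}\big)$ if $\mathbf u_j\ne0$, and $s_{j0}=0$ if $\mathbf u_j=0$, is an admissible choice of the coefficients. (c) $2A_x=|(\mathbf x_2-\mathbf x_1)\times(\mathbf x_3-\mathbf x_1)|$ and $2A_y=|(\mathbf y_2-\mathbf y_1)\times(\mathbf y_3-\mathbf y_1)|$; the inner integral of $L$ converges for every $\mathbf y\in\mathbb R^3$ and is integrable over $S_y$; and $$L=4A_xA_yU,\qquad U=I_4(\mathbf x_2-\mathbf x_1,\ \mathbf x_3-\mathbf x_1,\ -(\mathbf y_2-\mathbf y_1),\ -(\mathbf y_3-\mathbf y_1),\ \mathbf x_1-\mathbf y_1).$$ (d) For every admissible choice of the coefficients, starting from this $U$, the identities (4), (3), (2s), (2t), (1) hold at every stage that is reached through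 nonzero coefficients, and at each $I_1$ so reached the parameters $h_1,\dots,h_4$ are in exactly one of the cases #1–#7. Consequently $L=4A_xA_yU$, where $U$ is the finite sum of values of $F_1$ that (4), (3), (2s), (2t), (1) produce. -/

import Mathlib

open MeasureTheory Set
open scoped Matrix

namespace GalerkinBEM

/-- Three dimensional Euclidean space. -/
abbrev E3 : Type := EuclideanSpace ℝ (Fin 3)

/-- The flat (closed) triangle with vertices `x 0`, `x 1`, `x 2`. -/
def tri (x : Fin 3 → E3) : Set E3 := convexHull ℝ (Set.range x)

/-- The area of the triangle: its two dimensional Euclidean Hausdorff measure, which is the usual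
surface measure. -/
noncomputable def area (x : Fin 3 → E3) : ℝ := (μHE[2] (tri x)).toReal

/-- The potential at `q` of the uniformly charged triangle with vertices `x`. -/
noncomputable def potential (x : Fin 3 → E3) (q : E3) : ℝ := ∫ p in tri x, ‖p - q‖⁻¹ ∂μHE[2]

/-- The single layer Galerkin integral `∫_{S_y} ∫_{S_x} 1/|x-y| dS(x) dS(y)`. -/
noncomputable def singleLayer (x y : Fin 3 → E3) : ℝ := ∫ q in tri y, potential x q ∂μHE[2]

/-! ### Primitive boundary functions -/

/-- The kernel `G₄(R₄) = 1/R₄`. -/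
noncomputable def G4 (R : ℝ) : ℝ := R⁻¹

/-- `F₄(P₄; h₄)`. -/
noncomputable def F4 (P h4 : ℝ) : ℝ :=
  1 / (3 * P ^ 4) * ((P ^ 2 - 2 * h4 ^ 2) * √(P ^ 2 + h4 ^ 2) + 2 * h4 ^ 3)

open Classical in
/-- `F₃(P₃; h₃, h₄)`, where at least one of `h₃`, `h₄` is zero. -/
noncomputable def F3 (P h3 h4 : ℝ) : ℝ :=
  if h3 = 0 ∧ h4 = 0 then 1 / (6 * P)
  else if h3 ≠ 0 ∧ h4 = 0 then
    let R3 := √(P ^ 2 + h3 ^ 2)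
    1 / (6 * P ^ 3) * (P * R3 - h3 ^ 2 * Real.log ((P + R3) / h3))
  else if h3 = 0 ∧ h4 ≠ 0 then
    let R4 := √(P ^ 2 + h4 ^ 2)
    1 / (6 * P ^ 3) *
      (P * R4 - 3 * h4 ^ 2 * Real.log ((P + R4) / h4) + 4 * h4 ^ 2 * ((R4 - h4) / P))
  else 0

open Classical in
/-- `F₂(P₂; h₂, h₃, h₄)`, where at least one of `h₃`, `h₄` is zero. -/
noncomputable def F2 (P h2 h3 h4 : ℝ) : ℝ :=
  let h := √(h2 ^ 2 + h3 ^ 2 + h4 ^ 2)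
  let R2 := √(P ^ 2 + h2 ^ 2)
  let R3 := √(P ^ 2 + h2 ^ 2 + h3 ^ 2)
  let R4 := √(P ^ 2 + h2 ^ 2 + h3 ^ 2 + h4 ^ 2)
  let C5 := h + h3 ^ 2 / h2 * Real.log ((h2 + h) / h3)
  let C7 := h + h4 ^ 2 * (3 / h2 * Real.log ((h2 + h) / h4) - 2 * ((h - h4) / h2 ^ 2))
  if h2 = 0 ∧ h3 = 0 ∧ h4 = 0 then 1 / (6 * P)
  else if h2 ≠ 0 ∧ h3 = 0 ∧ h4 = 0 then (R2 - h2) / (6 * P ^ 2)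
  else if h2 = 0 ∧ h3 ≠ 0 ∧ h4 = 0 then
    1 / (6 * P ^ 2) * (R3 - 2 * h3 + h3 ^ 2 / P * Real.log ((P + R3) / h3))
  else if h2 ≠ 0 ∧ h3 ≠ 0 ∧ h4 = 0 then
    1 / (6 * P ^ 2) * (R3 - C5 + h3 ^ 2 / R2 * Real.log ((R2 + R3) / h3))
  else if h2 = 0 ∧ h3 = 0 ∧ h4 ≠ 0 then
    1 / (6 * P ^ 2) *
      (R4 - 3 * h4 + h4 ^ 2 * (3 / P * Real.log ((P + R4) / h4) - 2 * ((R4 - h4) / P ^ 2)))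
  else if h2 ≠ 0 ∧ h3 = 0 ∧ h4 ≠ 0 then
    1 / (6 * P ^ 2) *
      (R4 - C7 + h4 ^ 2 * (3 / R2 * Real.log ((R2 + R4) / h4) - 2 * ((R4 - h4) / R2 ^ 2)))
  else 0

/-- The seven cases #1, ..., #7 of the parameters `h₁, h₂, h₃, h₄` (numbered here from `0`). -/
def hCase : Fin 7 → ℝ → ℝ → ℝ → ℝ → Prop
  | 0, h1, h2, h3, h4 => h4 = 0 ∧ h3 = 0 ∧ h2 = 0 ∧ h1 ≠ 0
  | 1, h1, h2, h3, h4 => h4 = 0 ∧ h3 = 0 ∧ h1 = 0 ∧ h2 ≠ 0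
  | 2, h1, h2, h3, h4 => h4 = 0 ∧ h3 = 0 ∧ h2 ≠ 0 ∧ h1 ≠ 0
  | 3, h1, h2, h3, h4 => h4 = 0 ∧ h2 = 0 ∧ h3 ≠ 0 ∧ h1 ≠ 0
  | 4, h1, h2, h3, h4 => h4 = 0 ∧ h1 = 0 ∧ h3 ≠ 0 ∧ h2 ≠ 0
  | 5, h1, h2, h3, h4 => h3 = 0 ∧ h2 = 0 ∧ h4 ≠ 0 ∧ h1 ≠ 0
  | 6, h1, h2, h3, h4 => h3 = 0 ∧ h1 = 0 ∧ h4 ≠ 0 ∧ h2 ≠ 0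

open Classical in
/-- `F₁(P₁; h₁, h₂, h₃, h₄)`, with one closed formula in each of the seven cases. -/
noncomputable def F1 (P h1 h2 h3 h4 : ℝ) : ℝ :=
  let h := √(h1 ^ 2 + h2 ^ 2 + h3 ^ 2 + h4 ^ 2)
  let R4 := √(P ^ 2 + h ^ 2)
  let R1 := √(P ^ 2 + h1 ^ 2)
  let R2 := √(P ^ 2 + h2 ^ 2)
  let Φ1 := 1 / P * Real.log ((P + R4) / h)
  let Φ2 := fun η : ℝ => 1 / P * Real.arctan (η * P / (h ^ 2 + R4 * √(h ^ 2 - η ^ 2)))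
  let Φ3 := 1 / R1 * Real.log ((R1 + R4) / √(h ^ 2 - h1 ^ 2))
  let Φ4 := fun η : ℝ =>
    η ^ 2 / (P ^ 2 * h2) * (R2 / h2 * Real.log ((R2 + R4) / η) - Real.log ((h2 + h) / η))
  if hCase 0 h1 h2 h3 h4 then 1 / 6 * Φ1
  else if hCase 1 h1 h2 h3 h4 then 1 / 6 * (Φ1 - 1 / (R2 + h2))
  else if hCase 2 h1 h2 h3 h4 then 1 / 6 * (Φ1 - h2 / h1 * Φ2 h1)
  else if hCase 3 h1 h2 h3 h4 then
    1 / 6 * ((1 - h3 ^ 2 / h1 ^ 2) * Φ1 - 2 * h3 / h1 * Φ2 h1 + h3 ^ 2 / h1 ^ 2 * Φ3)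
  else if hCase 4 h1 h2 h3 h4 then
    1 / 6 * (h ^ 2 / h2 ^ 2 * Φ1 - 1 / (R4 + h) - Φ4 h3)
  else if hCase 5 h1 h2 h3 h4 then
    1 / 6 * ((1 - 3 * h4 ^ 2 / h1 ^ 2) * Φ1 - (3 - h4 ^ 2 / h1 ^ 2) * (h4 / h1) * Φ2 h1
      + 3 * (h4 ^ 2 / h1 ^ 2) * Φ3 - h4 ^ 2 / (h1 ^ 2 * (R4 + h4)))
  else if hCase 6 h1 h2 h3 h4 then
    1 / 6 * ((1 + 3 * h4 ^ 2 / h2 ^ 2) * Φ1 - 2 * h4 ^ 3 / h2 ^ 3 * Φ2 h2 - 3 * Φ4 h4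
      + (2 * h4 ^ 2 - h2 ^ 2) / (h2 ^ 2 * (R4 + h)))
  else 0

/-- The functions `F₄, F₃, F₂, F₁` are obtained from `G₄` by the successive integrations
`F_d(P) = P^{-d} ∫₀^P p^{d-1} G_d(√(p² + h_d²)) dp`, `G_{d-1} = F_d`. -/
def PBFRelations : Prop :=
  (∀ P h4 : ℝ, 0 < P → 0 ≤ h4 →
    F4 P h4 = (P ^ 4)⁻¹ * ∫ p in (0 : ℝ)..P, p ^ 3 * G4 (√(p ^ 2 + h4 ^ 2))) ∧
  (∀ P h3 h4 : ℝ, 0 < P → 0 ≤ h3 → 0 ≤ h4 → h3 * h4 = 0 →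
    F3 P h3 h4 = (P ^ 3)⁻¹ * ∫ p in (0 : ℝ)..P, p ^ 2 * F4 (√(p ^ 2 + h3 ^ 2)) h4) ∧
  (∀ P h2 h3 h4 : ℝ, 0 < P → 0 ≤ h2 → 0 ≤ h3 → 0 ≤ h4 → h3 * h4 = 0 →
    F2 P h2 h3 h4 = (P ^ 2)⁻¹ * ∫ p in (0 : ℝ)..P, p * F3 (√(p ^ 2 + h2 ^ 2)) h3 h4) ∧
  (∀ P h1 h2 h3 h4 : ℝ, 0 < P → 0 ≤ h1 → 0 ≤ h2 → 0 ≤ h3 → 0 ≤ h4 →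
    (∃ k, hCase k h1 h2 h3 h4) →
    F1 P h1 h2 h3 h4 = P⁻¹ * ∫ p in (0 : ℝ)..P, F2 (√(p ^ 2 + h1 ^ 2)) h2 h3 h4)

/-! ### Projections -/

/-- A choice, for all vectors `a 0, ..., a (d-1)` and `e`, of coefficients `s_{10}, ..., s_{d0}`. -/
abbrev CoeffRule : Type := (d : ℕ) → (Fin d → E3) → E3 → Fin d → ℝ

/-- The component `e_∥ = ∑ s_{i0} a_i` given by the chosen coefficients. -/
noncomputable def par (s : CoeffRule) {d : ℕ} (a : Fin d → E3) (e : E3) : E3 :=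
  ∑ i, s d a e i • a i

/-- The length `h_d = |e - e_∥|`. -/
noncomputable def height (s : CoeffRule) {d : ℕ} (a : Fin d → E3) (e : E3) : ℝ :=
  ‖e - par s a e‖

/-- The coefficients always give the decomposition of `e` into a component in the span of the `a i`
and a component orthogonal to all `a i`. (They are not unique if the `a i` are dependent.) -/
def IsProjectionRule (s : CoeffRule) : Prop :=
  ∀ (d : ℕ) (a : Fin d → E3) (e : E3) (j : Fin d), inner ℝ (a j) (e - par s a e) = 0

open Classical in
/-- The coefficients computed by the Gram-Schmidt process followed by back substitution, with
coefficient zero for each `a j` that depends on its predecessors. -/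
noncomputable def gsCoeff {d : ℕ} (a : Fin d → E3) (e : E3) (j : Fin d) : ℝ :=
  if InnerProductSpace.gramSchmidt ℝ a j = 0 then 0
  else
    (inner ℝ (InnerProductSpace.gramSchmidt ℝ a j) e
      - ∑ i : {i : Fin d // j < i},
          inner ℝ (InnerProductSpace.gramSchmidt ℝ a j) (a i.1) * gsCoeff a e i.1)
      / inner ℝ (InnerProductSpace.gramSchmidt ℝ a j) (a j)
termination_by d - j.1
decreasing_by
  have hlt : j.1 < i.1.1 := i.2
  have hd : i.1.1 < d := i.1.2
  clear * - hlt hd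
  omega

/-! ### The recursive scheme -/

/-- Parameters of a four dimensional integral. -/
structure Node4 where
  (a1 a2 a3 a4 e : E3)

/-- Parameters of a three dimensional integral over the right prism, with the inherited `h₄`. -/
structure Node3 where
  (a1 a2 a3 e : E3)
  (h4 : ℝ)

/-- The two kinds of two dimensional domains: unit square and standard triangle. -/
inductive Shape where
  | square
  | triangle

/-- Parameters of a two dimensional integral, with the inherited `h₃, h₄`. -/
structure Node2 where
  shape : Shape
  (a1 a2 e : E3)
  (h3 h4 : ℝ)

/-- Parameters of a one dimensional integral, with the inherited `h₂, h₃, h₄`. -/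
structure Node1 where
  (a1 e : E3)
  (h2 h3 h4 : ℝ)

/-- The parameters of the integral over the product of the two standard triangles. -/
def rootNode (x y : Fin 3 → E3) : Node4 :=
  ⟨x 1 - x 0, x 2 - x 0, -(y 1 - y 0), -(y 2 - y 0), x 0 - y 0⟩

/-- The integral `I₄` of `G₄(R₄)`. -/
noncomputable def I4 (n : Node4) : ℝ :=
  ∫ s1 in (0 : ℝ)..1, ∫ s2 in (0 : ℝ)..(1 - s1), ∫ s3 in (0 : ℝ)..1, ∫ s4 in (0 : ℝ)..(1 - s3),
    G4 ‖s1 • n.a1 + s2 • n.a2 + s3 • n.a3 + s4 • n.a4 + n.e‖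

/-- The integral `I₃` of `G₃(R₃) = F₄(R₃; h₄)` over the right prism. -/
noncomputable def I3 (n : Node3) : ℝ :=
  ∫ s1 in (0 : ℝ)..1, ∫ s2 in (0 : ℝ)..(1 - s1), ∫ s3 in (0 : ℝ)..1,
    F4 ‖s1 • n.a1 + s2 • n.a2 + s3 • n.a3 + n.e‖ n.h4

/-- The integral `I₂` of `G₂(R₂) = F₃(R₂; h₃, h₄)` over the unit square or standard triangle. -/
noncomputable def I2 (n : Node2) : ℝ :=
  match n.shape with
  | .square => ∫ s1 in (0 : ℝ)..1, ∫ s2 in (0 : ℝ)..1,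
      F3 ‖s1 • n.a1 + s2 • n.a2 + n.e‖ n.h3 n.h4
  | .triangle => ∫ s1 in (0 : ℝ)..1, ∫ s2 in (0 : ℝ)..(1 - s1),
      F3 ‖s1 • n.a1 + s2 • n.a2 + n.e‖ n.h3 n.h4

/-- The integral `I₁` of `G₁(R₁) = F₂(R₁; h₂, h₃, h₄)` over the unit segment. -/
noncomputable def I1 (n : Node1) : ℝ :=
  ∫ s1 in (0 : ℝ)..1, F2 ‖s1 • n.a1 + n.e‖ n.h2 n.h3 n.h4

/-- The six weighted three dimensional integrals to which `I₄` is reduced. -/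
noncomputable def faces4 (s : CoeffRule) (n : Node4) : List (ℝ × Node3) :=
  let a : Fin 4 → E3 := ![n.a1, n.a2, n.a3, n.a4]
  let s10 := s 4 a n.e 0
  let s20 := s 4 a n.e 1
  let s30 := s 4 a n.e 2
  let s40 := s 4 a n.e 3
  let h4 := height s a n.e
  let e := par s a n.e
  [(-s40, ⟨n.a1, n.a2, n.a3, e, h4⟩),
   (1 + s30 + s40, ⟨n.a1, n.a2, n.a4 - n.a3, e + n.a3, h4⟩),
   (-s30, ⟨n.a1, n.a2, n.a4, e, h4⟩),
   (-s20, ⟨n.a3, n.a4, n.a1, e, h4⟩),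
   (1 + s10 + s20, ⟨n.a3, n.a4, n.a2 - n.a1, e + n.a1, h4⟩),
   (-s10, ⟨n.a3, n.a4, n.a2, e, h4⟩)]

/-- The five weighted two dimensional integrals to which `I₃` is reduced. -/
noncomputable def faces3 (s : CoeffRule) (n : Node3) : List (ℝ × Node2) :=
  let a : Fin 3 → E3 := ![n.a1, n.a2, n.a3]
  let s10 := s 3 a n.e 0
  let s20 := s 3 a n.e 1
  let s30 := s 3 a n.e 2
  let h3 := height s a n.e
  let e := par s a n.e
  [(1 + s10 + s20, ⟨.square, n.a1 - n.a2, n.a3, e + n.a2, h3, n.h4⟩),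
   (-s10, ⟨.square, n.a2, n.a3, e, h3, n.h4⟩),
   (-s20, ⟨.square, n.a1, n.a3, e, h3, n.h4⟩),
   (1 + s30, ⟨.triangle, n.a1, n.a2, e + n.a3, h3, n.h4⟩),
   (-s30, ⟨.triangle, n.a1, n.a2, e, h3, n.h4⟩)]

/-- The four (square) or three (triangle) weighted one dimensional integrals to which `I₂` is
reduced. -/
noncomputable def faces2 (s : CoeffRule) (n : Node2) : List (ℝ × Node1) :=
  let a : Fin 2 → E3 := ![n.a1, n.a2]
  let s10 := s 2 a n.e 0
  let s20 := s 2 a n.e 1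
  let h2 := height s a n.e
  let e := par s a n.e
  match n.shape with
  | .square =>
    [(1 + s10, ⟨n.a2, e + n.a1, h2, n.h3, n.h4⟩),
     (-s10, ⟨n.a2, e, h2, n.h3, n.h4⟩),
     (1 + s20, ⟨n.a1, e + n.a2, h2, n.h3, n.h4⟩),
     (-s20, ⟨n.a1, e, h2, n.h3, n.h4⟩)]
  | .triangle =>
    [(-s10, ⟨n.a2, e, h2, n.h3, n.h4⟩),
     (-s20, ⟨n.a1, e, h2, n.h3, n.h4⟩),
     (1 + s10 + s20, ⟨n.a1 - n.a2, e + n.a2, h2, n.h3, n.h4⟩)]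

/-- The parameter `h₁` of a one dimensional integral. -/
noncomputable def height1 (s : CoeffRule) (n : Node1) : ℝ := height s ![n.a1] n.e

/-- The closed form of `I₁`: the values of `F₁` at the two end points of the edge. -/
noncomputable def closed1 (s : CoeffRule) (n : Node1) : ℝ :=
  let s10 := s 1 ![n.a1] n.e 0
  (1 + s10) * F1 (|1 + s10| * ‖n.a1‖) (height1 s n) n.h2 n.h3 n.h4
    - s10 * F1 (|0 + s10| * ‖n.a1‖) (height1 s n) n.h2 n.h3 n.h4

/-- The closed form of `I₂`. -/
noncomputable def closed2 (s : CoeffRule) (n : Node2) : ℝ :=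
  ((faces2 s n).map fun w => w.1 * closed1 s w.2).sum

/-- The closed form of `I₃`. -/
noncomputable def closed3 (s : CoeffRule) (n : Node3) : ℝ :=
  ((faces3 s n).map fun w => w.1 * closed2 s w.2).sum

/-- The closed form of `I₄`: a finite sum of values of `F₁` with explicit coefficients. -/
noncomputable def closed4 (s : CoeffRule) (n : Node4) : ℝ :=
  ((faces4 s n).map fun w => w.1 * closed3 s w.2).sum

/-- Validity of the last reduction step at `n`: exactly one of the seven cases applies, and the
integral is the combination of end point values of `F₁`. -/
def Step1 (s : CoeffRule) (n : Node1) : Prop :=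
  (∃! k : Fin 7, hCase k (height1 s n) n.h2 n.h3 n.h4) ∧ I1 n = closed1 s n

/-- Validity of the reduction from dimension two at `n`. Here and below, integrals that enter with
coefficient zero are dropped, so nothing is claimed about them. -/
def Step2 (s : CoeffRule) (n : Node2) : Prop :=
  I2 n = ((faces2 s n).map fun w => w.1 * I1 w.2).sum ∧
    ∀ w ∈ faces2 s n, w.1 ≠ 0 → Step1 s w.2

/-- Validity of the reduction from dimension three at `n`. -/
def Step3 (s : CoeffRule) (n : Node3) : Prop :=
  I3 n = ((faces3 s n).map fun w => w.1 * I2 w.2).sum ∧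
    ∀ w ∈ faces3 s n, w.1 ≠ 0 → Step2 s w.2

/-- Validity of the reduction from dimension four at `n`. -/
def Step4 (s : CoeffRule) (n : Node4) : Prop :=
  I4 n = ((faces4 s n).map fun w => w.1 * I3 w.2).sum ∧
    ∀ w ∈ faces4 s n, w.1 ≠ 0 → Step3 s w.2

end GalerkinBEM

namespace GalerkinBEM

open Filter Topology

/-! ### Closed forms of the primitive boundary functions -/

/-! The scheme is the divergence theorem for one radial field, applied in dimensions 4, 3, 2, 1. Put
v = ∑ s_i a_i + e_∥ = ∑ (s_i + s_{i0}) a_i, so that R² = |v|² + h_d² by Pythagoras (`norm_sum_add`).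
The integral relation for F_d gives P F_d' + d F_d = G_d(√(P² + h_d²)) (`IsPrimitive.hasDerivAt`).
Hence, in parameter space, the field with components (s_i + s_{i0}) F_d(|v|) has the integrand as
its divergence. Its flux density is a constant times F_d(|v|) on each face: -s_{i0} on s_i = 0, 1 +
s_{i0} on s_i = 1, and 1 + s_{10} + s_{20} on a hypotenuse. So an integral over a product of
intervals and triangles becomes a weighted sum of integrals of F_d = G_{d-1} over the faces. Only
e_∥ = ∑ s_{i0} a_i is used, so the dependence of the a_i, unavoidable for four vectors in space,
does no harm.

The field may be singular inside the domain or on a face. One therefore uses F_d(√(|v|² + ε²)),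
whose divergence is a convex combination of d F_d and G_d (`IsPrimitive.div_reg`) and is bounded by
d F_d(|v|), and lets ε tend to 0 by dominated convergence. Continuous, decreasing, nonnegative
kernels below 1/R are preserved by the first three integrations (`IsPrimitive.isKernel`). The
domination thus reduces to the integrability of 1/|v|, which holds as soon as two parameter
directions are independent (`exists_lintegral_inv_norm_le`). The remaining degenerate integrals have
a bounded integrand. The last step is a plain one dimensional substitution.

The seven cases come from dimension three. A nonzero h_4 or h_3 supplies a normal to all vectors of
the later stages, which then lie in a plane; this gives h_3 h_4 = 0, and h_2 = 0 whenever h_3 or h_4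
is nonzero and the two edges are independent. The weight of a face is also the coordinate of its
base vector transverse to the face. A nonzero weight therefore keeps the face away from the origin,
or, when parallel edges make a square collapse, forces h_2 ≠ 0 and h_1 = 0 instead. These
alternatives are recorded in `Admissible3`, `Admissible2`, `Admissible1` and handed down by the face
lemmas.

The closed forms are checked by differentiating P^d F_d and computing its limit at 0. The link with
L is the area formula for the affine parametrization of a triangle. -/

/-- Fundamental theorem of calculus for nonnegative derivatives on a half-open interval. -/
lemma integral_eq_of_hasDerivAt_of_tendsto_zero {g W : ℝ → ℝ} (hW : Tendsto W (𝓝[>] 0) (𝓝 0))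
    (hd : ∀ p, 0 < p → HasDerivAt W (g p) p) (hg : ∀ p, 0 < p → 0 ≤ g p) {P : ℝ} (hP : 0 < P) :
    IntervalIntegrable g volume 0 P ∧ ∫ p in (0 : ℝ)..P, g p = W P := by
  -- The closed forms divide by p, so `W` may take a meaningless value at 0; it is replaced there by
  -- the limit.
  have hd' : ∀ p, 0 < p → HasDerivAt (Function.update W 0 0) (g p) p := fun p hp => by
    refine (hd p hp).congr_of_eventuallyEq ?_
    filter_upwards [lt_mem_nhds hp] with q hq
    rw [Function.update_of_ne hq.ne']
  have hc : ContinuousOn (Function.update W 0 0) (uIcc 0 P) := by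
    rw [uIcc_of_le hP.le]
    intro p hp
    rcases hp.1.eq_or_lt with rfl | h
    · rw [continuousWithinAt_update_same]
      refine hW.mono_left (nhdsWithin_mono _ ?_)
      rintro q ⟨hq, hq'⟩
      exact lt_of_le_of_ne hq.1 (Ne.symm hq')
    · exact (hd' p h).continuousAt.continuousWithinAt
  -- Integrability near 0 need not be assumed: a nonnegative derivative of a function continuous up
  -- to the end point is integrable.
  have hint : IntervalIntegrable g volume 0 P := by
    refine intervalIntegral.intervalIntegrable_deriv_of_nonneg hc ?_ ?_
    · intro p hp; rw [min_eq_left hP.le, max_eq_right hP.le] at hp; exact hd' p hp.1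
    · intro p hp; rw [min_eq_left hP.le, max_eq_right hP.le] at hp; exact hg p hp.1
  refine ⟨hint, ?_⟩
  rw [intervalIntegral.integral_eq_sub_of_hasDerivAt_of_le hP.le (by rwa [uIcc_of_le hP.le] at hc)
    (fun p hp => hd' p hp.1) hint, Function.update_of_ne hP.ne', Function.update_self, sub_zero]

/-! ### Derivatives and limits of the elementary building blocks -/

lemma hasDerivAt_sqrt_sq_add {c p : ℝ} (h : 0 < p ^ 2 + c) :
    HasDerivAt (fun p => √(p ^ 2 + c)) (p / √(p ^ 2 + c)) p := by
  have := ((hasDerivAt_pow 2 p).add_const c).sqrt h.ne'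
  refine this.congr_deriv ?_
  have := Real.sqrt_pos.2 h
  field_simp
  push_cast
  ring

/-- The derivative of the inverse hyperbolic sine in its logarithmic form. -/
lemma hasDerivAt_log_add_sqrt {k p : ℝ} (hk : 0 < k) (hp : 0 ≤ p) :
    HasDerivAt (fun p => Real.log ((p + √(p ^ 2 + k ^ 2)) / k)) (1 / √(p ^ 2 + k ^ 2)) p := by
  have hpos : 0 < p ^ 2 + k ^ 2 := by positivity
  have hR := Real.sqrt_pos.2 hpos
  have := (((hasDerivAt_id p).add (hasDerivAt_sqrt_sq_add hpos)).div_const k).log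
    (by simp only [id, Pi.add_apply]; positivity)
  refine this.congr_deriv ?_
  simp only [id, Pi.add_apply]
  have : 0 < p + √(p ^ 2 + k ^ 2) := by positivity
  field_simp
  ring

lemma hasDerivAt_log_sqrt_add_sqrt {b k p : ℝ} (hk : 0 < k) (hb : 0 < p ^ 2 + b ^ 2) :
    HasDerivAt (fun p => Real.log ((√(p ^ 2 + b ^ 2) + √(p ^ 2 + (b ^ 2 + k ^ 2))) / k))
      (p / (√(p ^ 2 + b ^ 2) * √(p ^ 2 + (b ^ 2 + k ^ 2)))) p := by
  have hpos : 0 < p ^ 2 + (b ^ 2 + k ^ 2) := by nlinarith [sq_pos_of_pos hk]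
  have hR := Real.sqrt_pos.2 hpos
  have hR2 := Real.sqrt_pos.2 hb
  have := (((hasDerivAt_sqrt_sq_add hb).add (hasDerivAt_sqrt_sq_add hpos)).div_const k).log
    (by simp only [Pi.add_apply]; positivity)
  refine this.congr_deriv ?_
  simp only [Pi.add_apply]
  have : 0 < √(p ^ 2 + b ^ 2) + √(p ^ 2 + (b ^ 2 + k ^ 2)) := by positivity
  field_simp
  ring

lemma tendsto_log_add_sqrt_div {k : ℝ} (hk : 0 < k) :
    Tendsto (fun p => Real.log ((p + √(p ^ 2 + k ^ 2)) / k) / p) (𝓝[>] 0) (𝓝 (1 / k)) := by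
  have := (hasDerivAt_log_add_sqrt hk le_rfl).tendsto_slope_zero_right
  simp only [zero_add, smul_eq_mul, ne_eq, OfNat.ofNat_ne_zero, not_false_eq_true, zero_pow,
    Real.sqrt_sq hk.le, div_self hk.ne', Real.log_one, sub_zero] at this
  simpa only [div_eq_inv_mul, mul_one] using this

/-! ### The primitives F₄, F₃ and F₂ -/

lemma F4_integral {P h4 : ℝ} (hP : 0 < P) (h : 0 ≤ h4) :
    IntervalIntegrable (fun p => p ^ 3 * G4 (√(p ^ 2 + h4 ^ 2))) volume 0 P ∧
    ∫ p in (0 : ℝ)..P, p ^ 3 * G4 (√(p ^ 2 + h4 ^ 2)) = P ^ 4 * F4 P h4 := by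
  have key := integral_eq_of_hasDerivAt_of_tendsto_zero
    (g := fun p => p ^ 3 * G4 (√(p ^ 2 + h4 ^ 2)))
    (W := fun p => 1 / 3 * ((p ^ 2 - 2 * h4 ^ 2) * √(p ^ 2 + h4 ^ 2) + 2 * h4 ^ 3)) ?_ ?_ ?_ hP
  · refine ⟨key.1, key.2.trans ?_⟩
    unfold F4
    field_simp
  · refine tendsto_nhdsWithin_of_tendsto_nhds ?_
    refine Continuous.tendsto' (by fun_prop) _ _ ?_
    rw [zero_pow two_ne_zero, zero_add, Real.sqrt_sq h]
    ring
  · intro p hp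
    have hpos : 0 < p ^ 2 + h4 ^ 2 := by positivity
    have hR := Real.sqrt_pos.2 hpos
    have hsq := Real.sq_sqrt hpos.le
    have := (((((hasDerivAt_pow 2 p).sub_const (2 * h4 ^ 2)).mul
      (hasDerivAt_sqrt_sq_add hpos)).add_const (2 * h4 ^ 3)).const_mul (1 / 3))
    refine this.congr_deriv ?_
    unfold G4
    -- From here only R > 0 and R² = p² + h4² matter, and the claim is an identity of rational
    -- functions.
    generalize √(p ^ 2 + h4 ^ 2) = R at *
    field_simp
    grind
  · intro p hp
    unfold G4
    positivity

/-- At each level the sign of the primitive serves as the sign of the next derivative, which is what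
the half-open fundamental theorem requires. -/
lemma F4_nonneg {P h4 : ℝ} (hP : 0 < P) (h : 0 ≤ h4) : 0 ≤ F4 P h4 := by
  have := (F4_integral hP h).2
  have h0 : 0 ≤ ∫ p in (0 : ℝ)..P, p ^ 3 * G4 (√(p ^ 2 + h4 ^ 2)) :=
    intervalIntegral.integral_nonneg hP.le fun p hp => by
      have := hp.1
      unfold G4; positivity
  rw [this] at h0
  exact nonneg_of_mul_nonneg_right h0 (by positivity)

lemma F4_zero {P : ℝ} (hP : 0 < P) : F4 P 0 = 1 / (3 * P) := by
  unfold F4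
  rw [show P ^ 2 + 0 ^ 2 = P ^ 2 by ring, Real.sqrt_sq hP.le]
  field_simp
  ring

lemma F3_integral {P h3 h4 : ℝ} (hP : 0 < P) (hh3 : 0 ≤ h3) (hh4 : 0 ≤ h4) (h : h3 * h4 = 0) :
    IntervalIntegrable (fun p => p ^ 2 * F4 (√(p ^ 2 + h3 ^ 2)) h4) volume 0 P ∧
    ∫ p in (0 : ℝ)..P, p ^ 2 * F4 (√(p ^ 2 + h3 ^ 2)) h4 = P ^ 3 * F3 P h3 h4 := by
  have hnonneg : ∀ p, 0 < p → 0 ≤ p ^ 2 * F4 (√(p ^ 2 + h3 ^ 2)) h4 := fun p hp =>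
    mul_nonneg (by positivity) (F4_nonneg (by positivity) hh4)
  rcases hh3.eq_or_lt with rfl | h3pos
  · rcases hh4.eq_or_lt with rfl | h4pos
    · have key := integral_eq_of_hasDerivAt_of_tendsto_zero (W := fun p => 1 / 6 * p ^ 2)
        ?_ ?_ hnonneg hP
      · refine ⟨key.1, key.2.trans ?_⟩
        simp only [F3, and_self, if_true]
        field_simp
      · exact tendsto_nhdsWithin_of_tendsto_nhds (Continuous.tendsto' (by fun_prop) _ _ (by simp))
      · intro p hp
        have := (hasDerivAt_pow 2 p).const_mul (1 / 6)
        refine this.congr_deriv ?_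
        rw [show p ^ 2 + 0 ^ 2 = p ^ 2 by ring, Real.sqrt_sq hp.le, F4_zero hp]
        field_simp
        push_cast
        ring
    · have key := integral_eq_of_hasDerivAt_of_tendsto_zero
        (W := fun p => 1 / 6 * (p * √(p ^ 2 + h4 ^ 2)
          - 3 * h4 ^ 2 * Real.log ((p + √(p ^ 2 + h4 ^ 2)) / h4)
          + 4 * h4 ^ 2 * ((√(p ^ 2 + h4 ^ 2) - h4) / p))) ?_ ?_ hnonneg hP
      · refine ⟨key.1, key.2.trans ?_⟩
        simp only [F3, h4pos.ne', and_false, if_false, not_true_eq_false, ne_eq, not_false_eq_true,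
          if_true, and_true]
        field_simp
      -- This is the difference quotient at 0 of p ↦ √(p² + h4²), whose derivative vanishes there.
      · have h1 : Tendsto (fun p : ℝ => (√(p ^ 2 + h4 ^ 2) - h4) / p) (𝓝[>] 0) (𝓝 0) := by
          have := (hasDerivAt_sqrt_sq_add (c := h4 ^ 2) (p := 0) (by positivity)).tendsto_slope_zero_right
          simpa [Real.sqrt_sq h4pos.le, div_eq_inv_mul] using this
        have h2 : Tendsto (fun p : ℝ => Real.log ((p + √(p ^ 2 + h4 ^ 2)) / h4)) (𝓝[>] 0) (𝓝 0) := by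
          have := (hasDerivAt_log_add_sqrt h4pos le_rfl).continuousAt.tendsto
          refine tendsto_nhdsWithin_of_tendsto_nhds ?_
          simpa [Real.sqrt_sq h4pos.le, h4pos.ne'] using this
        have h3 : Tendsto (fun p : ℝ => p * √(p ^ 2 + h4 ^ 2)) (𝓝[>] 0) (𝓝 0) :=
          tendsto_nhdsWithin_of_tendsto_nhds (Continuous.tendsto' (by fun_prop) _ _ (by simp))
        simpa only [mul_zero, sub_zero, add_zero] using ((h3.sub (h2.const_mul (3 * h4 ^ 2))).add
          (h1.const_mul (4 * h4 ^ 2))).const_mul (1 / 6)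
      · intro p hp
        have hpos : 0 < p ^ 2 + h4 ^ 2 := by positivity
        have hR := Real.sqrt_pos.2 hpos
        have hsq := Real.sq_sqrt hpos.le
        have := (((((hasDerivAt_id p).mul (hasDerivAt_sqrt_sq_add hpos)).sub
          ((hasDerivAt_log_add_sqrt h4pos hp.le).const_mul (3 * h4 ^ 2))).add
          ((((hasDerivAt_sqrt_sq_add hpos).sub_const h4).div (hasDerivAt_id p) hp.ne').const_mul
            (4 * h4 ^ 2))).const_mul (1 / 6))
        refine this.congr_deriv ?_
        rw [show p ^ 2 + 0 ^ 2 = p ^ 2 by ring, Real.sqrt_sq hp.le]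
        unfold F4
        simp only [id]
        generalize √(p ^ 2 + h4 ^ 2) = R at *
        field_simp
        grind
  · obtain rfl : h4 = 0 := by simpa [h3pos.ne'] using h
    have key := integral_eq_of_hasDerivAt_of_tendsto_zero
      (W := fun p => 1 / 6 * (p * √(p ^ 2 + h3 ^ 2)
          - h3 ^ 2 * Real.log ((p + √(p ^ 2 + h3 ^ 2)) / h3))) ?_ ?_ hnonneg hP
    · refine ⟨key.1, key.2.trans ?_⟩
      simp only [F3, h3pos.ne', false_and, if_false, not_true_eq_false, ne_eq, not_false_eq_true,
          if_true, and_true]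
      field_simp
    · have h2 : Tendsto (fun p : ℝ => Real.log ((p + √(p ^ 2 + h3 ^ 2)) / h3)) (𝓝[>] 0) (𝓝 0) := by
        have := (hasDerivAt_log_add_sqrt h3pos le_rfl).continuousAt.tendsto
        refine tendsto_nhdsWithin_of_tendsto_nhds ?_
        simpa [Real.sqrt_sq h3pos.le, h3pos.ne'] using this
      have h1 : Tendsto (fun p : ℝ => p * √(p ^ 2 + h3 ^ 2)) (𝓝[>] 0) (𝓝 0) :=
        tendsto_nhdsWithin_of_tendsto_nhds (Continuous.tendsto' (by fun_prop) _ _ (by simp))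
      simpa only [mul_zero, sub_zero] using (h1.sub (h2.const_mul (h3 ^ 2))).const_mul (1 / 6)
    · intro p hp
      have hpos : 0 < p ^ 2 + h3 ^ 2 := by positivity
      have hR := Real.sqrt_pos.2 hpos
      have hsq := Real.sq_sqrt hpos.le
      have := ((((hasDerivAt_id p).mul (hasDerivAt_sqrt_sq_add hpos)).sub
          ((hasDerivAt_log_add_sqrt h3pos hp.le).const_mul (h3 ^ 2))).const_mul (1 / 6))
      refine this.congr_deriv ?_
      rw [F4_zero hR]
      simp only [id]
      generalize √(p ^ 2 + h3 ^ 2) = R at *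
      field_simp
      grind

lemma F3_nonneg {P h3 h4 : ℝ} (hP : 0 < P) (hh3 : 0 ≤ h3) (hh4 : 0 ≤ h4) (h : h3 * h4 = 0) :
    0 ≤ F3 P h3 h4 := by
  have h0 : 0 ≤ ∫ p in (0 : ℝ)..P, p ^ 2 * F4 (√(p ^ 2 + h3 ^ 2)) h4 := by
    -- The sign of the kernel is known only at positive arguments, so the point p = 0 is discarded
    -- as a null set.
    refine intervalIntegral.integral_nonneg_of_ae_restrict hP.le ?_
    rw [Filter.EventuallyLE, ae_restrict_iff' measurableSet_Icc]
    filter_upwards [compl_mem_ae_iff.2 (measure_singleton (0 : ℝ))] with p hp0 hp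
    have : 0 < p := lt_of_le_of_ne hp.1 (Ne.symm hp0)
    exact mul_nonneg (by positivity) (F4_nonneg (by positivity) hh4)
  rw [(F3_integral hP hh3 hh4 h).2] at h0
  exact nonneg_of_mul_nonneg_right h0 (by positivity)

/-- For b > 0 the quotient is continuous at 0; for b = 0 it is a difference quotient of the inverse
hyperbolic sine. Stating both at once lets the cases h2 = 0 and h2 > 0 of F₂ share one
antiderivative. -/
lemma tendsto_log_sqrt_add_sqrt_div {b k : ℝ} (hb : 0 ≤ b) (hk : 0 < k) :
    Tendsto (fun p => Real.log ((√(p ^ 2 + b ^ 2) + √(p ^ 2 + (b ^ 2 + k ^ 2))) / k)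
      / √(p ^ 2 + b ^ 2)) (𝓝[>] 0)
      (𝓝 (if b = 0 then 1 / k else Real.log ((b + √(b ^ 2 + k ^ 2)) / k) / b)) := by
  split_ifs with h
  · subst h
    refine (tendsto_log_add_sqrt_div hk).congr' ?_
    filter_upwards [self_mem_nhdsWithin] with p hp
    have hp : 0 < p := hp
    rw [show p ^ 2 + 0 ^ 2 = p ^ 2 by ring, Real.sqrt_sq hp.le, zero_pow two_ne_zero, zero_add]
  · have hb' : 0 < b := lt_of_le_of_ne hb (Ne.symm h)
    have h1 : ContinuousAt (fun p => Real.log ((√(p ^ 2 + b ^ 2) + √(p ^ 2 + (b ^ 2 + k ^ 2))) / k)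
        / √(p ^ 2 + b ^ 2)) 0 :=
      ((hasDerivAt_log_sqrt_add_sqrt hk (by positivity)).div
        (hasDerivAt_sqrt_sq_add (by positivity)) (by positivity)).continuousAt
    refine tendsto_nhdsWithin_of_tendsto_nhds ?_
    have := h1.tendsto
    simpa only [ne_eq, OfNat.ofNat_ne_zero, not_false_eq_true, zero_pow, zero_add, Real.sqrt_sq hb]
      using this

lemma hasDerivAt_log_sqrt_add_sqrt_div {b k p : ℝ} (hk : 0 < k) (hp : 0 < p) :
    HasDerivAt (fun p => Real.log ((√(p ^ 2 + b ^ 2) + √(p ^ 2 + (b ^ 2 + k ^ 2))) / k)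
      / √(p ^ 2 + b ^ 2))
      (p / (√(p ^ 2 + b ^ 2) ^ 2 * √(p ^ 2 + (b ^ 2 + k ^ 2))) -
        p * Real.log ((√(p ^ 2 + b ^ 2) + √(p ^ 2 + (b ^ 2 + k ^ 2))) / k)
          / √(p ^ 2 + b ^ 2) ^ 3) p := by
  have hpos : 0 < p ^ 2 + b ^ 2 := by positivity
  have hpos' : 0 < p ^ 2 + (b ^ 2 + k ^ 2) := by positivity
  have hR := Real.sqrt_pos.2 hpos
  have hR' := Real.sqrt_pos.2 hpos'
  have := (hasDerivAt_log_sqrt_add_sqrt hk hpos).div (hasDerivAt_sqrt_sq_add hpos) hR.ne'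
  refine this.congr_deriv ?_
  field_simp

lemma F3_zero_zero (P : ℝ) : F3 P 0 0 = 1 / (6 * P) := by simp [F3]

lemma F3_of_h3 {P h3 : ℝ} (h : 0 < h3) :
    F3 P h3 0 = 1 / (6 * P ^ 3) *
      (P * √(P ^ 2 + h3 ^ 2) - h3 ^ 2 * Real.log ((P + √(P ^ 2 + h3 ^ 2)) / h3)) := by
  simp [F3, h.ne']

lemma F3_of_h4 {P h4 : ℝ} (h : 0 < h4) :
    F3 P 0 h4 = 1 / (6 * P ^ 3) *
      (P * √(P ^ 2 + h4 ^ 2) - 3 * h4 ^ 2 * Real.log ((P + √(P ^ 2 + h4 ^ 2)) / h4)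
        + 4 * h4 ^ 2 * ((√(P ^ 2 + h4 ^ 2) - h4) / P)) := by
  simp [F3, h.ne']

lemma sqrt_sq_sqrt_add {p b k : ℝ} :
    √(√(p ^ 2 + b ^ 2) ^ 2 + k ^ 2) = √(p ^ 2 + (b ^ 2 + k ^ 2)) := by
  rw [Real.sq_sqrt (by positivity), add_assoc]

lemma F2_integral {P h2 h3 h4 : ℝ} (hP : 0 < P) (hh2 : 0 ≤ h2) (hh3 : 0 ≤ h3) (hh4 : 0 ≤ h4)
    (h : h3 * h4 = 0) :
    IntervalIntegrable (fun p => p * F3 (√(p ^ 2 + h2 ^ 2)) h3 h4) volume 0 P ∧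
    ∫ p in (0 : ℝ)..P, p * F3 (√(p ^ 2 + h2 ^ 2)) h3 h4 = P ^ 2 * F2 P h2 h3 h4 := by
  have hnonneg : ∀ p, 0 < p → 0 ≤ p * F3 (√(p ^ 2 + h2 ^ 2)) h3 h4 := fun p hp =>
    mul_nonneg hp.le (F3_nonneg (by positivity) hh3 hh4 h)
  rcases hh3.eq_or_lt with rfl | h3pos
  · rcases hh4.eq_or_lt with rfl | h4pos
    · have key := integral_eq_of_hasDerivAt_of_tendsto_zero
        (W := fun p => 1 / 6 * (√(p ^ 2 + h2 ^ 2) - h2)) ?_ ?_ hnonneg hP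
      · refine ⟨key.1, key.2.trans ?_⟩
        rcases hh2.eq_or_lt with rfl | h2pos
        · simp [F2, Real.sqrt_sq hP.le]
          field_simp
        · simp [F2, h2pos.ne']
          field_simp
      · exact tendsto_nhdsWithin_of_tendsto_nhds
          (Continuous.tendsto' (by fun_prop) _ _ (by simp [Real.sqrt_sq hh2]))
      · intro p hp
        have := ((hasDerivAt_sqrt_sq_add (c := h2 ^ 2) (p := p) (by positivity)).sub_const
          h2).const_mul (1 / 6)
        refine this.congr_deriv ?_
        rw [F3_zero_zero]
        ring
    -- The subtracted constant is the limit at 0 of the rest: C₇ if h2 > 0, and 3 h4 if h2 = 0. The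
    -- term (R₄ - h4)/R₂² is written 1/(R₄ + h4), which stays regular when R₂ tends to 0.
    · have key := integral_eq_of_hasDerivAt_of_tendsto_zero
        (W := fun p => 1 / 6 * (√(p ^ 2 + (h2 ^ 2 + h4 ^ 2)) + h4 ^ 2 *
          (3 * (Real.log ((√(p ^ 2 + h2 ^ 2) + √(p ^ 2 + (h2 ^ 2 + h4 ^ 2))) / h4)
            / √(p ^ 2 + h2 ^ 2)) - 2 * (1 / (√(p ^ 2 + (h2 ^ 2 + h4 ^ 2)) + h4))) -
          (√(h2 ^ 2 + h4 ^ 2) + h4 ^ 2 * (3 * (if h2 = 0 then 1 / h4 else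
            Real.log ((h2 + √(h2 ^ 2 + h4 ^ 2)) / h4) / h2)
            - 2 * (1 / (√(h2 ^ 2 + h4 ^ 2) + h4)))))) ?_ ?_ hnonneg hP
      · refine ⟨key.1, key.2.trans ?_⟩
        have hR := Real.sqrt_pos.2 (show 0 < P ^ 2 + (h2 ^ 2 + h4 ^ 2) by positivity)
        have hRsq := Real.sq_sqrt (show 0 ≤ P ^ 2 + (h2 ^ 2 + h4 ^ 2) by positivity)
        have hR2 := Real.sqrt_pos.2 (show 0 < P ^ 2 + h2 ^ 2 by positivity)
        have hR2sq := Real.sq_sqrt (show 0 ≤ P ^ 2 + h2 ^ 2 by positivity)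
        rcases hh2.eq_or_lt with rfl | h2pos
        · rw [zero_pow two_ne_zero, zero_add] at hR hRsq
          simp [F2, h4pos.ne', Real.sqrt_sq hP.le, Real.sqrt_sq h4pos.le]
          generalize √(P ^ 2 + h4 ^ 2) = R at *
          generalize Real.log _ = L at *
          have : 0 < R + h4 := by positivity
          field_simp
          grind
        · simp [F2, h4pos.ne', h2pos.ne']
          simp only [add_assoc]
          have hh := Real.sqrt_pos.2 (show 0 < h2 ^ 2 + h4 ^ 2 by positivity)
          have hhsq := Real.sq_sqrt (show 0 ≤ h2 ^ 2 + h4 ^ 2 by positivity)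
          have e1 : (√(P ^ 2 + (h2 ^ 2 + h4 ^ 2)) + h4)⁻¹
              = (√(P ^ 2 + (h2 ^ 2 + h4 ^ 2)) - h4) / √(P ^ 2 + h2 ^ 2) ^ 2 := by
            generalize √(P ^ 2 + (h2 ^ 2 + h4 ^ 2)) = R at *
            have : 0 < R + h4 := by positivity
            field_simp
            linarith
          have e2 : (√(h2 ^ 2 + h4 ^ 2) + h4)⁻¹ = (√(h2 ^ 2 + h4 ^ 2) - h4) / h2 ^ 2 := by
            generalize √(h2 ^ 2 + h4 ^ 2) = R at hh hhsq ⊢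
            have : 0 < R + h4 := by positivity
            field_simp
            linarith
          rw [e1, e2]
          field_simp
          ring
      · have h1 := tendsto_log_sqrt_add_sqrt_div hh2 h4pos
        have ht : Tendsto (fun p : ℝ => √(p ^ 2 + (h2 ^ 2 + h4 ^ 2))) (𝓝[>] 0)
            (𝓝 (√(h2 ^ 2 + h4 ^ 2))) :=
          tendsto_nhdsWithin_of_tendsto_nhds (Continuous.tendsto' (by fun_prop) _ _ (by simp))
        have h5 : Tendsto (fun p : ℝ => 1 / (√(p ^ 2 + (h2 ^ 2 + h4 ^ 2)) + h4)) (𝓝[>] 0)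
            (𝓝 (1 / (√(h2 ^ 2 + h4 ^ 2) + h4))) :=
          tendsto_const_nhds.div (ht.add_const h4) (by positivity)
        have := ((ht.add (((h1.const_mul 3).sub (h5.const_mul 2)).const_mul (h4 ^ 2))).sub_const
          (√(h2 ^ 2 + h4 ^ 2) + h4 ^ 2 * (3 * (if h2 = 0 then 1 / h4 else
            Real.log ((h2 + √(h2 ^ 2 + h4 ^ 2)) / h4) / h2)
            - 2 * (1 / (√(h2 ^ 2 + h4 ^ 2) + h4))))).const_mul (1 / 6)
        rwa [sub_self, mul_zero] at this
      · intro p hp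
        have hpos : 0 < p ^ 2 + (h2 ^ 2 + h4 ^ 2) := by positivity
        have hR := Real.sqrt_pos.2 hpos
        have hRsq := Real.sq_sqrt hpos.le
        have hR2 := Real.sqrt_pos.2 (show 0 < p ^ 2 + h2 ^ 2 by positivity)
        have hR2sq := Real.sq_sqrt (show 0 ≤ p ^ 2 + h2 ^ 2 by positivity)
        have hs : 0 < √(p ^ 2 + (h2 ^ 2 + h4 ^ 2)) + h4 := by positivity
        have := (((hasDerivAt_sqrt_sq_add hpos).add
          ((((hasDerivAt_log_sqrt_add_sqrt_div (b := h2) h4pos hp).const_mul 3).sub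
            (((hasDerivAt_const p (1 : ℝ)).div ((hasDerivAt_sqrt_sq_add hpos).add_const h4)
              hs.ne').const_mul 2)).const_mul (h4 ^ 2))).sub_const
          (√(h2 ^ 2 + h4 ^ 2) + h4 ^ 2 * (3 * (if h2 = 0 then 1 / h4 else
            Real.log ((h2 + √(h2 ^ 2 + h4 ^ 2)) / h4) / h2)
            - 2 * (1 / (√(h2 ^ 2 + h4 ^ 2) + h4))))).const_mul (1 / 6)
        refine this.congr_deriv ?_
        rw [F3_of_h4 h4pos, sqrt_sq_sqrt_add]
        generalize √(p ^ 2 + (h2 ^ 2 + h4 ^ 2)) = R at *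
        generalize √(p ^ 2 + h2 ^ 2) = R2 at *
        -- The logarithm enters both sides linearly with the same coefficient, so it can be treated
        -- as a free variable.
        generalize Real.log _ = L at *
        field_simp
        grind
  · obtain rfl : h4 = 0 := by simpa [h3pos.ne'] using h
    have key := integral_eq_of_hasDerivAt_of_tendsto_zero
      -- Again the constant is the limit at 0 of the rest: C₅ if h2 > 0, and 2 h3 if h2 = 0.
      (W := fun p => 1 / 6 * (√(p ^ 2 + (h2 ^ 2 + h3 ^ 2)) + h3 ^ 2 *
          (Real.log ((√(p ^ 2 + h2 ^ 2) + √(p ^ 2 + (h2 ^ 2 + h3 ^ 2))) / h3)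
            / √(p ^ 2 + h2 ^ 2)) -
          (√(h2 ^ 2 + h3 ^ 2) + h3 ^ 2 * (if h2 = 0 then 1 / h3 else
            Real.log ((h2 + √(h2 ^ 2 + h3 ^ 2)) / h3) / h2)))) ?_ ?_ hnonneg hP
    · refine ⟨key.1, key.2.trans ?_⟩
      rcases hh2.eq_or_lt with rfl | h2pos
      · simp [F2, h3pos.ne', Real.sqrt_sq hP.le, Real.sqrt_sq h3pos.le]
        field_simp
        ring
      · simp [F2, h3pos.ne', h2pos.ne']
        simp only [add_assoc]
        have hR2 := Real.sqrt_pos.2 (show 0 < P ^ 2 + h2 ^ 2 by positivity)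
        field_simp
        ring
    · have h1 := tendsto_log_sqrt_add_sqrt_div hh2 h3pos
      have ht : Tendsto (fun p : ℝ => √(p ^ 2 + (h2 ^ 2 + h3 ^ 2))) (𝓝[>] 0)
            (𝓝 (√(h2 ^ 2 + h3 ^ 2))) :=
          tendsto_nhdsWithin_of_tendsto_nhds (Continuous.tendsto' (by fun_prop) _ _ (by simp))
      have := ((ht.add (h1.const_mul (h3 ^ 2))).sub_const
          (√(h2 ^ 2 + h3 ^ 2) + h3 ^ 2 * (if h2 = 0 then 1 / h3 else
            Real.log ((h2 + √(h2 ^ 2 + h3 ^ 2)) / h3) / h2))).const_mul (1 / 6)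
      rwa [sub_self, mul_zero] at this
    · intro p hp
      have hpos : 0 < p ^ 2 + (h2 ^ 2 + h3 ^ 2) := by positivity
      have hR := Real.sqrt_pos.2 hpos
      have hRsq := Real.sq_sqrt hpos.le
      have hR2 := Real.sqrt_pos.2 (show 0 < p ^ 2 + h2 ^ 2 by positivity)
      have hR2sq := Real.sq_sqrt (show 0 ≤ p ^ 2 + h2 ^ 2 by positivity)
      have := (((hasDerivAt_sqrt_sq_add hpos).add
          ((hasDerivAt_log_sqrt_add_sqrt_div (b := h2) h3pos hp).const_mul (h3 ^ 2))).sub_const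
          (√(h2 ^ 2 + h3 ^ 2) + h3 ^ 2 * (if h2 = 0 then 1 / h3 else
            Real.log ((h2 + √(h2 ^ 2 + h3 ^ 2)) / h3) / h2))).const_mul (1 / 6)
      refine this.congr_deriv ?_
      rw [F3_of_h3 h3pos, sqrt_sq_sqrt_add]
      generalize √(p ^ 2 + (h2 ^ 2 + h3 ^ 2)) = R at *
      generalize √(p ^ 2 + h2 ^ 2) = R2 at *
      generalize Real.log _ = L at *
      field_simp
      grind

lemma F2_nonneg {P h2 h3 h4 : ℝ} (hP : 0 < P) (hh2 : 0 ≤ h2) (hh3 : 0 ≤ h3) (hh4 : 0 ≤ h4)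
    (h : h3 * h4 = 0) : 0 ≤ F2 P h2 h3 h4 := by
  have h0 : 0 ≤ ∫ p in (0 : ℝ)..P, p * F3 (√(p ^ 2 + h2 ^ 2)) h3 h4 := by
    refine intervalIntegral.integral_nonneg_of_ae_restrict hP.le ?_
    rw [Filter.EventuallyLE, ae_restrict_iff' measurableSet_Icc]
    filter_upwards [compl_mem_ae_iff.2 (measure_singleton (0 : ℝ))] with p hp0 hp
    have : 0 < p := lt_of_le_of_ne hp.1 (Ne.symm hp0)
    exact mul_nonneg this.le (F3_nonneg (by positivity) hh3 hh4 h)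
  rw [(F2_integral hP hh2 hh3 hh4 h).2] at h0
  exact nonneg_of_mul_nonneg_right h0 (by positivity)

/-! ### The terms Φ₂, Φ₃ and Φ₄ of the last primitive -/

lemma hasDerivAt_arctan_div {η k h p : ℝ} (hk : 0 < k) (hh : 0 < h)
    (hsq : h ^ 2 = η ^ 2 + k ^ 2) :
    HasDerivAt (fun p => Real.arctan (η * p / (h ^ 2 + √(p ^ 2 + h ^ 2) * k)))
      (η / (√(p ^ 2 + h ^ 2) * (√(p ^ 2 + h ^ 2) + k))) p := by
  have hpos : 0 < p ^ 2 + h ^ 2 := by positivity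
  have hR := Real.sqrt_pos.2 hpos
  have hRsq := Real.sq_sqrt hpos.le
  have hD : 0 < h ^ 2 + √(p ^ 2 + h ^ 2) * k := by positivity
  have := (((hasDerivAt_id p).const_mul η).div
    (((hasDerivAt_sqrt_sq_add hpos).mul_const k).const_add (h ^ 2)) hD.ne').arctan
  refine this.congr_deriv ?_
  simp only [id, Pi.div_apply]
  generalize √(p ^ 2 + h ^ 2) = R at *
  -- With k² = h² - η² and R² = p² + h², the sum (h² + R k)² + η² p² factors as h² (R + k)²; this is
  -- why the derivative of the arctangent is so simple.
  have h1 : 1 + (η * p / (h ^ 2 + R * k)) ^ 2 = h ^ 2 * (R + k) ^ 2 / (h ^ 2 + R * k) ^ 2 := by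
    have : η ^ 2 = h ^ 2 - k ^ 2 := by linarith
    have : p ^ 2 = R ^ 2 - h ^ 2 := by linarith
    field_simp
    grind
  rw [h1]
  have : 0 < R + k := by positivity
  field_simp
  grind

lemma tendsto_arctan_div {η k h : ℝ} (hk : 0 < k) (hh : 0 < h)
    (hsq : h ^ 2 = η ^ 2 + k ^ 2) :
    Tendsto (fun p => Real.arctan (η * p / (h ^ 2 + √(p ^ 2 + h ^ 2) * k))) (𝓝[>] 0) (𝓝 0) := by
  have := (hasDerivAt_arctan_div (p := 0) hk hh hsq).continuousAt.tendsto
  refine tendsto_nhdsWithin_of_tendsto_nhds ?_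
  simpa using this

lemma tendsto_log_add_sqrt {k : ℝ} (hk : 0 < k) :
    Tendsto (fun p => Real.log ((p + √(p ^ 2 + k ^ 2)) / k)) (𝓝[>] 0) (𝓝 0) := by
  have := (hasDerivAt_log_add_sqrt hk le_rfl).continuousAt.tendsto
  refine tendsto_nhdsWithin_of_tendsto_nhds ?_
  simpa [Real.sqrt_sq hk.le, hk.ne'] using this

lemma tendsto_mul_log_sqrt_add_sqrt_div {b k : ℝ} (hb : 0 ≤ b) (hk : 0 < k) :
    Tendsto (fun p => p * (Real.log ((√(p ^ 2 + b ^ 2) + √(p ^ 2 + (b ^ 2 + k ^ 2))) / k)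
      / √(p ^ 2 + b ^ 2))) (𝓝[>] 0) (𝓝 0) := by
  have h0 : Tendsto (fun p : ℝ => p) (𝓝[>] 0) (𝓝 0) :=
    tendsto_nhdsWithin_of_tendsto_nhds tendsto_id
  simpa using h0.mul (tendsto_log_sqrt_add_sqrt_div hb hk)

/-- The function `P Φ₄`. -/
lemma hasDerivAt_sqrt_mul_log {b k p : ℝ} (hk : 0 < k) (hb : 0 < b) :
    HasDerivAt (fun p => √(p ^ 2 + b ^ 2) / b *
        Real.log ((√(p ^ 2 + b ^ 2) + √(p ^ 2 + (b ^ 2 + k ^ 2))) / k)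
        - Real.log ((b + √(b ^ 2 + k ^ 2)) / k))
      (p / (√(p ^ 2 + b ^ 2) * b) *
        Real.log ((√(p ^ 2 + b ^ 2) + √(p ^ 2 + (b ^ 2 + k ^ 2))) / k)
        + p / (b * √(p ^ 2 + (b ^ 2 + k ^ 2)))) p := by
  have hpos : 0 < p ^ 2 + b ^ 2 := by positivity
  have hpos' : 0 < p ^ 2 + (b ^ 2 + k ^ 2) := by positivity
  have hR := Real.sqrt_pos.2 hpos
  have hR' := Real.sqrt_pos.2 hpos'
  have := (((hasDerivAt_sqrt_sq_add hpos).div_const b).mul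
    (hasDerivAt_log_sqrt_add_sqrt hk hpos)).sub_const (Real.log ((b + √(b ^ 2 + k ^ 2)) / k))
  refine this.congr_deriv ?_
  field_simp

/-- A difference quotient at 0 of a function even in p, hence with derivative 0 there. -/
lemma tendsto_sqrt_mul_log_div {b k : ℝ} (hk : 0 < k) (hb : 0 < b) :
    Tendsto (fun p => (√(p ^ 2 + b ^ 2) / b *
        Real.log ((√(p ^ 2 + b ^ 2) + √(p ^ 2 + (b ^ 2 + k ^ 2))) / k)
        - Real.log ((b + √(b ^ 2 + k ^ 2)) / k)) / p) (𝓝[>] 0) (𝓝 0) := by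
  have := (hasDerivAt_sqrt_mul_log (p := 0) hk hb).tendsto_slope_zero_right
  simpa [Real.sqrt_sq hb.le, hb.ne', div_eq_inv_mul] using this

lemma F2_zero_zero_zero {P : ℝ} : F2 P 0 0 0 = 1 / (6 * P) := by simp [F2]

lemma F2_of_h2 {P h2 : ℝ} (h : 0 < h2) : F2 P h2 0 0 = (√(P ^ 2 + h2 ^ 2) - h2) / (6 * P ^ 2) := by
  simp [F2, h.ne']

lemma F2_of_h3 {P h3 : ℝ} (h : 0 < h3) :
    F2 P 0 h3 0 = 1 / (6 * P ^ 2) * (√(P ^ 2 + h3 ^ 2) - 2 * h3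
      + h3 ^ 2 / P * Real.log ((P + √(P ^ 2 + h3 ^ 2)) / h3)) := by
  simp [F2, h.ne']

lemma F2_of_h4 {P h4 : ℝ} (h : 0 < h4) :
    F2 P 0 0 h4 = 1 / (6 * P ^ 2) * (√(P ^ 2 + h4 ^ 2) - 3 * h4
      + h4 ^ 2 * (3 / P * Real.log ((P + √(P ^ 2 + h4 ^ 2)) / h4)
        - 2 * ((√(P ^ 2 + h4 ^ 2) - h4) / P ^ 2))) := by
  simp [F2, h.ne']

lemma F2_of_h2_h3 {P h2 h3 h : ℝ} (hh2 : 0 < h2) (hh3 : 0 < h3) (hh : 0 < h)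
    (hsq : h ^ 2 = h2 ^ 2 + h3 ^ 2) :
    F2 P h2 h3 0 = 1 / (6 * P ^ 2) * (√(P ^ 2 + h ^ 2)
      - (h + h3 ^ 2 / h2 * Real.log ((h2 + h) / h3)) + h3 ^ 2 / √(P ^ 2 + h2 ^ 2) *
        Real.log ((√(P ^ 2 + h2 ^ 2) + √(P ^ 2 + h ^ 2)) / h3)) := by
  simp [F2, hh2.ne', hh3.ne', Real.sqrt_sq hh.le, add_assoc, ← hsq]

lemma F2_of_h2_h4 {P h2 h4 h : ℝ} (hh2 : 0 < h2) (hh4 : 0 < h4) (hh : 0 < h)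
    (hsq : h ^ 2 = h2 ^ 2 + h4 ^ 2) :
    F2 P h2 0 h4 = 1 / (6 * P ^ 2) * (√(P ^ 2 + h ^ 2)
      - (h + h4 ^ 2 * (3 / h2 * Real.log ((h2 + h) / h4) - 2 * ((h - h4) / h2 ^ 2)))
      + h4 ^ 2 * (3 / √(P ^ 2 + h2 ^ 2) *
        Real.log ((√(P ^ 2 + h2 ^ 2) + √(P ^ 2 + h ^ 2)) / h4)
        - 2 * ((√(P ^ 2 + h ^ 2) - h4) / √(P ^ 2 + h2 ^ 2) ^ 2))) := by
  simp [F2, hh2.ne', hh4.ne', Real.sqrt_sq hh.le, add_assoc, ← hsq]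

/-! ### The seven cases of F₁ -/

lemma F1_integral_of_h1 {P h1 : ℝ} (hP : 0 < P) (hh1 : 0 < h1) :
    IntervalIntegrable (fun p => F2 (√(p ^ 2 + h1 ^ 2)) 0 0 0) volume 0 P ∧
    ∫ p in (0 : ℝ)..P, F2 (√(p ^ 2 + h1 ^ 2)) 0 0 0 = P * F1 P h1 0 0 0 := by
  have key := integral_eq_of_hasDerivAt_of_tendsto_zero
    (g := fun p => F2 (√(p ^ 2 + h1 ^ 2)) 0 0 0)
    (W := fun p => 1 / 6 * Real.log ((p + √(p ^ 2 + h1 ^ 2)) / h1)) ?_ ?_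
    (fun p hp => F2_nonneg (by positivity) le_rfl le_rfl le_rfl (by simp)) hP
  · refine ⟨key.1, key.2.trans ?_⟩
    have e : √(h1 ^ 2 + 0 ^ 2 + 0 ^ 2 + 0 ^ 2) = h1 := by simp [Real.sqrt_sq hh1.le]
    simp only [F1, e]
    simp [hCase, hh1.ne']
    field_simp
  · simpa only [mul_zero] using (tendsto_log_add_sqrt hh1).const_mul (1 / 6)
  · intro p hp
    refine ((hasDerivAt_log_add_sqrt hh1 hp.le).const_mul (1 / 6)).congr_deriv ?_
    rw [F2_zero_zero_zero]
    field_simp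

lemma sqrt_sq_add_zero_sq {p : ℝ} (hp : 0 < p) : √(p ^ 2 + 0 ^ 2) = p := by
  rw [zero_pow two_ne_zero, add_zero, Real.sqrt_sq hp.le]

lemma F1_integral_of_h2 {P h2 : ℝ} (hP : 0 < P) (hh2 : 0 < h2) :
    IntervalIntegrable (fun p => F2 (√(p ^ 2 + 0 ^ 2)) h2 0 0) volume 0 P ∧
    ∫ p in (0 : ℝ)..P, F2 (√(p ^ 2 + 0 ^ 2)) h2 0 0 = P * F1 P 0 h2 0 0 := by
  have key := integral_eq_of_hasDerivAt_of_tendsto_zero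
    (g := fun p => F2 (√(p ^ 2 + 0 ^ 2)) h2 0 0)
    (W := fun p => 1 / 6 * (Real.log ((p + √(p ^ 2 + h2 ^ 2)) / h2)
      - p / (√(p ^ 2 + h2 ^ 2) + h2))) ?_ ?_
    (fun p hp => F2_nonneg (by positivity) hh2.le le_rfl le_rfl (by simp)) hP
  · refine ⟨key.1, key.2.trans ?_⟩
    have e : √(0 ^ 2 + h2 ^ 2 + 0 ^ 2 + 0 ^ 2) = h2 := by simp [Real.sqrt_sq hh2.le]
    simp only [F1, e]
    simp [hCase, hh2.ne']
    field_simp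
  · have h1 : Tendsto (fun p => p / (√(p ^ 2 + h2 ^ 2) + h2)) (𝓝[>] 0) (𝓝 0) := by
      refine tendsto_nhdsWithin_of_tendsto_nhds (Continuous.tendsto' ?_ _ _ (by simp))
      exact continuous_id.div (by fun_prop) fun p => by positivity
    simpa only [mul_zero, sub_zero] using ((tendsto_log_add_sqrt hh2).sub h1).const_mul (1 / 6)
  · intro p hp
    have hpos : 0 < p ^ 2 + h2 ^ 2 := by positivity
    have hR := Real.sqrt_pos.2 hpos
    have hRsq := Real.sq_sqrt hpos.le
    have hs : 0 < √(p ^ 2 + h2 ^ 2) + h2 := by positivity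
    refine (((hasDerivAt_log_add_sqrt hh2 hp.le).sub ((hasDerivAt_id p).div
      ((hasDerivAt_sqrt_sq_add hpos).add_const h2) hs.ne')).const_mul (1 / 6)).congr_deriv ?_
    rw [sqrt_sq_add_zero_sq hp, F2_of_h2 hh2]
    simp only [id]
    generalize √(p ^ 2 + h2 ^ 2) = R at *
    field_simp
    grind

lemma F1_integral_of_h1_h2 {P h1 h2 : ℝ} (hP : 0 < P) (hh1 : 0 < h1) (hh2 : 0 < h2) :
    IntervalIntegrable (fun p => F2 (√(p ^ 2 + h1 ^ 2)) h2 0 0) volume 0 P ∧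
    ∫ p in (0 : ℝ)..P, F2 (√(p ^ 2 + h1 ^ 2)) h2 0 0 = P * F1 P h1 h2 0 0 := by
  obtain ⟨h, hh, hsq⟩ : ∃ h, 0 < h ∧ h ^ 2 = h1 ^ 2 + h2 ^ 2 :=
    ⟨√(h1 ^ 2 + h2 ^ 2), by positivity, Real.sq_sqrt (by positivity)⟩
  have key := integral_eq_of_hasDerivAt_of_tendsto_zero
    (g := fun p => F2 (√(p ^ 2 + h1 ^ 2)) h2 0 0)
    (W := fun p => 1 / 6 * (Real.log ((p + √(p ^ 2 + h ^ 2)) / h)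
      - h2 / h1 * Real.arctan (h1 * p / (h ^ 2 + √(p ^ 2 + h ^ 2) * h2)))) ?_ ?_
    (fun p hp => F2_nonneg (by positivity) hh2.le le_rfl le_rfl (by simp)) hP
  · refine ⟨key.1, key.2.trans ?_⟩
    have e : √(h1 ^ 2 + h2 ^ 2 + 0 ^ 2 + 0 ^ 2) = h := by simp [← hsq, Real.sqrt_sq hh.le]
    have e' : √(h ^ 2 - h1 ^ 2) = h2 := by simp [hsq, Real.sqrt_sq hh2.le]
    simp only [F1, e, e']
    simp [hCase, hh1.ne', hh2.ne']
    field_simp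
  · simpa only [mul_zero, sub_zero] using ((tendsto_log_add_sqrt hh).sub
      ((tendsto_arctan_div hh2 hh hsq).const_mul (h2 / h1))).const_mul (1 / 6)
  · intro p hp
    have hpos : 0 < p ^ 2 + h ^ 2 := by positivity
    have hR := Real.sqrt_pos.2 hpos
    have hRsq := Real.sq_sqrt hpos.le
    have hR1 := Real.sqrt_pos.2 (show 0 < p ^ 2 + h1 ^ 2 by positivity)
    have hR1sq := Real.sq_sqrt (show 0 ≤ p ^ 2 + h1 ^ 2 by positivity)
    have hs : 0 < √(p ^ 2 + h ^ 2) + h2 := by positivity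
    refine (((hasDerivAt_log_add_sqrt hh hp.le).sub
      ((hasDerivAt_arctan_div hh2 hh hsq).const_mul (h2 / h1))).const_mul (1 / 6)).congr_deriv ?_
    rw [F2_of_h2 hh2, sqrt_sq_sqrt_add, ← hsq]
    generalize √(p ^ 2 + h ^ 2) = R at *
    generalize √(p ^ 2 + h1 ^ 2) = R1 at *
    field_simp
    grind

lemma F1_integral_of_h1_h3 {P h1 h3 : ℝ} (hP : 0 < P) (hh1 : 0 < h1) (hh3 : 0 < h3) :
    IntervalIntegrable (fun p => F2 (√(p ^ 2 + h1 ^ 2)) 0 h3 0) volume 0 P ∧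
    ∫ p in (0 : ℝ)..P, F2 (√(p ^ 2 + h1 ^ 2)) 0 h3 0 = P * F1 P h1 0 h3 0 := by
  obtain ⟨h, hh, hsq⟩ : ∃ h, 0 < h ∧ h ^ 2 = h1 ^ 2 + h3 ^ 2 :=
    ⟨√(h1 ^ 2 + h3 ^ 2), by positivity, Real.sq_sqrt (by positivity)⟩
  have key := integral_eq_of_hasDerivAt_of_tendsto_zero
    (g := fun p => F2 (√(p ^ 2 + h1 ^ 2)) 0 h3 0)
    (W := fun p => 1 / 6 * ((1 - h3 ^ 2 / h1 ^ 2) * Real.log ((p + √(p ^ 2 + h ^ 2)) / h)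
      - 2 * h3 / h1 * Real.arctan (h1 * p / (h ^ 2 + √(p ^ 2 + h ^ 2) * h3))
      + h3 ^ 2 / h1 ^ 2 * (p * (Real.log ((√(p ^ 2 + h1 ^ 2) + √(p ^ 2 + h ^ 2)) / h3)
        / √(p ^ 2 + h1 ^ 2))))) ?_ ?_
    (fun p hp => F2_nonneg (by positivity) le_rfl hh3.le le_rfl (by simp)) hP
  · refine ⟨key.1, key.2.trans ?_⟩
    have e : √(h1 ^ 2 + 0 ^ 2 + h3 ^ 2 + 0 ^ 2) = h := by simp [← hsq, Real.sqrt_sq hh.le]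
    have e' : √(h ^ 2 - h1 ^ 2) = h3 := by simp [hsq, Real.sqrt_sq hh3.le]
    simp only [F1, e, e']
    simp [hCase, hh1.ne', hh3.ne']
    field_simp
  · have := tendsto_mul_log_sqrt_add_sqrt_div hh1.le hh3
    rw [← hsq] at this
    simpa only [mul_zero, sub_zero, add_zero] using
      ((((tendsto_log_add_sqrt hh).const_mul (1 - h3 ^ 2 / h1 ^ 2)).sub
      ((tendsto_arctan_div hh3 hh hsq).const_mul (2 * h3 / h1))).add
      (this.const_mul (h3 ^ 2 / h1 ^ 2))).const_mul (1 / 6)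
  · intro p hp
    have hpos : 0 < p ^ 2 + h ^ 2 := by positivity
    have hR := Real.sqrt_pos.2 hpos
    have hRsq := Real.sq_sqrt hpos.le
    have hR1 := Real.sqrt_pos.2 (show 0 < p ^ 2 + h1 ^ 2 by positivity)
    have hR1sq := Real.sq_sqrt (show 0 ≤ p ^ 2 + h1 ^ 2 by positivity)
    have hs : 0 < √(p ^ 2 + h ^ 2) + h3 := by positivity
    have hL := hasDerivAt_log_sqrt_add_sqrt_div (b := h1) hh3 hp
    rw [← hsq] at hL
    refine (((((hasDerivAt_log_add_sqrt hh hp.le).const_mul (1 - h3 ^ 2 / h1 ^ 2)).sub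
      ((hasDerivAt_arctan_div hh3 hh hsq).const_mul (2 * h3 / h1))).add
      (((hasDerivAt_id p).mul hL).const_mul (h3 ^ 2 / h1 ^ 2))).const_mul (1 / 6)).congr_deriv ?_
    rw [F2_of_h3 hh3, sqrt_sq_sqrt_add, ← hsq]
    simp only [id]
    generalize √(p ^ 2 + h ^ 2) = R at *
    generalize √(p ^ 2 + h1 ^ 2) = R1 at *
    generalize Real.log _ = L at *
    field_simp
    grind

lemma F1_integral_of_h2_h3 {P h2 h3 : ℝ} (hP : 0 < P) (hh2 : 0 < h2) (hh3 : 0 < h3) :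
    IntervalIntegrable (fun p => F2 (√(p ^ 2 + 0 ^ 2)) h2 h3 0) volume 0 P ∧
    ∫ p in (0 : ℝ)..P, F2 (√(p ^ 2 + 0 ^ 2)) h2 h3 0 = P * F1 P 0 h2 h3 0 := by
  obtain ⟨h, hh, hsq⟩ : ∃ h, 0 < h ∧ h ^ 2 = h2 ^ 2 + h3 ^ 2 :=
    ⟨√(h2 ^ 2 + h3 ^ 2), by positivity, Real.sq_sqrt (by positivity)⟩
  have key := integral_eq_of_hasDerivAt_of_tendsto_zero
    (g := fun p => F2 (√(p ^ 2 + 0 ^ 2)) h2 h3 0)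
    (W := fun p => 1 / 6 * (h ^ 2 / h2 ^ 2 * Real.log ((p + √(p ^ 2 + h ^ 2)) / h)
      - p / (√(p ^ 2 + h ^ 2) + h)
      - h3 ^ 2 / h2 * ((√(p ^ 2 + h2 ^ 2) / h2 *
        Real.log ((√(p ^ 2 + h2 ^ 2) + √(p ^ 2 + h ^ 2)) / h3)
        - Real.log ((h2 + h) / h3)) / p))) ?_ ?_
    (fun p hp => F2_nonneg (by positivity) hh2.le hh3.le le_rfl (by simp)) hP
  · refine ⟨key.1, key.2.trans ?_⟩
    have e : √(0 ^ 2 + h2 ^ 2 + h3 ^ 2 + 0 ^ 2) = h := by simp [← hsq, Real.sqrt_sq hh.le]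
    simp only [F1, e]
    simp [hCase, hh2.ne', hh3.ne']
    field_simp
  · have h1 : Tendsto (fun p => p / (√(p ^ 2 + h ^ 2) + h)) (𝓝[>] 0) (𝓝 0) := by
      refine tendsto_nhdsWithin_of_tendsto_nhds (Continuous.tendsto' ?_ _ _ (by simp))
      exact continuous_id.div (by fun_prop) fun p => by positivity
    have := tendsto_sqrt_mul_log_div hh3 hh2
    rw [← hsq, Real.sqrt_sq hh.le] at this
    simpa only [mul_zero, sub_zero] using ((((tendsto_log_add_sqrt hh).const_mul
      (h ^ 2 / h2 ^ 2)).sub h1).sub (this.const_mul (h3 ^ 2 / h2))).const_mul (1 / 6)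
  · intro p hp
    have hpos : 0 < p ^ 2 + h ^ 2 := by positivity
    have hR := Real.sqrt_pos.2 hpos
    have hRsq := Real.sq_sqrt hpos.le
    have hR2 := Real.sqrt_pos.2 (show 0 < p ^ 2 + h2 ^ 2 by positivity)
    have hR2sq := Real.sq_sqrt (show 0 ≤ p ^ 2 + h2 ^ 2 by positivity)
    have hs : 0 < √(p ^ 2 + h ^ 2) + h := by positivity
    have hL := hasDerivAt_sqrt_mul_log (p := p) hh3 hh2
    rw [← hsq, Real.sqrt_sq hh.le] at hL
    refine (((((hasDerivAt_log_add_sqrt hh hp.le).const_mul (h ^ 2 / h2 ^ 2)).sub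
      ((hasDerivAt_id p).div ((hasDerivAt_sqrt_sq_add hpos).add_const h) hs.ne')).sub
      ((hL.div (hasDerivAt_id p) hp.ne').const_mul (h3 ^ 2 / h2))).const_mul (1 / 6)).congr_deriv ?_
    rw [sqrt_sq_add_zero_sq hp, F2_of_h2_h3 hh2 hh3 hh hsq]
    simp only [id]
    generalize √(p ^ 2 + h ^ 2) = R at *
    generalize √(p ^ 2 + h2 ^ 2) = R2 at *
    generalize Real.log ((R2 + R) / h3) = L at *
    generalize Real.log _ = l at *
    field_simp
    grind

lemma F1_integral_of_h1_h4 {P h1 h4 : ℝ} (hP : 0 < P) (hh1 : 0 < h1) (hh4 : 0 < h4) :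
    IntervalIntegrable (fun p => F2 (√(p ^ 2 + h1 ^ 2)) 0 0 h4) volume 0 P ∧
    ∫ p in (0 : ℝ)..P, F2 (√(p ^ 2 + h1 ^ 2)) 0 0 h4 = P * F1 P h1 0 0 h4 := by
  obtain ⟨h, hh, hsq⟩ : ∃ h, 0 < h ∧ h ^ 2 = h1 ^ 2 + h4 ^ 2 :=
    ⟨√(h1 ^ 2 + h4 ^ 2), by positivity, Real.sq_sqrt (by positivity)⟩
  have key := integral_eq_of_hasDerivAt_of_tendsto_zero
    (g := fun p => F2 (√(p ^ 2 + h1 ^ 2)) 0 0 h4)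
    (W := fun p => 1 / 6 * ((1 - 3 * h4 ^ 2 / h1 ^ 2) * Real.log ((p + √(p ^ 2 + h ^ 2)) / h)
      - (3 - h4 ^ 2 / h1 ^ 2) * (h4 / h1) *
        Real.arctan (h1 * p / (h ^ 2 + √(p ^ 2 + h ^ 2) * h4))
      + 3 * (h4 ^ 2 / h1 ^ 2) * (p * (Real.log ((√(p ^ 2 + h1 ^ 2) + √(p ^ 2 + h ^ 2)) / h4)
        / √(p ^ 2 + h1 ^ 2)))
      - h4 ^ 2 / h1 ^ 2 * (p / (√(p ^ 2 + h ^ 2) + h4)))) ?_ ?_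
    (fun p hp => F2_nonneg (by positivity) le_rfl le_rfl hh4.le (by simp)) hP
  · refine ⟨key.1, key.2.trans ?_⟩
    have e : √(h1 ^ 2 + 0 ^ 2 + 0 ^ 2 + h4 ^ 2) = h := by simp [← hsq, Real.sqrt_sq hh.le]
    have e' : √(h ^ 2 - h1 ^ 2) = h4 := by simp [hsq, Real.sqrt_sq hh4.le]
    simp only [F1, e, e']
    simp [hCase, hh1.ne', hh4.ne']
    field_simp
  · have := tendsto_mul_log_sqrt_add_sqrt_div hh1.le hh4
    rw [← hsq] at this
    have h1' : Tendsto (fun p => p / (√(p ^ 2 + h ^ 2) + h4)) (𝓝[>] 0) (𝓝 0) := by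
      refine tendsto_nhdsWithin_of_tendsto_nhds (Continuous.tendsto' ?_ _ _ (by simp))
      exact continuous_id.div (by fun_prop) fun p => by positivity
    simpa only [mul_zero, sub_zero, add_zero] using
      (((((tendsto_log_add_sqrt hh).const_mul (1 - 3 * h4 ^ 2 / h1 ^ 2)).sub
      ((tendsto_arctan_div hh4 hh hsq).const_mul ((3 - h4 ^ 2 / h1 ^ 2) * (h4 / h1)))).add
      (this.const_mul (3 * (h4 ^ 2 / h1 ^ 2)))).sub
      (h1'.const_mul (h4 ^ 2 / h1 ^ 2))).const_mul (1 / 6)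
  · intro p hp
    have hpos : 0 < p ^ 2 + h ^ 2 := by positivity
    have hR := Real.sqrt_pos.2 hpos
    have hRsq := Real.sq_sqrt hpos.le
    have hR1 := Real.sqrt_pos.2 (show 0 < p ^ 2 + h1 ^ 2 by positivity)
    have hR1sq := Real.sq_sqrt (show 0 ≤ p ^ 2 + h1 ^ 2 by positivity)
    have hs : 0 < √(p ^ 2 + h ^ 2) + h4 := by positivity
    have hL := hasDerivAt_log_sqrt_add_sqrt_div (b := h1) hh4 hp
    rw [← hsq] at hL
    refine ((((((hasDerivAt_log_add_sqrt hh hp.le).const_mul (1 - 3 * h4 ^ 2 / h1 ^ 2)).sub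
      ((hasDerivAt_arctan_div hh4 hh hsq).const_mul ((3 - h4 ^ 2 / h1 ^ 2) * (h4 / h1)))).add
      (((hasDerivAt_id p).mul hL).const_mul (3 * (h4 ^ 2 / h1 ^ 2)))).sub
      (((hasDerivAt_id p).div ((hasDerivAt_sqrt_sq_add hpos).add_const h4) hs.ne').const_mul
        (h4 ^ 2 / h1 ^ 2))).const_mul (1 / 6)).congr_deriv ?_
    rw [F2_of_h4 hh4, sqrt_sq_sqrt_add, ← hsq]
    simp only [id]
    generalize √(p ^ 2 + h ^ 2) = R at *
    generalize √(p ^ 2 + h1 ^ 2) = R1 at *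
    generalize Real.log _ = L at *
    have e1 : R1 ^ 2 = R ^ 2 - h4 ^ 2 := by linarith
    have e2 : h1 ^ 2 = h ^ 2 - h4 ^ 2 := by linarith
    have e3 : p ^ 2 = R ^ 2 - h ^ 2 := by linarith
    field_simp
    grind

lemma F1_integral_of_h2_h4 {P h2 h4 : ℝ} (hP : 0 < P) (hh2 : 0 < h2) (hh4 : 0 < h4) :
    IntervalIntegrable (fun p => F2 (√(p ^ 2 + 0 ^ 2)) h2 0 h4) volume 0 P ∧
    ∫ p in (0 : ℝ)..P, F2 (√(p ^ 2 + 0 ^ 2)) h2 0 h4 = P * F1 P 0 h2 0 h4 := by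
  obtain ⟨h, hh, hsq⟩ : ∃ h, 0 < h ∧ h ^ 2 = h2 ^ 2 + h4 ^ 2 :=
    ⟨√(h2 ^ 2 + h4 ^ 2), by positivity, Real.sq_sqrt (by positivity)⟩
  have key := integral_eq_of_hasDerivAt_of_tendsto_zero
    (g := fun p => F2 (√(p ^ 2 + 0 ^ 2)) h2 0 h4)
    (W := fun p => 1 / 6 * ((1 + 3 * h4 ^ 2 / h2 ^ 2) * Real.log ((p + √(p ^ 2 + h ^ 2)) / h)
      - 2 * h4 ^ 3 / h2 ^ 3 * Real.arctan (h2 * p / (h ^ 2 + √(p ^ 2 + h ^ 2) * h4))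
      - 3 * (h4 ^ 2 / h2) * ((√(p ^ 2 + h2 ^ 2) / h2 *
        Real.log ((√(p ^ 2 + h2 ^ 2) + √(p ^ 2 + h ^ 2)) / h4)
        - Real.log ((h2 + h) / h4)) / p)
      + (2 * h4 ^ 2 - h2 ^ 2) / h2 ^ 2 * (p / (√(p ^ 2 + h ^ 2) + h)))) ?_ ?_
    (fun p hp => F2_nonneg (by positivity) hh2.le le_rfl hh4.le (by simp)) hP
  · refine ⟨key.1, key.2.trans ?_⟩
    have e : √(0 ^ 2 + h2 ^ 2 + 0 ^ 2 + h4 ^ 2) = h := by simp [← hsq, Real.sqrt_sq hh.le]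
    have e' : √(h ^ 2 - h2 ^ 2) = h4 := by simp [hsq, Real.sqrt_sq hh4.le]
    simp only [F1, e, e']
    simp [hCase, hh2.ne', hh4.ne']
    field_simp
  · have h1 : Tendsto (fun p => p / (√(p ^ 2 + h ^ 2) + h)) (𝓝[>] 0) (𝓝 0) := by
      refine tendsto_nhdsWithin_of_tendsto_nhds (Continuous.tendsto' ?_ _ _ (by simp))
      exact continuous_id.div (by fun_prop) fun p => by positivity
    have := tendsto_sqrt_mul_log_div hh4 hh2
    rw [← hsq, Real.sqrt_sq hh.le] at this
    simpa only [mul_zero, sub_zero, add_zero] using (((((tendsto_log_add_sqrt hh).const_mul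
      (1 + 3 * h4 ^ 2 / h2 ^ 2)).sub
      ((tendsto_arctan_div hh4 hh hsq).const_mul (2 * h4 ^ 3 / h2 ^ 3))).sub
      (this.const_mul (3 * (h4 ^ 2 / h2)))).add
      (h1.const_mul ((2 * h4 ^ 2 - h2 ^ 2) / h2 ^ 2))).const_mul (1 / 6)
  · intro p hp
    have hpos : 0 < p ^ 2 + h ^ 2 := by positivity
    have hR := Real.sqrt_pos.2 hpos
    have hRsq := Real.sq_sqrt hpos.le
    have hR2 := Real.sqrt_pos.2 (show 0 < p ^ 2 + h2 ^ 2 by positivity)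
    have hR2sq := Real.sq_sqrt (show 0 ≤ p ^ 2 + h2 ^ 2 by positivity)
    have hs : 0 < √(p ^ 2 + h ^ 2) + h := by positivity
    have hL := hasDerivAt_sqrt_mul_log (p := p) hh4 hh2
    rw [← hsq, Real.sqrt_sq hh.le] at hL
    refine ((((((hasDerivAt_log_add_sqrt hh hp.le).const_mul (1 + 3 * h4 ^ 2 / h2 ^ 2)).sub
      ((hasDerivAt_arctan_div hh4 hh hsq).const_mul (2 * h4 ^ 3 / h2 ^ 3))).sub
      ((hL.div (hasDerivAt_id p) hp.ne').const_mul (3 * (h4 ^ 2 / h2)))).add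
      (((hasDerivAt_id p).div ((hasDerivAt_sqrt_sq_add hpos).add_const h) hs.ne').const_mul
        ((2 * h4 ^ 2 - h2 ^ 2) / h2 ^ 2))).const_mul (1 / 6)).congr_deriv ?_
    rw [sqrt_sq_add_zero_sq hp, F2_of_h2_h4 hh2 hh4 hh hsq]
    simp only [id]
    generalize √(p ^ 2 + h ^ 2) = R at *
    generalize √(p ^ 2 + h2 ^ 2) = R2 at *
    generalize Real.log ((R2 + R) / h4) = L at *
    generalize Real.log _ = l at *
    have e1 : R2 ^ 2 = R ^ 2 - h4 ^ 2 := by linarith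
    have e2 : h2 ^ 2 = h ^ 2 - h4 ^ 2 := by linarith
    have e3 : p ^ 2 = R ^ 2 - h ^ 2 := by linarith
    field_simp
    grind

lemma F1_integral {P h1 h2 h3 h4 : ℝ} (hP : 0 < P) (hh1 : 0 ≤ h1) (hh2 : 0 ≤ h2) (hh3 : 0 ≤ h3)
    (hh4 : 0 ≤ h4) (h : ∃ k, hCase k h1 h2 h3 h4) :
    IntervalIntegrable (fun p => F2 (√(p ^ 2 + h1 ^ 2)) h2 h3 h4) volume 0 P ∧
    ∫ p in (0 : ℝ)..P, F2 (√(p ^ 2 + h1 ^ 2)) h2 h3 h4 = P * F1 P h1 h2 h3 h4 := by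
  obtain ⟨k, hk⟩ := h
  fin_cases k <;> simp only [hCase, ne_eq] at hk
  · obtain ⟨rfl, rfl, rfl, h⟩ := hk
    exact F1_integral_of_h1 hP (lt_of_le_of_ne hh1 (Ne.symm h))
  · obtain ⟨rfl, rfl, rfl, h⟩ := hk
    exact F1_integral_of_h2 hP (lt_of_le_of_ne hh2 (Ne.symm h))
  · obtain ⟨rfl, rfl, h, h'⟩ := hk
    exact F1_integral_of_h1_h2 hP (lt_of_le_of_ne hh1 (Ne.symm h')) (lt_of_le_of_ne hh2 (Ne.symm h))
  · obtain ⟨rfl, rfl, h, h'⟩ := hk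
    exact F1_integral_of_h1_h3 hP (lt_of_le_of_ne hh1 (Ne.symm h')) (lt_of_le_of_ne hh3 (Ne.symm h))
  · obtain ⟨rfl, rfl, h, h'⟩ := hk
    exact F1_integral_of_h2_h3 hP (lt_of_le_of_ne hh2 (Ne.symm h')) (lt_of_le_of_ne hh3 (Ne.symm h))
  · obtain ⟨rfl, rfl, h, h'⟩ := hk
    exact F1_integral_of_h1_h4 hP (lt_of_le_of_ne hh1 (Ne.symm h')) (lt_of_le_of_ne hh4 (Ne.symm h))
  · obtain ⟨rfl, rfl, h, h'⟩ := hk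
    exact F1_integral_of_h2_h4 hP (lt_of_le_of_ne hh2 (Ne.symm h')) (lt_of_le_of_ne hh4 (Ne.symm h))

theorem pbfRelations : PBFRelations := by
  refine ⟨fun P h4 hP hh4 => ?_, fun P h3 h4 hP hh3 hh4 h => ?_,
    fun P h2 h3 h4 hP hh2 hh3 hh4 h => ?_, fun P h1 h2 h3 h4 hP hh1 hh2 hh3 hh4 h => ?_⟩
  · rw [(F4_integral hP hh4).2, inv_mul_cancel_left₀ (by positivity)]
  · rw [(F3_integral hP hh3 hh4 h).2, inv_mul_cancel_left₀ (by positivity)]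
  · rw [(F2_integral hP hh2 hh3 hh4 h).2, inv_mul_cancel_left₀ (by positivity)]
  · rw [(F1_integral hP hh1 hh2 hh3 hh4 h).2, inv_mul_cancel_left₀ (by positivity)]

/-! ### Radial kernels and their primitives -/

/-- Radial kernels that are no more singular than `1/R`. -/
structure IsKernel (G : ℝ → ℝ) : Prop where
  continuousOn : ContinuousOn G (Ioi 0)
  antitoneOn : AntitoneOn G (Ioi 0)
  nonneg : ∀ R, 0 < R → 0 ≤ G R
  le_inv : ∀ R, 0 < R → G R ≤ R⁻¹

/-- `F P = P^{-(n+1)} ∫₀^P p^n G(√(p² + h²)) dp`. -/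
def IsPrimitive (n : ℕ) (h : ℝ) (G F : ℝ → ℝ) : Prop :=
  ∀ P, 0 < P → IntervalIntegrable (fun p => p ^ n * G (√(p ^ 2 + h ^ 2))) volume 0 P ∧
    ∫ p in (0 : ℝ)..P, p ^ n * G (√(p ^ 2 + h ^ 2)) = P ^ (n + 1) * F P

section

variable {n : ℕ} {h : ℝ} {G F : ℝ → ℝ}

/-- The substitution p = t P turns F into a weighted average of G over the fixed interval [0, 1].
Monotonicity and bounds for F then follow by comparing integrands pointwise. -/
lemma IsPrimitive.scaled (hF : IsPrimitive n h G F) {P : ℝ} (hP : 0 < P) :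
    IntervalIntegrable (fun t => t ^ n * G (√((t * P) ^ 2 + h ^ 2))) volume 0 1 ∧
    ∫ t in (0 : ℝ)..1, t ^ n * G (√((t * P) ^ 2 + h ^ 2)) = F P := by
  obtain ⟨h1, h2⟩ := hF P hP
  have e : (fun t => t ^ n * G (√((t * P) ^ 2 + h ^ 2)))
      = fun t => (P ^ n)⁻¹ * ((t * P) ^ n * G (√((t * P) ^ 2 + h ^ 2))) := by
    funext t
    rw [mul_pow t P n]
    field_simp
  constructor
  · rw [e]
    have := (h1.comp_mul_right (c := P))
    rw [zero_div, div_self hP.ne'] at this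
    exact this.const_mul _
  · rw [e, intervalIntegral.integral_const_mul]
    have := intervalIntegral.mul_integral_comp_mul_right (a := 0) (b := 1)
      (f := fun p => p ^ n * G (√(p ^ 2 + h ^ 2))) P
    rw [zero_mul, one_mul, h2] at this
    have h3 : ∫ t in (0 : ℝ)..1, (t * P) ^ n * G (√((t * P) ^ 2 + h ^ 2)) = P ^ n * F P := by
      apply mul_left_cancel₀ hP.ne'
      rw [this]; ring
    rw [h3, inv_mul_cancel_left₀ (by positivity)]

lemma IsPrimitive.antitoneOn (hn : n ≠ 0) (hG : IsKernel G) (hF : IsPrimitive n h G F) :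
    AntitoneOn F (Ioi 0) := by
  intro P hP Q hQ hPQ
  have hP : 0 < P := hP
  have hQ : 0 < Q := hQ
  rw [← (hF.scaled hP).2, ← (hF.scaled hQ).2]
  refine intervalIntegral.integral_mono_on zero_le_one (hF.scaled hQ).1 (hF.scaled hP).1 ?_
  intro t ht
  -- At t = 0 the argument of G may be 0, where nothing is known; the weight t ^ n removes this
  -- point because n ≠ 0.
  rcases ht.1.eq_or_lt with rfl | h0
  · simp [hn]
  · refine mul_le_mul_of_nonneg_left ?_ (by positivity)
    exact hG.antitoneOn (Real.sqrt_pos.2 (by positivity)) (Real.sqrt_pos.2 (by positivity))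
      (Real.sqrt_le_sqrt (by gcongr))

lemma IsPrimitive.nonneg (hn : n ≠ 0) (hG : IsKernel G) (hF : IsPrimitive n h G F) {P : ℝ}
    (hP : 0 < P) : 0 ≤ F P := by
  rw [← (hF.scaled hP).2]
  refine intervalIntegral.integral_nonneg zero_le_one fun t ht => ?_
  rcases ht.1.eq_or_lt with rfl | h0
  · simp [hn]
  · exact mul_nonneg (by positivity) (hG.nonneg _ (by positivity))

/-- For n ≥ 1 the weight absorbs the singularity: t ^ n (t P)⁻¹ ≤ P⁻¹ on (0, 1]. -/
lemma IsPrimitive.le_inv (hn : n ≠ 0) (hG : IsKernel G) (hF : IsPrimitive n h G F) {P : ℝ}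
    (hP : 0 < P) : F P ≤ P⁻¹ := by
  have : ∫ _ in (0 : ℝ)..1, P⁻¹ = P⁻¹ := by simp
  rw [← (hF.scaled hP).2, ← this]
  refine intervalIntegral.integral_mono_on zero_le_one (hF.scaled hP).1 (by simp) fun t ht => ?_
  rcases ht.1.eq_or_lt with rfl | h0
  · simp [hn, hP.le]
  · have h1 : t * P ≤ √((t * P) ^ 2 + h ^ 2) := Real.le_sqrt_of_sq_le (by nlinarith [sq_nonneg h])
    calc t ^ n * G (√((t * P) ^ 2 + h ^ 2)) ≤ t ^ 1 * (t * P)⁻¹ := by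
          refine mul_le_mul (pow_le_pow_of_le_one h0.le ht.2 (Nat.one_le_iff_ne_zero.2 hn))
            ((hG.le_inv _ (by positivity)).trans ?_) (hG.nonneg _ (by positivity)) (by positivity)
          exact inv_anti₀ (by positivity) h1
      _ = P⁻¹ := by field_simp

/-- Since G decreases, its weighted average is at least its value at t = 1 times the total weight
1/(n+1). This lets (n+1) F dominate the whole regularized divergence. -/
lemma IsPrimitive.kernel_le (hn : n ≠ 0) (hG : IsKernel G) (hF : IsPrimitive n h G F) {P : ℝ}
    (hP : 0 < P) : G (√(P ^ 2 + h ^ 2)) ≤ (n + 1) * F P := by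
  have : ∫ t in (0 : ℝ)..1, t ^ n * G (√(P ^ 2 + h ^ 2)) = G (√(P ^ 2 + h ^ 2)) / (n + 1) := by
    rw [intervalIntegral.integral_mul_const, integral_pow]
    simp
    ring
  rw [← div_le_iff₀' (by positivity), ← (hF.scaled hP).2, ← this]
  refine intervalIntegral.integral_mono_on zero_le_one
    ((by fun_prop : Continuous _).intervalIntegrable _ _) (hF.scaled hP).1 fun t ht => ?_
  rcases ht.1.eq_or_lt with rfl | h0
  · simp [hn]
  · refine mul_le_mul_of_nonneg_left ?_ (by positivity)
    refine hG.antitoneOn (Real.sqrt_pos.2 (by positivity)) (Real.sqrt_pos.2 (by positivity))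
      (Real.sqrt_le_sqrt ?_)
    have : t * P ≤ P := by nlinarith [ht.2]
    have : (t * P) ^ 2 ≤ P ^ 2 := by gcongr
    linarith

/-- A positive height makes the primitive bounded. This replaces integrability of 1/|v| where the
edges are parallel or only one direction is left. -/
lemma IsPrimitive.le_kernel (hG : IsKernel G) (hF : IsPrimitive n h G F) {P : ℝ}
    (hP : 0 < P) (hh : 0 < h) : F P ≤ G h := by
  have : ∫ _ in (0 : ℝ)..1, G h = G h := by simp
  rw [← (hF.scaled hP).2, ← this]
  refine intervalIntegral.integral_mono_on zero_le_one (hF.scaled hP).1 (by simp) fun t ht => ?_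
  have h1 : h ≤ √((t * P) ^ 2 + h ^ 2) := Real.le_sqrt_of_sq_le (by nlinarith [sq_nonneg (t * P)])
  have h2 : G (√((t * P) ^ 2 + h ^ 2)) ≤ G h := hG.antitoneOn hh (hh.trans_le h1) h1
  calc t ^ n * G (√((t * P) ^ 2 + h ^ 2)) ≤ 1 * G h :=
        mul_le_mul (pow_le_one₀ ht.1 ht.2) h2 (hG.nonneg _ (hh.trans_le h1)) zero_le_one
    _ = G h := one_mul _

/-- Differentiating P^{n+1} F(P) = ∫₀^P p^n G(√(p² + h²)) dp gives P F' + (n+1) F = G(√(P² + h²)).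
For n + 1 = d this says that the radial field v F(|v|) in d variables has divergence G, the identity
behind every reduction. -/
lemma IsPrimitive.hasDerivAt (hG : IsKernel G) (hF : IsPrimitive n h G F) {P : ℝ}
    (hP : 0 < P) : HasDerivAt F ((G (√(P ^ 2 + h ^ 2)) - (n + 1) * F P) / P) P := by
  have hc : ContinuousOn (fun p => p ^ n * G (√(p ^ 2 + h ^ 2))) (Ioi 0) := by
    refine (by fun_prop : Continuous fun p : ℝ => p ^ n).continuousOn.mul
      (hG.continuousOn.comp (by fun_prop) fun p hp => ?_)
    have hp : 0 < p := hp
    exact Real.sqrt_pos.2 (by positivity)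
  have h1 := intervalIntegral.integral_hasDerivAt_right (hF P hP).1
    (hc.stronglyMeasurableAtFilter isOpen_Ioi P hP) (hc.continuousAt (Ioi_mem_nhds hP))
  have h2 := h1.div (hasDerivAt_pow (n + 1) P) (by positivity)
  have h3 : HasDerivAt F ((P ^ n * G (√(P ^ 2 + h ^ 2)) * P ^ (n + 1) - (∫ p in (0 : ℝ)..P,
      p ^ n * G (√(p ^ 2 + h ^ 2))) * (((n + 1 : ℕ) : ℝ) * P ^ (n + 1 - 1))) / (P ^ (n + 1)) ^ 2) P := by
    refine h2.congr_of_eventuallyEq ?_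
    filter_upwards [Ioi_mem_nhds hP] with q hq
    have hq : 0 < q := hq
    rw [Pi.div_apply, (hF q hq).2, mul_div_cancel_left₀ _ (by positivity)]
  refine h3.congr_deriv ?_
  rw [(hF P hP).2]
  push_cast
  field_simp
  ring

lemma IsPrimitive.isKernel (hn : n ≠ 0) (hG : IsKernel G) (hF : IsPrimitive n h G F) :
    IsKernel F where
  continuousOn := fun _ hP => (hF.hasDerivAt hG hP).continuousAt.continuousWithinAt
  antitoneOn := hF.antitoneOn hn hG
  nonneg := fun _ hP => hF.nonneg hn hG hP
  le_inv := fun _ hP => hF.le_inv hn hG hP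

end

lemma isKernel_G4 : IsKernel G4 where
  continuousOn := continuousOn_inv₀.mono fun _ hx => ne_of_gt hx
  antitoneOn := fun _ ha _ _ hab => inv_anti₀ ha hab
  nonneg := fun _ hR => inv_nonneg.2 hR.le
  le_inv := fun _ _ => le_rfl

lemma isPrimitive_F4 {h4 : ℝ} (hh4 : 0 ≤ h4) : IsPrimitive 3 h4 G4 (fun P => F4 P h4) :=
  fun _ hP => F4_integral hP hh4

lemma isPrimitive_F3 {h3 h4 : ℝ} (hh3 : 0 ≤ h3) (hh4 : 0 ≤ h4) (h : h3 * h4 = 0) :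
    IsPrimitive 2 h3 (fun P => F4 P h4) (fun P => F3 P h3 h4) :=
  fun _ hP => F3_integral hP hh3 hh4 h

lemma isPrimitive_F2 {h2 h3 h4 : ℝ} (hh2 : 0 ≤ h2) (hh3 : 0 ≤ h3) (hh4 : 0 ≤ h4)
    (h : h3 * h4 = 0) : IsPrimitive 1 h2 (fun P => F3 P h3 h4) (fun P => F2 P h2 h3 h4) :=
  fun _ hP => by simpa only [pow_one] using F2_integral hP hh2 hh3 hh4 h

lemma isPrimitive_F1 {h1 h2 h3 h4 : ℝ} (hh1 : 0 ≤ h1) (hh2 : 0 ≤ h2) (hh3 : 0 ≤ h3)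
    (hh4 : 0 ≤ h4) (h : ∃ k, hCase k h1 h2 h3 h4) :
    IsPrimitive 0 h1 (fun P => F2 P h2 h3 h4) (fun P => F1 P h1 h2 h3 h4) := by
  intro P hP
  simpa only [pow_zero, one_mul, zero_add, pow_one] using F1_integral hP hh1 hh2 hh3 hh4 h

lemma isKernel_F4 {h4 : ℝ} (hh4 : 0 ≤ h4) : IsKernel (fun P => F4 P h4) :=
  (isPrimitive_F4 hh4).isKernel (by norm_num) isKernel_G4

lemma isKernel_F3 {h3 h4 : ℝ} (hh3 : 0 ≤ h3) (hh4 : 0 ≤ h4) (h : h3 * h4 = 0) :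
    IsKernel (fun P => F3 P h3 h4) :=
  (isPrimitive_F3 hh3 hh4 h).isKernel (by norm_num) (isKernel_F4 hh4)

lemma isKernel_F2 {h2 h3 h4 : ℝ} (hh2 : 0 ≤ h2) (hh3 : 0 ≤ h3) (hh4 : 0 ≤ h4)
    (h : h3 * h4 = 0) : IsKernel (fun P => F2 P h2 h3 h4) :=
  (isPrimitive_F2 hh2 hh3 hh4 h).isKernel (by norm_num) (isKernel_F3 hh3 hh4 h)

/-! ### Integration over the standard triangle -/

/-- The standard triangle. -/
def stdTri : Set (ℝ × ℝ) := {p | 0 ≤ p.1 ∧ 0 ≤ p.2 ∧ p.1 + p.2 ≤ 1}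

/-- Lebesgue measure on the standard triangle. -/
noncomputable def triMeasure : Measure (ℝ × ℝ) := volume.restrict stdTri

/-- Lebesgue measure on the unit interval. -/
noncomputable def segMeasure : Measure ℝ := volume.restrict (Icc 0 1)

lemma isCompact_stdTri : IsCompact stdTri := by
  refine IsCompact.of_isClosed_subset (isCompact_Icc (a := ((0, 0) : ℝ × ℝ)) (b := (1, 1))) ?_ ?_
  · exact (isClosed_le continuous_const continuous_fst).inter
      ((isClosed_le continuous_const continuous_snd).inter
        (isClosed_le (continuous_fst.add continuous_snd) continuous_const))
  · rintro ⟨a, b⟩ ⟨h1, h2, h3⟩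
    simp only at h1 h2 h3
    exact ⟨⟨h1, h2⟩, ⟨by simp only; linarith, by simp only; linarith⟩⟩

lemma measurableSet_stdTri : MeasurableSet stdTri := isCompact_stdTri.measurableSet

instance : IsFiniteMeasure segMeasure := by unfold segMeasure; infer_instance

instance : IsFiniteMeasure triMeasure :=
  ⟨by rw [triMeasure, Measure.restrict_apply_univ]; exact isCompact_stdTri.measure_lt_top⟩

lemma integral_segMeasure (f : ℝ → ℝ) : ∫ t, f t ∂segMeasure = ∫ t in (0 : ℝ)..1, f t := by
  rw [segMeasure, integral_Icc_eq_integral_Ioc, intervalIntegral.integral_of_le zero_le_one]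

lemma map_swap_triMeasure : triMeasure.map Prod.swap = triMeasure := by
  have h : MeasurePreserving (Prod.swap : ℝ × ℝ → ℝ × ℝ) volume volume :=
    Measure.measurePreserving_swap
  have h2 := h.restrict_preimage measurableSet_stdTri
  have : Prod.swap ⁻¹' stdTri = stdTri := by
    ext ⟨a, b⟩
    simp only [stdTri, mem_preimage, mem_ofPred_eq, Prod.fst_swap, Prod.snd_swap]
    constructor <;> rintro ⟨h1, h2, h3⟩ <;> exact ⟨h2, h1, by linarith⟩
  rw [this] at h2
  exact h2.map_eq

lemma integral_triMeasure {f : ℝ × ℝ → ℝ} (hf : Integrable f triMeasure) :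
    ∫ p, f p ∂triMeasure = ∫ s in (0 : ℝ)..1, ∫ t in (0 : ℝ)..(1 - s), f (s, t) := by
  rw [triMeasure, ← integral_indicator measurableSet_stdTri]
  have hi : Integrable (stdTri.indicator f) := (integrable_indicator_iff measurableSet_stdTri).2 hf
  rw [Measure.volume_eq_prod, integral_prod _ hi, ← integral_segMeasure, segMeasure,
    ← integral_indicator measurableSet_Icc]
  refine integral_congr_ae (Eventually.of_forall fun s => ?_)
  by_cases hs : s ∈ Icc (0 : ℝ) 1
  · have h1 : (fun t => stdTri.indicator f (s, t)) = (Icc 0 (1 - s)).indicator fun t => f (s, t) := by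
      funext t
      by_cases ht : t ∈ Icc 0 (1 - s)
      · rw [indicator_of_mem ht, indicator_of_mem]
        exact ⟨hs.1, ht.1, by have := ht.2; simp only; linarith⟩
      · rw [indicator_of_notMem ht, indicator_of_notMem]
        rintro ⟨h1, h2, h3⟩
        exact ht ⟨h2, by simp only at h3; linarith⟩
    simp only [indicator_of_mem hs, h1]
    rw [integral_indicator measurableSet_Icc, integral_Icc_eq_integral_Ioc,
      intervalIntegral.integral_of_le (by linarith [hs.2])]
  · have h1 : (fun t => stdTri.indicator f (s, t)) = fun _ => 0 := by
      funext t
      rw [indicator_of_notMem]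
      rintro ⟨h1, h2, h3⟩
      simp only at h1 h2 h3
      exact hs ⟨h1, by linarith⟩
    simp only [indicator_of_notMem hs, h1, integral_zero]

/-- The divergence theorem on the triangle needs both orders of integration: each component of the
field is integrated first along its own direction. -/
lemma integral_triMeasure_swap {f : ℝ × ℝ → ℝ} (hf : Integrable f triMeasure) :
    ∫ p, f p ∂triMeasure = ∫ t in (0 : ℝ)..1, ∫ s in (0 : ℝ)..(1 - t), f (s, t) := by
  have hm : MeasurableEmbedding (Prod.swap : ℝ × ℝ → ℝ × ℝ) :=
    MeasurableEquiv.prodComm.measurableEmbedding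
  have h1 : Integrable (f ∘ Prod.swap) triMeasure := by
    rwa [← hm.integrable_map_iff, map_swap_triMeasure]
  have h2 := integral_triMeasure h1
  have h3 := hm.integral_map (μ := triMeasure) f
  rw [map_swap_triMeasure] at h3
  rw [h3]
  exact h2

lemma integrable_triMeasure {f : ℝ × ℝ → ℝ} (hf : Continuous f) : Integrable f triMeasure :=
  hf.continuousOn.integrableOn_compact isCompact_stdTri

lemma integrable_segMeasure {f : ℝ → ℝ} (hf : Continuous f) : Integrable f segMeasure :=
  hf.continuousOn.integrableOn_compact isCompact_Icc

lemma integrable_tri_prod_tri {f : (ℝ × ℝ) × (ℝ × ℝ) → ℝ} (hf : Continuous f) :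
    Integrable f (triMeasure.prod triMeasure) := by
  rw [triMeasure, Measure.prod_restrict]
  exact hf.continuousOn.integrableOn_compact (isCompact_stdTri.prod isCompact_stdTri)

lemma integrable_tri_prod_seg {f : (ℝ × ℝ) × ℝ → ℝ} (hf : Continuous f) :
    Integrable f (triMeasure.prod segMeasure) := by
  rw [triMeasure, segMeasure, Measure.prod_restrict]
  exact hf.continuousOn.integrableOn_compact (isCompact_stdTri.prod isCompact_Icc)

lemma integrable_seg_prod_seg {f : ℝ × ℝ → ℝ} (hf : Continuous f) :
    Integrable f (segMeasure.prod segMeasure) := by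
  rw [segMeasure, Measure.prod_restrict]
  exact hf.continuousOn.integrableOn_compact (isCompact_Icc.prod isCompact_Icc)

/-! ### The divergence theorem on segments and triangles -/

section Divergence

variable {φ : E3 → ℝ}

lemma hasDerivAt_comp_line (hφ : ContDiff ℝ 1 φ) (a w : E3) (t : ℝ) :
    HasDerivAt (fun t : ℝ => φ (t • a + w)) (fderiv ℝ φ (t • a + w) a) t := by
  have h1 : HasDerivAt (fun t : ℝ => t • a + w) a t := by
    simpa using ((hasDerivAt_id t).smul_const a).add_const w
  exact ((hφ.differentiable one_ne_zero).differentiableAt.hasFDerivAt (x := t • a + w)).comp_hasDerivAt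
    t h1

lemma continuous_fderiv_apply' (hφ : ContDiff ℝ 1 φ) {X : Type*} [TopologicalSpace X] {f g : X → E3}
    (hf : Continuous f) (hg : Continuous g) : Continuous fun x => fderiv ℝ φ (f x) (g x) :=
  ((hφ.continuous_fderiv one_ne_zero).comp hf).clm_apply hg

/-- The integrand is the derivative of (t + c) φ(t a + w). The upper limit is left free because the
slices of the triangle have length 1 - s. -/
lemma integral_line_div (hφ : ContDiff ℝ 1 φ) (a w : E3) (c L : ℝ) :
    ∫ t in (0 : ℝ)..L, (φ (t • a + w) + fderiv ℝ φ (t • a + w) ((t + c) • a)) =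
      (L + c) * φ (L • a + w) - c * φ w := by
  have h1 : ∀ t ∈ uIcc 0 L, HasDerivAt (fun t : ℝ => (t + c) * φ (t • a + w))
      (φ (t • a + w) + fderiv ℝ φ (t • a + w) ((t + c) • a)) t := fun t _ => by
    refine (((hasDerivAt_id t).add_const c).mul (hasDerivAt_comp_line hφ a w t)).congr_deriv ?_
    simp
  have hc : Continuous fun t : ℝ => φ (t • a + w) + fderiv ℝ φ (t • a + w) ((t + c) • a) :=
    (hφ.continuous.comp (by fun_prop)).add (continuous_fderiv_apply' hφ (by fun_prop) (by fun_prop))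
  rw [intervalIntegral.integral_eq_sub_of_hasDerivAt h1 (hc.intervalIntegrable _ _)]
  simp

/-- Each component of the field is integrated along its slices. Both families of slices end on the
hypotenuse, where the weights t + c and 1 - t + d add up to the constant 1 + c + d. The offset `w`
is not tied to c and d, so the result also applies to triangular slices of larger domains. -/
lemma integral_tri_div (hφ : ContDiff ℝ 1 φ) (a b w : E3) (c d : ℝ) :
    ∫ p, (2 * φ (p.1 • a + p.2 • b + w)
        + fderiv ℝ φ (p.1 • a + p.2 • b + w) ((p.1 + c) • a + (p.2 + d) • b)) ∂triMeasure =
      (1 + c + d) * (∫ t in (0 : ℝ)..1, φ (t • (a - b) + (w + b)))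
        - c * (∫ t in (0 : ℝ)..1, φ (t • b + w)) - d * (∫ t in (0 : ℝ)..1, φ (t • a + w)) := by
  have cφ := hφ.continuous
  have i1 : Integrable (fun p : ℝ × ℝ => φ (p.1 • a + (p.2 • b + w))
      + fderiv ℝ φ (p.1 • a + (p.2 • b + w)) ((p.1 + c) • a)) triMeasure :=
    integrable_triMeasure ((cφ.comp (by fun_prop)).add
      (continuous_fderiv_apply' hφ (by fun_prop) (by fun_prop)))
  have i2 : Integrable (fun p : ℝ × ℝ => φ (p.2 • b + (p.1 • a + w))
      + fderiv ℝ φ (p.2 • b + (p.1 • a + w)) ((p.2 + d) • b)) triMeasure :=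
    integrable_triMeasure ((cφ.comp (by fun_prop)).add
      (continuous_fderiv_apply' hφ (by fun_prop) (by fun_prop)))
  have e : ∀ p : ℝ × ℝ, 2 * φ (p.1 • a + p.2 • b + w)
        + fderiv ℝ φ (p.1 • a + p.2 • b + w) ((p.1 + c) • a + (p.2 + d) • b)
      = (φ (p.1 • a + (p.2 • b + w)) + fderiv ℝ φ (p.1 • a + (p.2 • b + w)) ((p.1 + c) • a))
        + (φ (p.2 • b + (p.1 • a + w))
          + fderiv ℝ φ (p.2 • b + (p.1 • a + w)) ((p.2 + d) • b)) := fun p => by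
    have e1 : p.1 • a + (p.2 • b + w) = p.1 • a + p.2 • b + w := by abel
    have e2 : p.2 • b + (p.1 • a + w) = p.1 • a + p.2 • b + w := by abel
    rw [e1, e2, map_add]
    ring
  rw [integral_congr_ae (Eventually.of_forall e), integral_add i1 i2, integral_triMeasure_swap i1,
    integral_triMeasure i2]
  simp only [integral_line_div hφ]
  have j1 : ∀ f : ℝ → E3, Continuous f → IntervalIntegrable (fun t => φ (f t)) volume 0 1 :=
    fun f hf => (cφ.comp hf).intervalIntegrable _ _
  have j2 : ∀ (g : ℝ → ℝ) (f : ℝ → E3), Continuous g → Continuous f →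
      IntervalIntegrable (fun t => g t * φ (f t)) volume 0 1 :=
    fun g f hg hf => (hg.mul (cφ.comp hf)).intervalIntegrable _ _
  rw [intervalIntegral.integral_sub (j2 _ _ (by fun_prop) (by fun_prop))
      (j2 _ _ (by fun_prop) (by fun_prop)),
    intervalIntegral.integral_sub (j2 _ _ (by fun_prop) (by fun_prop))
      (j2 _ _ (by fun_prop) (by fun_prop)),
    intervalIntegral.integral_const_mul, intervalIntegral.integral_const_mul]
  -- Reflection t ↦ 1 - t, so that both contributions use the same parametrization of the
  -- hypotenuse.
  have h1 : ∫ x in (0 : ℝ)..1, (1 - x + c) * φ ((1 - x) • a + (x • b + w))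
      = ∫ t in (0 : ℝ)..1, (t + c) * φ (t • (a - b) + (w + b)) := by
    have := intervalIntegral.integral_comp_sub_left (a := 0) (b := 1)
      (fun t => (t + c) * φ (t • (a - b) + (w + b))) 1
    rw [sub_self, sub_zero] at this
    rw [← this]
    refine intervalIntegral.integral_congr fun t _ => ?_
    congr 2
    module
  have h2 : ∫ x in (0 : ℝ)..1, (1 - x + d) * φ ((1 - x) • b + (x • a + w))
      = ∫ t in (0 : ℝ)..1, (1 - t + d) * φ (t • (a - b) + (w + b)) := by
    refine intervalIntegral.integral_congr fun t _ => ?_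
    congr 2
    module
  have h3 : (∫ t in (0 : ℝ)..1, (t + c) * φ (t • (a - b) + (w + b)))
      + ∫ t in (0 : ℝ)..1, (1 - t + d) * φ (t • (a - b) + (w + b))
      = (1 + c + d) * (∫ t in (0 : ℝ)..1, φ (t • (a - b) + (w + b))) := by
    rw [← intervalIntegral.integral_add (j2 _ _ (by fun_prop) (by fun_prop))
      (j2 _ _ (by fun_prop) (by fun_prop)), ← intervalIntegral.integral_const_mul]
    refine intervalIntegral.integral_congr fun t _ => ?_
    ring
  rw [h1, h2]
  linarith

lemma integral_comb {X : Type*} [MeasurableSpace X] {μ : Measure X} {f g h : X → ℝ}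
    (hf : Integrable f μ) (hg : Integrable g μ) (hh : Integrable h μ) (α β γ : ℝ) :
    ∫ x, (α * f x - β * g x - γ * h x) ∂μ
      = α * (∫ x, f x ∂μ) - β * (∫ x, g x ∂μ) - γ * (∫ x, h x ∂μ) := by
  have h1 : Integrable (fun x => α * f x - β * g x) μ := (hf.const_mul α).sub (hg.const_mul β)
  rw [integral_sub h1 (hh.const_mul γ), integral_sub (hf.const_mul α) (hg.const_mul β)]
  simp only [integral_const_mul]

/-- The faces of the product of two triangles run along b - a from a, whereas `integral_tri_div`
runs along a - b from b. -/
lemma integral_interval_reverse (a b w : E3) :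
    ∫ t in (0 : ℝ)..1, φ (t • (a - b) + (w + b)) = ∫ t in (0 : ℝ)..1, φ (t • (b - a) + (w + a)) := by
  have := intervalIntegral.integral_comp_sub_left (a := 0) (b := 1)
    (fun t : ℝ => φ (t • (a - b) + (w + b))) 1
  rw [sub_self, sub_zero] at this
  rw [← this]
  refine intervalIntegral.integral_congr fun t _ => ?_
  refine congrArg φ ?_
  module

lemma integral_prod_tri_seg {f : (ℝ × ℝ) × ℝ → ℝ} (hf : Continuous f) :
    ∫ q, (∫ t in (0 : ℝ)..1, f (q, t)) ∂triMeasure = ∫ x, f x ∂triMeasure.prod segMeasure := by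
  rw [integral_prod _ (integrable_tri_prod_seg hf)]
  simp only [integral_segMeasure]

lemma integrable_tri_interval {f : (ℝ × ℝ) × ℝ → ℝ} (hf : Continuous f) :
    Integrable (fun q => ∫ t in (0 : ℝ)..1, f (q, t)) triMeasure := by
  have := (integrable_tri_prod_seg hf).integral_prod_left
  simpa only [integral_segMeasure] using this

lemma integral_prod_seg_seg {f : ℝ × ℝ → ℝ} (hf : Continuous f) :
    ∫ s, (∫ t in (0 : ℝ)..1, f (t, s)) ∂segMeasure = ∫ x, f x ∂segMeasure.prod segMeasure := by
  rw [integral_prod_symm _ (integrable_seg_prod_seg hf)]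
  simp only [integral_segMeasure]

lemma integrable_seg_interval {f : ℝ × ℝ → ℝ} (hf : Continuous f) :
    Integrable (fun s => ∫ t in (0 : ℝ)..1, f (t, s)) segMeasure := by
  have := (integrable_seg_prod_seg hf).integral_prod_right
  simpa only [integral_segMeasure] using this

/-- By `he` the position vector is (x.1 + c) a + (x.2 + d) b, so its directional derivative splits
into two line fields. The vectors a and b need not be independent; in the same way the prism splits
into a triangle and a line, and the four dimensional domain into two triangles. -/
lemma integral_square_div (hφ : ContDiff ℝ 1 φ) {a b e : E3} {c d : ℝ}
    (he : e = c • a + d • b) :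
    ∫ x, (2 * φ (x.1 • a + x.2 • b + e)
        + fderiv ℝ φ (x.1 • a + x.2 • b + e) (x.1 • a + x.2 • b + e)) ∂segMeasure.prod segMeasure =
      (1 + c) * (∫ t, φ (t • b + (e + a)) ∂segMeasure) - c * (∫ t, φ (t • b + e) ∂segMeasure)
      + (1 + d) * (∫ t, φ (t • a + (e + b)) ∂segMeasure) - d * (∫ t, φ (t • a + e) ∂segMeasure) := by
  have cφ := hφ.continuous
  have i1 : Integrable (fun x : ℝ × ℝ => φ (x.1 • a + (x.2 • b + e))
      + fderiv ℝ φ (x.1 • a + (x.2 • b + e)) ((x.1 + c) • a)) (segMeasure.prod segMeasure) :=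
    integrable_seg_prod_seg ((cφ.comp (by fun_prop)).add
      (continuous_fderiv_apply' hφ (by fun_prop) (by fun_prop)))
  have i2 : Integrable (fun x : ℝ × ℝ => φ (x.2 • b + (x.1 • a + e))
      + fderiv ℝ φ (x.2 • b + (x.1 • a + e)) ((x.2 + d) • b)) (segMeasure.prod segMeasure) :=
    integrable_seg_prod_seg ((cφ.comp (by fun_prop)).add
      (continuous_fderiv_apply' hφ (by fun_prop) (by fun_prop)))
  have key : ∀ x : ℝ × ℝ, 2 * φ (x.1 • a + x.2 • b + e)
        + fderiv ℝ φ (x.1 • a + x.2 • b + e) (x.1 • a + x.2 • b + e)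
      = (φ (x.1 • a + (x.2 • b + e)) + fderiv ℝ φ (x.1 • a + (x.2 • b + e)) ((x.1 + c) • a))
        + (φ (x.2 • b + (x.1 • a + e))
          + fderiv ℝ φ (x.2 • b + (x.1 • a + e)) ((x.2 + d) • b)) := fun x => by
    have e1 : x.1 • a + (x.2 • b + e) = x.1 • a + x.2 • b + e := by abel
    have e2 : x.2 • b + (x.1 • a + e) = x.1 • a + x.2 • b + e := by abel
    have e3 : fderiv ℝ φ (x.1 • a + x.2 • b + e) (x.1 • a + x.2 • b + e)
        = fderiv ℝ φ (x.1 • a + x.2 • b + e) ((x.1 + c) • a + (x.2 + d) • b) := by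
      congr 1
      rw [he]; module
    rw [e1, e2, e3, map_add]
    ring
  have j : ∀ f : ℝ → E3, Continuous f → Integrable (fun t => φ (f t)) segMeasure :=
    fun f hf => integrable_segMeasure (cφ.comp hf)
  rw [integral_congr_ae (Eventually.of_forall key), integral_add i1 i2, integral_prod_symm _ i1,
    integral_prod _ i2]
  simp only [integral_segMeasure (fun t => φ _ + _), integral_line_div hφ]
  rw [integral_sub ((j _ (by fun_prop)).const_mul _) ((j _ (by fun_prop)).const_mul _),
    integral_sub ((j _ (by fun_prop)).const_mul _) ((j _ (by fun_prop)).const_mul _)]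
  simp only [integral_const_mul, one_smul]
  have r1 : ∀ t : ℝ, a + (t • b + e) = t • b + (e + a) := fun t => by abel
  have r2 : ∀ t : ℝ, b + (t • a + e) = t • a + (e + b) := fun t => by abel
  simp only [r1, r2]
  ring

lemma integral_prism_div (hφ : ContDiff ℝ 1 φ) {a b g e : E3} {c d k : ℝ}
    (he : e = c • a + d • b + k • g) :
    ∫ x, (3 * φ (x.1.1 • a + x.1.2 • b + x.2 • g + e)
        + fderiv ℝ φ (x.1.1 • a + x.1.2 • b + x.2 • g + e) (x.1.1 • a + x.1.2 • b + x.2 • g + e))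
        ∂triMeasure.prod segMeasure =
      (1 + c + d) * (∫ x, φ (x.1 • (a - b) + x.2 • g + (e + b)) ∂segMeasure.prod segMeasure)
      - c * (∫ x, φ (x.1 • b + x.2 • g + e) ∂segMeasure.prod segMeasure)
      - d * (∫ x, φ (x.1 • a + x.2 • g + e) ∂segMeasure.prod segMeasure)
      + (1 + k) * (∫ p, φ (p.1 • a + p.2 • b + (e + g)) ∂triMeasure)
      - k * (∫ p, φ (p.1 • a + p.2 • b + e) ∂triMeasure) := by
  have cφ := hφ.continuous
  have i1 : Integrable (fun x : (ℝ × ℝ) × ℝ => 2 * φ (x.1.1 • a + x.1.2 • b + (x.2 • g + e))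
      + fderiv ℝ φ (x.1.1 • a + x.1.2 • b + (x.2 • g + e)) ((x.1.1 + c) • a + (x.1.2 + d) • b))
      (triMeasure.prod segMeasure) :=
    integrable_tri_prod_seg ((continuous_const.mul (cφ.comp (by fun_prop))).add
      (continuous_fderiv_apply' hφ (by fun_prop) (by fun_prop)))
  have i2 : Integrable (fun x : (ℝ × ℝ) × ℝ => φ (x.2 • g + (x.1.1 • a + x.1.2 • b + e))
      + fderiv ℝ φ (x.2 • g + (x.1.1 • a + x.1.2 • b + e)) ((x.2 + k) • g))
      (triMeasure.prod segMeasure) :=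
    integrable_tri_prod_seg ((cφ.comp (by fun_prop)).add
      (continuous_fderiv_apply' hφ (by fun_prop) (by fun_prop)))
  have key : ∀ x : (ℝ × ℝ) × ℝ, 3 * φ (x.1.1 • a + x.1.2 • b + x.2 • g + e)
        + fderiv ℝ φ (x.1.1 • a + x.1.2 • b + x.2 • g + e) (x.1.1 • a + x.1.2 • b + x.2 • g + e)
      = (2 * φ (x.1.1 • a + x.1.2 • b + (x.2 • g + e))
          + fderiv ℝ φ (x.1.1 • a + x.1.2 • b + (x.2 • g + e))
            ((x.1.1 + c) • a + (x.1.2 + d) • b))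
        + (φ (x.2 • g + (x.1.1 • a + x.1.2 • b + e))
          + fderiv ℝ φ (x.2 • g + (x.1.1 • a + x.1.2 • b + e)) ((x.2 + k) • g)) := fun x => by
    have e1 : x.1.1 • a + x.1.2 • b + (x.2 • g + e) = x.1.1 • a + x.1.2 • b + x.2 • g + e := by abel
    have e2 : x.2 • g + (x.1.1 • a + x.1.2 • b + e) = x.1.1 • a + x.1.2 • b + x.2 • g + e := by abel
    have e3 : fderiv ℝ φ (x.1.1 • a + x.1.2 • b + x.2 • g + e)
          (x.1.1 • a + x.1.2 • b + x.2 • g + e)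
        = fderiv ℝ φ (x.1.1 • a + x.1.2 • b + x.2 • g + e)
          (((x.1.1 + c) • a + (x.1.2 + d) • b) + (x.2 + k) • g) := by
      congr 1
      rw [he]; module
    rw [e1, e2, e3, map_add]
    ring
  have j : ∀ f : ℝ × ℝ → E3, Continuous f →
      Integrable (fun s => ∫ t in (0 : ℝ)..1, φ (f (t, s))) segMeasure :=
    fun f hf => integrable_seg_interval (f := fun x => φ (f x)) (cφ.comp hf)
  have jT : ∀ f : ℝ × ℝ → E3, Continuous f → Integrable (fun t => φ (f t)) triMeasure :=
    fun f hf => integrable_triMeasure (cφ.comp hf)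
  rw [integral_congr_ae (Eventually.of_forall key), integral_add i1 i2, integral_prod_symm _ i1,
    integral_prod _ i2]
  simp only [integral_segMeasure (fun t => φ _ + _), integral_line_div hφ, integral_tri_div hφ]
  have k1 := j (fun x => x.1 • (a - b) + (x.2 • g + e + b)) (by fun_prop)
  have k2 := j (fun x => x.1 • b + (x.2 • g + e)) (by fun_prop)
  have k3 := j (fun x => x.1 • a + (x.2 • g + e)) (by fun_prop)
  dsimp only at k1 k2 k3
  rw [integral_comb k1 k2 k3,
    integral_sub ((jT _ (by fun_prop)).const_mul _) ((jT _ (by fun_prop)).const_mul _)]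
  simp only [integral_const_mul, one_smul]
  rw [integral_prod_seg_seg (f := fun x => φ (x.1 • (a - b) + (x.2 • g + e + b)))
      (cφ.comp (by fun_prop)),
    integral_prod_seg_seg (f := fun x => φ (x.1 • b + (x.2 • g + e))) (cφ.comp (by fun_prop)),
    integral_prod_seg_seg (f := fun x => φ (x.1 • a + (x.2 • g + e))) (cφ.comp (by fun_prop))]
  have r1 : ∀ x : ℝ × ℝ, x.1 • (a - b) + (x.2 • g + e + b) = x.1 • (a - b) + x.2 • g + (e + b) :=
    fun x => by abel
  have r2 : ∀ p : ℝ × ℝ, g + (p.1 • a + p.2 • b + e) = p.1 • a + p.2 • b + (e + g) :=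
    fun p => by abel
  simp only [r1, r2, ← add_assoc]
  ring

lemma integral_tri_tri_div (hφ : ContDiff ℝ 1 φ) {a b a' b' e : E3} {c d c' d' : ℝ}
    (he : e = c • a + d • b + c' • a' + d' • b') :
    ∫ x, (4 * φ (x.1.1 • a + x.1.2 • b + x.2.1 • a' + x.2.2 • b' + e)
        + fderiv ℝ φ (x.1.1 • a + x.1.2 • b + x.2.1 • a' + x.2.2 • b' + e)
          (x.1.1 • a + x.1.2 • b + x.2.1 • a' + x.2.2 • b' + e)) ∂triMeasure.prod triMeasure =
      - d' * (∫ x, φ (x.1.1 • a + x.1.2 • b + x.2 • a' + e) ∂triMeasure.prod segMeasure)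
      + (1 + c' + d') *
        (∫ x, φ (x.1.1 • a + x.1.2 • b + x.2 • (b' - a') + (e + a')) ∂triMeasure.prod segMeasure)
      - c' * (∫ x, φ (x.1.1 • a + x.1.2 • b + x.2 • b' + e) ∂triMeasure.prod segMeasure)
      - d * (∫ x, φ (x.1.1 • a' + x.1.2 • b' + x.2 • a + e) ∂triMeasure.prod segMeasure)
      + (1 + c + d) *
        (∫ x, φ (x.1.1 • a' + x.1.2 • b' + x.2 • (b - a) + (e + a)) ∂triMeasure.prod segMeasure)
      - c * (∫ x, φ (x.1.1 • a' + x.1.2 • b' + x.2 • b + e) ∂triMeasure.prod segMeasure) := by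
  have cφ := hφ.continuous
  have i1 : Integrable (fun x : (ℝ × ℝ) × (ℝ × ℝ) =>
      2 * φ (x.1.1 • a + x.1.2 • b + (x.2.1 • a' + x.2.2 • b' + e))
      + fderiv ℝ φ (x.1.1 • a + x.1.2 • b + (x.2.1 • a' + x.2.2 • b' + e))
        ((x.1.1 + c) • a + (x.1.2 + d) • b)) (triMeasure.prod triMeasure) :=
    integrable_tri_prod_tri ((continuous_const.mul (cφ.comp (by fun_prop))).add
      (continuous_fderiv_apply' hφ (by fun_prop) (by fun_prop)))
  have i2 : Integrable (fun x : (ℝ × ℝ) × (ℝ × ℝ) =>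
      2 * φ (x.2.1 • a' + x.2.2 • b' + (x.1.1 • a + x.1.2 • b + e))
      + fderiv ℝ φ (x.2.1 • a' + x.2.2 • b' + (x.1.1 • a + x.1.2 • b + e))
        ((x.2.1 + c') • a' + (x.2.2 + d') • b')) (triMeasure.prod triMeasure) :=
    integrable_tri_prod_tri ((continuous_const.mul (cφ.comp (by fun_prop))).add
      (continuous_fderiv_apply' hφ (by fun_prop) (by fun_prop)))
  have key : ∀ x : (ℝ × ℝ) × (ℝ × ℝ), 4 * φ (x.1.1 • a + x.1.2 • b + x.2.1 • a' + x.2.2 • b' + e)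
        + fderiv ℝ φ (x.1.1 • a + x.1.2 • b + x.2.1 • a' + x.2.2 • b' + e)
          (x.1.1 • a + x.1.2 • b + x.2.1 • a' + x.2.2 • b' + e)
      = (2 * φ (x.1.1 • a + x.1.2 • b + (x.2.1 • a' + x.2.2 • b' + e))
          + fderiv ℝ φ (x.1.1 • a + x.1.2 • b + (x.2.1 • a' + x.2.2 • b' + e))
            ((x.1.1 + c) • a + (x.1.2 + d) • b))
        + (2 * φ (x.2.1 • a' + x.2.2 • b' + (x.1.1 • a + x.1.2 • b + e))
          + fderiv ℝ φ (x.2.1 • a' + x.2.2 • b' + (x.1.1 • a + x.1.2 • b + e))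
            ((x.2.1 + c') • a' + (x.2.2 + d') • b')) := fun x => by
    have e1 : x.1.1 • a + x.1.2 • b + (x.2.1 • a' + x.2.2 • b' + e)
      = x.1.1 • a + x.1.2 • b + x.2.1 • a' + x.2.2 • b' + e := by abel
    have e2 : x.2.1 • a' + x.2.2 • b' + (x.1.1 • a + x.1.2 • b + e)
      = x.1.1 • a + x.1.2 • b + x.2.1 • a' + x.2.2 • b' + e := by abel
    have e3 : fderiv ℝ φ (x.1.1 • a + x.1.2 • b + x.2.1 • a' + x.2.2 • b' + e)
          (x.1.1 • a + x.1.2 • b + x.2.1 • a' + x.2.2 • b' + e)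
        = fderiv ℝ φ (x.1.1 • a + x.1.2 • b + x.2.1 • a' + x.2.2 • b' + e)
          (((x.1.1 + c) • a + (x.1.2 + d) • b) + ((x.2.1 + c') • a' + (x.2.2 + d') • b')) := by
      congr 1
      rw [he]; module
    rw [e1, e2, e3, map_add]
    ring
  have j : ∀ f : (ℝ × ℝ) × ℝ → E3, Continuous f →
      Integrable (fun q => ∫ t in (0 : ℝ)..1, φ (f (q, t))) triMeasure :=
    fun f hf => integrable_tri_interval (f := fun x => φ (f x)) (cφ.comp hf)
  have j' : ∀ f : (ℝ × ℝ) × ℝ → E3, Continuous f →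
      ∫ q, (∫ t in (0 : ℝ)..1, φ (f (q, t))) ∂triMeasure
        = ∫ x, φ (f x) ∂triMeasure.prod segMeasure :=
    fun f hf => integral_prod_tri_seg (f := fun x => φ (f x)) (cφ.comp hf)
  -- The flux of the field of one triangle, integrated over the other; it is used twice with the
  -- roles of the triangles exchanged.
  have half : ∀ {a b a' b' : E3} {c d : ℝ},
      ∫ q, ((1 + c + d) * (∫ t in (0 : ℝ)..1, φ (t • (a - b) + (q.1 • a' + q.2 • b' + e + b)))
        - c * (∫ t in (0 : ℝ)..1, φ (t • b + (q.1 • a' + q.2 • b' + e)))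
        - d * (∫ t in (0 : ℝ)..1, φ (t • a + (q.1 • a' + q.2 • b' + e)))) ∂triMeasure
      = (1 + c + d) *
        (∫ x, φ (x.1.1 • a' + x.1.2 • b' + x.2 • (b - a) + (e + a)) ∂triMeasure.prod segMeasure)
        - c * (∫ x, φ (x.1.1 • a' + x.1.2 • b' + x.2 • b + e) ∂triMeasure.prod segMeasure)
        - d * (∫ x, φ (x.1.1 • a' + x.1.2 • b' + x.2 • a + e) ∂triMeasure.prod segMeasure) := by
    intro a b a' b' c d
    simp only [integral_interval_reverse a b]
    have k1 := j (fun x => x.2 • (b - a) + (x.1.1 • a' + x.1.2 • b' + e + a)) (by fun_prop)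
    have k2 := j (fun x => x.2 • b + (x.1.1 • a' + x.1.2 • b' + e)) (by fun_prop)
    have k3 := j (fun x => x.2 • a + (x.1.1 • a' + x.1.2 • b' + e)) (by fun_prop)
    dsimp only at k1 k2 k3
    rw [integral_comb k1 k2 k3, j' (fun x => x.2 • (b - a) + (x.1.1 • a' + x.1.2 • b' + e + a)) (by fun_prop),
      j' (fun x => x.2 • b + (x.1.1 • a' + x.1.2 • b' + e)) (by fun_prop),
      j' (fun x => x.2 • a + (x.1.1 • a' + x.1.2 • b' + e)) (by fun_prop)]
    have r1 : ∀ x : (ℝ × ℝ) × ℝ, x.2 • (b - a) + (x.1.1 • a' + x.1.2 • b' + e + a)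
      = x.1.1 • a' + x.1.2 • b' + x.2 • (b - a) + (e + a) := fun x => by abel
    have r2 : ∀ (x : (ℝ × ℝ) × ℝ) (b : E3), x.2 • b + (x.1.1 • a' + x.1.2 • b' + e)
      = x.1.1 • a' + x.1.2 • b' + x.2 • b + e := fun x b => by abel
    simp only [r1, r2]
  rw [integral_congr_ae (Eventually.of_forall key), integral_add i1 i2, integral_prod_symm _ i1,
    integral_prod _ i2]
  simp only [integral_tri_div hφ, half]
  ring

end Divergence

/-! ### Regularization of radial kernels -/

/-- A radial function with its singularity at the origin smoothed out. -/
noncomputable def reg (F : ℝ → ℝ) (ε : ℝ) (v : E3) : ℝ := F (√(‖v‖ ^ 2 + ε ^ 2))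

/-- The radial function `F` is integrable along `v`, which almost never vanishes. -/
def Good (F : ℝ → ℝ) {X : Type*} [MeasurableSpace X] (μ : Measure X) (v : X → E3) : Prop :=
  (∀ᵐ x ∂μ, v x ≠ 0) ∧ Integrable (fun x => F ‖v x‖) μ

section

variable {n : ℕ} {h ε : ℝ} {G F : ℝ → ℝ}

lemma IsPrimitive.contDiffOn (hn : n ≠ 0) (hG : IsKernel G) (hF : IsPrimitive n h G F) :
    ContDiffOn ℝ 1 F (Ioi 0) := by
  rw [contDiffOn_one_iff_derivWithin isOpen_Ioi.uniqueDiffOn]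
  refine ⟨fun P hP => (hF.hasDerivAt hG hP).differentiableAt.differentiableWithinAt, ?_⟩
  have h1 : ContinuousOn (fun P => (G (√(P ^ 2 + h ^ 2)) - (n + 1) * F P) / P) (Ioi 0) := by
    refine ((hG.continuousOn.comp (by fun_prop) fun p hp => ?_).sub
      (continuousOn_const.mul (hF.isKernel hn hG).continuousOn)).div continuousOn_id
      fun p hp => ne_of_gt hp
    have hp : 0 < p := hp
    exact Real.sqrt_pos.2 (by positivity)
  refine h1.congr fun P hP => ?_
  rw [derivWithin_of_isOpen isOpen_Ioi hP, (hF.hasDerivAt hG hP).deriv]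

lemma IsPrimitive.contDiff_reg (hn : n ≠ 0) (hG : IsKernel G) (hF : IsPrimitive n h G F)
    (hε : 0 < ε) : ContDiff ℝ 1 (reg F ε) := by
  have h1 : ContDiff ℝ 1 fun v : E3 => √(‖v‖ ^ 2 + ε ^ 2) :=
    ((contDiff_norm_sq ℝ).add contDiff_const).sqrt fun v => by positivity
  exact (hF.contDiffOn hn hG).comp_contDiff h1 fun v => Real.sqrt_pos.2 (by positivity)

/-- For R = √(|v|² + ε²) one has v · ∇R = |v|²/R. Inserting the differential equation of F yields a
convex combination of (n+1) F and G with weights ε²/R² and |v|²/R². -/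
lemma IsPrimitive.div_reg (hG : IsKernel G) (hF : IsPrimitive n h G F)
    (hε : 0 < ε) (v : E3) :
    (n + 1) * reg F ε v + fderiv ℝ (reg F ε) v v =
      ε ^ 2 / (‖v‖ ^ 2 + ε ^ 2) * ((n + 1) * F (√(‖v‖ ^ 2 + ε ^ 2)))
      + ‖v‖ ^ 2 / (‖v‖ ^ 2 + ε ^ 2) * G (√(√(‖v‖ ^ 2 + ε ^ 2) ^ 2 + h ^ 2)) := by
  have hpos : 0 < ‖v‖ ^ 2 + ε ^ 2 := by positivity
  have hR := Real.sqrt_pos.2 hpos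
  have hRsq := Real.sq_sqrt hpos.le
  have h1 := ((hasStrictFDerivAt_norm_sq v).hasFDerivAt.add_const (ε ^ 2)).sqrt hpos.ne'
  have h2 := (hF.hasDerivAt hG hR).comp_hasFDerivAt v h1
  have h3 : fderiv ℝ (reg F ε) v v = (G (√(√(‖v‖ ^ 2 + ε ^ 2) ^ 2 + h ^ 2))
      - (n + 1) * F (√(‖v‖ ^ 2 + ε ^ 2))) / √(‖v‖ ^ 2 + ε ^ 2) *
      (1 / (2 * √(‖v‖ ^ 2 + ε ^ 2)) * (2 * ‖v‖ ^ 2)) := by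
    have h4 : HasFDerivAt (reg F ε) _ v := h2
    rw [h4.fderiv]
    simp
  rw [h3, reg]
  rw [← hRsq]
  have e : ‖v‖ ^ 2 = √(‖v‖ ^ 2 + ε ^ 2) ^ 2 - ε ^ 2 := by linarith
  rw [Real.sqrt_sq hR.le]
  generalize √(‖v‖ ^ 2 + ε ^ 2) = R at *
  rw [e]
  field_simp
  ring

lemma IsPrimitive.div_reg_nonneg (hn : n ≠ 0) (hG : IsKernel G) (hF : IsPrimitive n h G F)
    (hε : 0 < ε) (v : E3) : 0 ≤ (n + 1) * reg F ε v + fderiv ℝ (reg F ε) v v := by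
  rw [hF.div_reg hG hε]
  have h1 : 0 ≤ F (√(‖v‖ ^ 2 + ε ^ 2)) := hF.nonneg hn hG (Real.sqrt_pos.2 (by positivity))
  have h2 : 0 ≤ G (√(√(‖v‖ ^ 2 + ε ^ 2) ^ 2 + h ^ 2)) := hG.nonneg _ (Real.sqrt_pos.2
    (by have := Real.sqrt_pos.2 (show 0 < ‖v‖ ^ 2 + ε ^ 2 by positivity); positivity))
  positivity

lemma IsPrimitive.reg_le (hn : n ≠ 0) (hG : IsKernel G) (hF : IsPrimitive n h G F)
    {v : E3} (hv : v ≠ 0) : reg F ε v ≤ F ‖v‖ := by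
  have h1 : 0 < ‖v‖ := norm_pos_iff.2 hv
  have h2 : ‖v‖ ≤ √(‖v‖ ^ 2 + ε ^ 2) := Real.le_sqrt_of_sq_le (by nlinarith [sq_nonneg ε])
  exact hF.antitoneOn hn hG h1 (h1.trans_le h2) h2

/-- A convex combination is bounded through G ≤ (n+1) F, and F decreases. The resulting bound does
not depend on ε, as dominated convergence needs. -/
lemma IsPrimitive.div_reg_le (hn : n ≠ 0) (hG : IsKernel G) (hF : IsPrimitive n h G F)
    (hε : 0 < ε) {v : E3} (hv : v ≠ 0) :
    (n + 1) * reg F ε v + fderiv ℝ (reg F ε) v v ≤ (n + 1) * F ‖v‖ := by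
  have hpos : 0 < ‖v‖ ^ 2 + ε ^ 2 := by positivity
  rw [hF.div_reg hG hε]
  calc _ ≤ ε ^ 2 / (‖v‖ ^ 2 + ε ^ 2) * ((n + 1) * F (√(‖v‖ ^ 2 + ε ^ 2)))
        + ‖v‖ ^ 2 / (‖v‖ ^ 2 + ε ^ 2) * ((n + 1) * F (√(‖v‖ ^ 2 + ε ^ 2))) := by
        gcongr
        exact hF.kernel_le hn hG (Real.sqrt_pos.2 hpos)
    _ = (n + 1) * F (√(‖v‖ ^ 2 + ε ^ 2)) := by field_simp; ring
    _ ≤ _ := by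
        have := hF.reg_le (ε := ε) hn hG hv
        unfold reg at this
        gcongr

end

/-- The sequence of regularization parameters. -/
noncomputable def eps (k : ℕ) : ℝ := 1 / ((k : ℝ) + 1)

lemma eps_pos (k : ℕ) : 0 < eps k := by unfold eps; positivity

lemma tendsto_eps : Tendsto eps atTop (𝓝 0) := tendsto_one_div_add_atTop_nhds_zero_nat

lemma tendsto_sqrt_eps (v : E3) :
    Tendsto (fun k => √(‖v‖ ^ 2 + eps k ^ 2)) atTop (𝓝 ‖v‖) := by
  have h : Tendsto (fun k => √(‖v‖ ^ 2 + eps k ^ 2)) atTop (𝓝 (√(‖v‖ ^ 2 + 0 ^ 2))) :=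
    (((tendsto_eps.pow 2).const_add _).sqrt)
  simpa [Real.sqrt_sq (norm_nonneg v)] using h

section Limits

variable {n : ℕ} {h : ℝ} {G F : ℝ → ℝ}

lemma IsKernel.tendsto_reg (hF : IsKernel F) {v : E3} (hv : v ≠ 0) :
    Tendsto (fun k => reg F (eps k) v) atTop (𝓝 (F ‖v‖)) :=
  (hF.continuousOn.continuousAt (Ioi_mem_nhds (norm_pos_iff.2 hv))).tendsto.comp (tendsto_sqrt_eps v)

lemma IsPrimitive.tendsto_div_reg (hn : n ≠ 0) (hG : IsKernel G) (hF : IsPrimitive n h G F)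
    {v : E3} (hv : v ≠ 0) :
    Tendsto (fun k => (n + 1) * reg F (eps k) v + fderiv ℝ (reg F (eps k)) v v) atTop
      (𝓝 (G (√(‖v‖ ^ 2 + h ^ 2)))) := by
  simp only [hF.div_reg hG (eps_pos _)]
  have hv' : 0 < ‖v‖ := norm_pos_iff.2 hv
  have h1 : Tendsto (fun k => eps k ^ 2 / (‖v‖ ^ 2 + eps k ^ 2)) atTop
      (𝓝 (0 ^ 2 / (‖v‖ ^ 2 + 0 ^ 2))) :=
    (tendsto_eps.pow 2).div ((tendsto_eps.pow 2).const_add _) (by positivity)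
  have h2 : Tendsto (fun k => ‖v‖ ^ 2 / (‖v‖ ^ 2 + eps k ^ 2)) atTop
      (𝓝 (‖v‖ ^ 2 / (‖v‖ ^ 2 + 0 ^ 2))) :=
    tendsto_const_nhds.div ((tendsto_eps.pow 2).const_add _) (by positivity)
  have h3 : Tendsto (fun k => F (√(‖v‖ ^ 2 + eps k ^ 2))) atTop (𝓝 (F ‖v‖)) :=
    (hF.isKernel hn hG).tendsto_reg hv
  have h4 : Tendsto (fun k => G (√(√(‖v‖ ^ 2 + eps k ^ 2) ^ 2 + h ^ 2))) atTop
      (𝓝 (G (√(‖v‖ ^ 2 + h ^ 2)))) :=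
    (hG.continuousOn.continuousAt (Ioi_mem_nhds (Real.sqrt_pos.2 (by positivity)))).tendsto.comp
      ((((tendsto_sqrt_eps v).pow 2).add_const _).sqrt)
  have h5 := (h1.mul (h3.const_mul ((n : ℝ) + 1))).add (h2.mul h4)
  have e1 : (0 : ℝ) ^ 2 / (‖v‖ ^ 2 + 0 ^ 2) = 0 := by simp
  have e2 : ‖v‖ ^ 2 / (‖v‖ ^ 2 + 0 ^ 2) = 1 := by simp [hv]
  rwa [e1, e2, zero_mul, zero_add, one_mul] at h5

variable {X : Type*} [TopologicalSpace X] [MeasurableSpace X]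
  [OpensMeasurableSpace X] {μ : Measure X} {v : X → E3}

/-- The weight c is part of the statement so that a face of weight zero, on which F may fail to be
integrable, requires nothing. -/
lemma IsPrimitive.tendsto_integral_reg (hn : n ≠ 0) (hG : IsKernel G) (hF : IsPrimitive n h G F)
    (hv : Continuous v) (c : ℝ) (hg : c ≠ 0 → Good F μ v) :
    Tendsto (fun k => c * ∫ x, reg F (eps k) (v x) ∂μ) atTop (𝓝 (c * ∫ x, F ‖v x‖ ∂μ)) := by
  rcases eq_or_ne c 0 with rfl | hc
  · simp
  obtain ⟨h1, h2⟩ := hg hc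
  refine (tendsto_integral_of_dominated_convergence (fun x => F ‖v x‖) (fun k => ?_) h2
    (fun k => ?_) ?_).const_mul c
  · exact ((hF.contDiff_reg hn hG (eps_pos k)).continuous.comp hv).aestronglyMeasurable
  · filter_upwards [h1] with x hx
    have h0 : 0 ≤ reg F (eps k) (v x) :=
      hF.nonneg hn hG (Real.sqrt_pos.2 (by have := eps_pos k; positivity))
    rw [Real.norm_of_nonneg h0]
    exact hF.reg_le hn hG hx
  · filter_upwards [h1] with x hx using (hF.isKernel hn hG).tendsto_reg hx

lemma IsPrimitive.tendsto_integral_div_reg (hn : n ≠ 0) (hG : IsKernel G)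
    (hF : IsPrimitive n h G F) (hv : Continuous v) (hg : Good F μ v) :
    Tendsto (fun k => ∫ x, ((n + 1) * reg F (eps k) (v x)
      + fderiv ℝ (reg F (eps k)) (v x) (v x)) ∂μ) atTop
      (𝓝 (∫ x, G (√(‖v x‖ ^ 2 + h ^ 2)) ∂μ)) := by
  refine tendsto_integral_of_dominated_convergence (fun x => (n + 1) * F ‖v x‖) (fun k => ?_)
    (hg.2.const_mul _) (fun k => ?_) ?_
  · have h1 := hF.contDiff_reg hn hG (eps_pos k)
    exact ((continuous_const.mul (h1.continuous.comp hv)).add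
      (continuous_fderiv_apply' h1 hv hv)).aestronglyMeasurable
  · filter_upwards [hg.1] with x hx
    rw [Real.norm_of_nonneg (hF.div_reg_nonneg hn hG (eps_pos k) _)]
    exact hF.div_reg_le hn hG (eps_pos k) hx
  · filter_upwards [hg.1] with x hx using hF.tendsto_div_reg hn hG hx

end Limits

/-! ### Reduction of dimension -/

section Reduction

variable {h : ℝ} {G F : ℝ → ℝ}

/-- The divergence theorem holds for every regularized kernel, and both sides converge as ε tends to
0; the identity is the equality of the limits. The other three shapes follow the same pattern. -/
theorem reduction_triangle (hG : IsKernel G) (hF : IsPrimitive 1 h G F) {a b e : E3} {c d : ℝ}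
    (he : e = c • a + d • b)
    (hg : Good F triMeasure fun p => p.1 • a + p.2 • b + e)
    (hg1 : c ≠ 0 → Good F segMeasure fun t => t • b + e)
    (hg2 : d ≠ 0 → Good F segMeasure fun t => t • a + e)
    (hg3 : 1 + c + d ≠ 0 → Good F segMeasure fun t => t • (a - b) + (e + b)) :
    ∫ p, G (√(‖p.1 • a + p.2 • b + e‖ ^ 2 + h ^ 2)) ∂triMeasure =
      -c * (∫ t, F ‖t • b + e‖ ∂segMeasure) + -d * (∫ t, F ‖t • a + e‖ ∂segMeasure)
      + (1 + c + d) * (∫ t, F ‖t • (a - b) + (e + b)‖ ∂segMeasure) := by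
  refine tendsto_nhds_unique
    (hF.tendsto_integral_div_reg one_ne_zero hG (by fun_prop) hg)
    ((((hF.tendsto_integral_reg one_ne_zero hG (by fun_prop) (-c) (hg1 ∘ neg_ne_zero.1)).add
      (hF.tendsto_integral_reg one_ne_zero hG (by fun_prop) (-d) (hg2 ∘ neg_ne_zero.1))).add
      (hF.tendsto_integral_reg one_ne_zero hG (by fun_prop) _ hg3)).congr fun k => ?_)
  have hφ := hF.contDiff_reg one_ne_zero hG (eps_pos k)
  have := integral_tri_div hφ a b e c d
  have r : ∀ p : ℝ × ℝ, (p.1 + c) • a + (p.2 + d) • b = p.1 • a + p.2 • b + e := fun p => by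
    rw [he]; module
  simp only [r] at this
  push_cast
  rw [show (1 : ℝ) + 1 = 2 by norm_num, this]
  simp only [integral_segMeasure]
  ring

theorem reduction_square (hG : IsKernel G) (hF : IsPrimitive 1 h G F) {a b e : E3} {c d : ℝ}
    (he : e = c • a + d • b)
    (hg : Good F (segMeasure.prod segMeasure) fun p => p.1 • a + p.2 • b + e)
    (hg1 : 1 + c ≠ 0 → Good F segMeasure fun t => t • b + (e + a))
    (hg2 : c ≠ 0 → Good F segMeasure fun t => t • b + e)
    (hg3 : 1 + d ≠ 0 → Good F segMeasure fun t => t • a + (e + b))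
    (hg4 : d ≠ 0 → Good F segMeasure fun t => t • a + e) :
    ∫ p, G (√(‖p.1 • a + p.2 • b + e‖ ^ 2 + h ^ 2)) ∂segMeasure.prod segMeasure =
      (1 + c) * (∫ t, F ‖t • b + (e + a)‖ ∂segMeasure) + -c * (∫ t, F ‖t • b + e‖ ∂segMeasure)
      + (1 + d) * (∫ t, F ‖t • a + (e + b)‖ ∂segMeasure)
      + -d * (∫ t, F ‖t • a + e‖ ∂segMeasure) := by
  refine tendsto_nhds_unique
    (hF.tendsto_integral_div_reg one_ne_zero hG (by fun_prop) hg)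
    (((((hF.tendsto_integral_reg one_ne_zero hG (by fun_prop) _ hg1).add
      (hF.tendsto_integral_reg one_ne_zero hG (by fun_prop) (-c) (hg2 ∘ neg_ne_zero.1))).add
      (hF.tendsto_integral_reg one_ne_zero hG (by fun_prop) _ hg3)).add
      (hF.tendsto_integral_reg one_ne_zero hG (by fun_prop) (-d) (hg4 ∘ neg_ne_zero.1))).congr
      fun k => ?_)
  have := integral_square_div (hF.contDiff_reg one_ne_zero hG (eps_pos k)) he
  push_cast
  rw [show (1 : ℝ) + 1 = 2 by norm_num, this]
  ring

theorem reduction_prism (hG : IsKernel G) (hF : IsPrimitive 2 h G F) {a b g e : E3} {c d k : ℝ}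
    (he : e = c • a + d • b + k • g)
    (hg : Good F (triMeasure.prod segMeasure) fun x => x.1.1 • a + x.1.2 • b + x.2 • g + e)
    (hg1 : 1 + c + d ≠ 0 →
      Good F (segMeasure.prod segMeasure) fun x => x.1 • (a - b) + x.2 • g + (e + b))
    (hg2 : c ≠ 0 → Good F (segMeasure.prod segMeasure) fun x => x.1 • b + x.2 • g + e)
    (hg3 : d ≠ 0 → Good F (segMeasure.prod segMeasure) fun x => x.1 • a + x.2 • g + e)
    (hg4 : 1 + k ≠ 0 → Good F triMeasure fun p => p.1 • a + p.2 • b + (e + g))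
    (hg5 : k ≠ 0 → Good F triMeasure fun p => p.1 • a + p.2 • b + e) :
    ∫ x, G (√(‖x.1.1 • a + x.1.2 • b + x.2 • g + e‖ ^ 2 + h ^ 2)) ∂triMeasure.prod segMeasure =
      (1 + c + d) * (∫ x, F ‖x.1 • (a - b) + x.2 • g + (e + b)‖ ∂segMeasure.prod segMeasure)
      + -c * (∫ x, F ‖x.1 • b + x.2 • g + e‖ ∂segMeasure.prod segMeasure)
      + -d * (∫ x, F ‖x.1 • a + x.2 • g + e‖ ∂segMeasure.prod segMeasure)
      + (1 + k) * (∫ p, F ‖p.1 • a + p.2 • b + (e + g)‖ ∂triMeasure)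
      + -k * (∫ p, F ‖p.1 • a + p.2 • b + e‖ ∂triMeasure) := by
  refine tendsto_nhds_unique
    (hF.tendsto_integral_div_reg two_ne_zero hG (by fun_prop) hg)
    ((((((hF.tendsto_integral_reg two_ne_zero hG (by fun_prop) _ hg1).add
      (hF.tendsto_integral_reg two_ne_zero hG (by fun_prop) (-c) (hg2 ∘ neg_ne_zero.1))).add
      (hF.tendsto_integral_reg two_ne_zero hG (by fun_prop) (-d) (hg3 ∘ neg_ne_zero.1))).add
      (hF.tendsto_integral_reg two_ne_zero hG (by fun_prop) _ hg4)).add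
      (hF.tendsto_integral_reg two_ne_zero hG (by fun_prop) (-k) (hg5 ∘ neg_ne_zero.1))).congr
      fun i => ?_)
  have := integral_prism_div (hF.contDiff_reg two_ne_zero hG (eps_pos i)) he
  push_cast
  rw [show (2 : ℝ) + 1 = 3 by norm_num, this]
  ring

theorem reduction_tri_tri (hG : IsKernel G) (hF : IsPrimitive 3 h G F) {a b a' b' e : E3}
    {c d c' d' : ℝ} (he : e = c • a + d • b + c' • a' + d' • b')
    (hg : Good F (triMeasure.prod triMeasure)
      fun x => x.1.1 • a + x.1.2 • b + x.2.1 • a' + x.2.2 • b' + e)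
    (hg1 : d' ≠ 0 →
      Good F (triMeasure.prod segMeasure) fun x => x.1.1 • a + x.1.2 • b + x.2 • a' + e)
    (hg2 : 1 + c' + d' ≠ 0 → Good F (triMeasure.prod segMeasure)
      fun x => x.1.1 • a + x.1.2 • b + x.2 • (b' - a') + (e + a'))
    (hg3 : c' ≠ 0 →
      Good F (triMeasure.prod segMeasure) fun x => x.1.1 • a + x.1.2 • b + x.2 • b' + e)
    (hg4 : d ≠ 0 →
      Good F (triMeasure.prod segMeasure) fun x => x.1.1 • a' + x.1.2 • b' + x.2 • a + e)
    (hg5 : 1 + c + d ≠ 0 → Good F (triMeasure.prod segMeasure)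
      fun x => x.1.1 • a' + x.1.2 • b' + x.2 • (b - a) + (e + a))
    (hg6 : c ≠ 0 →
      Good F (triMeasure.prod segMeasure) fun x => x.1.1 • a' + x.1.2 • b' + x.2 • b + e) :
    ∫ x, G (√(‖x.1.1 • a + x.1.2 • b + x.2.1 • a' + x.2.2 • b' + e‖ ^ 2 + h ^ 2))
        ∂triMeasure.prod triMeasure =
      -d' * (∫ x, F ‖x.1.1 • a + x.1.2 • b + x.2 • a' + e‖ ∂triMeasure.prod segMeasure)
      + (1 + c' + d') *
        (∫ x, F ‖x.1.1 • a + x.1.2 • b + x.2 • (b' - a') + (e + a')‖ ∂triMeasure.prod segMeasure)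
      + -c' * (∫ x, F ‖x.1.1 • a + x.1.2 • b + x.2 • b' + e‖ ∂triMeasure.prod segMeasure)
      + -d * (∫ x, F ‖x.1.1 • a' + x.1.2 • b' + x.2 • a + e‖ ∂triMeasure.prod segMeasure)
      + (1 + c + d) *
        (∫ x, F ‖x.1.1 • a' + x.1.2 • b' + x.2 • (b - a) + (e + a)‖ ∂triMeasure.prod segMeasure)
      + -c * (∫ x, F ‖x.1.1 • a' + x.1.2 • b' + x.2 • b + e‖ ∂triMeasure.prod segMeasure) := by
  refine tendsto_nhds_unique
    (hF.tendsto_integral_div_reg three_ne_zero hG (by fun_prop) hg)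
    (((((((hF.tendsto_integral_reg three_ne_zero hG (by fun_prop) (-d') (hg1 ∘ neg_ne_zero.1)).add
      (hF.tendsto_integral_reg three_ne_zero hG (by fun_prop) _ hg2)).add
      (hF.tendsto_integral_reg three_ne_zero hG (by fun_prop) (-c') (hg3 ∘ neg_ne_zero.1))).add
      (hF.tendsto_integral_reg three_ne_zero hG (by fun_prop) (-d) (hg4 ∘ neg_ne_zero.1))).add
      (hF.tendsto_integral_reg three_ne_zero hG (by fun_prop) _ hg5)).add
      (hF.tendsto_integral_reg three_ne_zero hG (by fun_prop) (-c) (hg6 ∘ neg_ne_zero.1))).congr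
      fun i => ?_)
  have := integral_tri_tri_div (hF.contDiff_reg three_ne_zero hG (eps_pos i)) he
  push_cast
  rw [show (3 : ℝ) + 1 = 4 by norm_num, this]
  ring

end Reduction

open ENNReal

/-! ### Integrability -/

lemma intervalIntegrable_abs_rpow : IntervalIntegrable (fun u : ℝ => |u| ^ (-(1 / 2) : ℝ)) volume (-1) 1 := by
  have h1 : IntervalIntegrable (fun u : ℝ => |u| ^ (-(1 / 2) : ℝ)) volume 0 1 := by
    refine (intervalIntegral.intervalIntegrable_rpow' (a := 0) (b := 1) (r := -(1 / 2))
      (by norm_num)).congr ?_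
    intro u hu
    rw [uIoc_of_le zero_le_one] at hu
    simp only [abs_of_pos hu.1]
  have h2 := (IntervalIntegrable.iff_comp_neg).1 h1
  simp only [abs_neg, neg_zero] at h2
  exact h2.symm.trans h1

/-- The function `|u|^{-1/2}`, infinite at zero. -/
noncomputable def invSqrtAbs (u : ℝ) : ℝ≥0∞ := (ENNReal.ofReal (√|u|))⁻¹

lemma measurable_invSqrtAbs : Measurable invSqrtAbs :=
  (ENNReal.measurable_ofReal.comp (by fun_prop)).inv

lemma lintegral_invSqrtAbs_lt_top : ∫⁻ u in Icc (-1) 1, invSqrtAbs u < ∞ := by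
  have h := intervalIntegrable_abs_rpow
  rw [intervalIntegrable_iff_integrableOn_Icc_of_le (by norm_num)] at h
  have h2 := h.2
  rw [hasFiniteIntegral_iff_enorm] at h2
  refine lt_of_le_of_lt (lintegral_mono_ae ?_) h2
  have h0 : ∀ᵐ u : ℝ ∂volume.restrict (Icc (-1) 1), u ≠ 0 :=
    ae_restrict_of_ae (compl_mem_ae_iff.2 (measure_singleton (0 : ℝ)))
  filter_upwards [h0] with u hu
  have hu' : 0 < |u| := abs_pos.2 hu
  rw [invSqrtAbs, ← ENNReal.ofReal_inv_of_pos (Real.sqrt_pos.2 hu'), Real.enorm_eq_ofReal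
    (by positivity), Real.rpow_neg hu'.le, Real.sqrt_eq_rpow]

/-- Outside [-1, 1] the function is at most 1, and inside it has finite integral. Translation
invariance makes the bound uniform in the position of the singularity. -/
lemma exists_lintegral_invSqrtAbs_le :
    ∃ C : ℝ≥0∞, C ≠ ∞ ∧ ∀ x : ℝ, ∫⁻ s, invSqrtAbs (s - x) ∂segMeasure ≤ C := by
  refine ⟨(∫⁻ u in Icc (-1) 1, invSqrtAbs u) + 1, by
    simp [lintegral_invSqrtAbs_lt_top.ne], fun x => ?_⟩
  have h1 : ∀ u, invSqrtAbs u ≤ (Icc (-1) 1).indicator invSqrtAbs u + 1 := by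
    intro u
    by_cases hu : u ∈ Icc (-1 : ℝ) 1
    · rw [indicator_of_mem hu]; exact le_self_add
    · rw [indicator_of_notMem hu, zero_add, invSqrtAbs, ENNReal.inv_le_one, ENNReal.one_le_ofReal,
        Real.one_le_sqrt]
      rw [mem_Icc, ← abs_le] at hu
      exact (not_le.1 hu).le
  calc ∫⁻ s, invSqrtAbs (s - x) ∂segMeasure
      ≤ ∫⁻ s, ((Icc (-1) 1).indicator invSqrtAbs (s - x) + 1) ∂segMeasure :=
        lintegral_mono fun s => h1 _
    _ = (∫⁻ s, (Icc (-1) 1).indicator invSqrtAbs (s - x) ∂segMeasure) + 1 := by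
        rw [lintegral_add_right _ measurable_const]
        simp [segMeasure]
    _ ≤ (∫⁻ s, (Icc (-1) 1).indicator invSqrtAbs (s - x)) + 1 := by
        gcongr
        exact Measure.restrict_le_self
    _ = _ := by
        rw [lintegral_sub_right_eq_self (fun u => (Icc (-1) 1).indicator invSqrtAbs u) x,
          lintegral_indicator measurableSet_Icc]

/-- Pairing with w, the component of a orthogonal to b, eliminates t. This gives α = ‖w‖, and x is
the value of s at which the pairing vanishes. -/
lemma exists_dist_le_norm {a b : E3} (h : LinearIndependent ℝ ![a, b]) :
    ∃ α : ℝ, 0 < α ∧ ∀ e : E3, ∃ x : ℝ, ∀ s t : ℝ, α * |s - x| ≤ ‖s • a + t • b + e‖ := by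
  have hb : b ≠ 0 := h.ne_zero 1
  set w : E3 := a - ((inner ℝ b a : ℝ) / inner ℝ b b) • b with hw
  have hwb : (inner ℝ w b : ℝ) = 0 := by
    rw [hw, inner_sub_left, inner_smul_left, real_inner_comm b a]
    simp [hb]
  have hw0 : w ≠ 0 := by
    intro h0
    have := LinearIndependent.pair_iff.1 h 1 (-((inner ℝ b a : ℝ) / inner ℝ b b))
      (by rw [← h0, hw]; module)
    exact one_ne_zero this.1
  have hwa : (inner ℝ w a : ℝ) = ‖w‖ ^ 2 := by
    have : a = w + ((inner ℝ b a : ℝ) / inner ℝ b b) • b := by rw [hw]; abel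
    conv_lhs => rw [this]
    rw [inner_add_right, inner_smul_right, hwb, real_inner_self_eq_norm_sq]
    ring
  have hpos : 0 < ‖w‖ := norm_pos_iff.2 hw0
  refine ⟨‖w‖, hpos, fun e => ⟨-(inner ℝ w e : ℝ) / ‖w‖ ^ 2, fun s t => ?_⟩⟩
  have h1 := abs_real_inner_le_norm w (s • a + t • b + e)
  rw [inner_add_right, inner_add_right, inner_smul_right, inner_smul_right, hwa, hwb] at h1
  have h2 : s * ‖w‖ ^ 2 + t * 0 + (inner ℝ w e : ℝ)
      = ‖w‖ * (‖w‖ * (s - -(inner ℝ w e : ℝ) / ‖w‖ ^ 2)) := by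
    field_simp; ring
  rw [h2, abs_mul, abs_mul, abs_of_pos hpos] at h1
  exact le_of_mul_le_mul_left h1 hpos

/-- The reciprocal distance is integrable over parallelograms, uniformly in their position. -/
lemma exists_lintegral_inv_norm_le {a b : E3} (h : LinearIndependent ℝ ![a, b]) :
    ∃ C : ℝ≥0∞, C ≠ ∞ ∧ ∀ e : E3,
      ∫⁻ p, ‖p.1 • a + p.2 • b + e‖ₑ⁻¹ ∂segMeasure.prod segMeasure ≤ C := by
  obtain ⟨α, hα, H1⟩ := exists_dist_le_norm h
  obtain ⟨β, hβ, H2⟩ := exists_dist_le_norm (LinearIndependent.pair_symm_iff.1 h)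
  obtain ⟨C, hC, H3⟩ := exists_lintegral_invSqrtAbs_le
  refine ⟨(ENNReal.ofReal (√α))⁻¹ * (ENNReal.ofReal (√β))⁻¹ * (C * C), ?_, fun e => ?_⟩
  · have h1 : (ENNReal.ofReal (√α))⁻¹ ≠ ∞ := by simp [hα]
    have h2 : (ENNReal.ofReal (√β))⁻¹ ≠ ∞ := by simp [hβ]
    exact ENNReal.mul_ne_top (ENNReal.mul_ne_top h1 h2) (ENNReal.mul_ne_top hC hC)
  obtain ⟨x, hx⟩ := H1 e
  obtain ⟨y, hy⟩ := H2 e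
  have key : ∀ p : ℝ × ℝ, ‖p.1 • a + p.2 • b + e‖ₑ⁻¹ ≤
      (ENNReal.ofReal (√α))⁻¹ * (ENNReal.ofReal (√β))⁻¹
        * (invSqrtAbs (p.1 - x) * invSqrtAbs (p.2 - y)) := by
    intro p
    have h1 := hx p.1 p.2
    have h2 := hy p.2 p.1
    rw [add_comm (p.2 • b)] at h2
    set z := p.1 • a + p.2 • b + e
    -- The geometric mean of the two lower bounds separates the variables and leaves two integrable
    -- inverse square roots.
    have h3 : √α * √β * (√|p.1 - x| * √|p.2 - y|) ≤ ‖z‖ := by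
      have := mul_le_mul (Real.sqrt_le_sqrt h1) (Real.sqrt_le_sqrt h2) (Real.sqrt_nonneg _)
        (Real.sqrt_nonneg _)
      rw [Real.mul_self_sqrt (norm_nonneg z), Real.sqrt_mul hα.le, Real.sqrt_mul hβ.le] at this
      linarith
    have h4 : ENNReal.ofReal (√α) * ENNReal.ofReal (√β) *
        (ENNReal.ofReal (√|p.1 - x|) * ENNReal.ofReal (√|p.2 - y|)) ≤ ‖z‖ₑ := by
      rw [← ofReal_norm, ← ENNReal.ofReal_mul (by positivity), ← ENNReal.ofReal_mul (by positivity),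
        ← ENNReal.ofReal_mul (by positivity)]
      exact ENNReal.ofReal_le_ofReal h3
    have h5 := ENNReal.inv_le_inv.2 h4
    rwa [ENNReal.mul_inv (Or.inr (by finiteness)) (Or.inl (by finiteness)),
      ENNReal.mul_inv (Or.inr (by finiteness)) (Or.inl (by finiteness)),
      ENNReal.mul_inv (Or.inr (by finiteness)) (Or.inl (by finiteness))] at h5
  have m1 : Measurable fun s => invSqrtAbs (s - x) := measurable_invSqrtAbs.comp (by fun_prop)
  have m2 : Measurable fun s => invSqrtAbs (s - y) := measurable_invSqrtAbs.comp (by fun_prop)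
  refine (lintegral_mono key).trans ?_
  have m3 : Measurable fun p : ℝ × ℝ => invSqrtAbs (p.1 - x) * invSqrtAbs (p.2 - y) :=
    (m1.comp measurable_fst).mul (m2.comp measurable_snd)
  rw [lintegral_const_mul _ m3,
    lintegral_prod_mul m1.aemeasurable m2.aemeasurable]
  gcongr
  · exact H3 x
  · exact H3 y

lemma triMeasure_le : triMeasure ≤ segMeasure.prod segMeasure := by
  rw [triMeasure, segMeasure, Measure.prod_restrict, ← Measure.volume_eq_prod]
  refine Measure.restrict_mono ?_ le_rfl
  rintro ⟨s, t⟩ ⟨h1, h2, h3⟩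
  simp only at h1 h2 h3
  exact ⟨⟨h1, by simp only; linarith⟩, ⟨h2, by simp only; linarith⟩⟩

lemma exists_lintegral_tri_inv_norm_le {a b : E3} (h : LinearIndependent ℝ ![a, b]) :
    ∃ C : ℝ≥0∞, C ≠ ∞ ∧ ∀ e : E3, ∫⁻ p, ‖p.1 • a + p.2 • b + e‖ₑ⁻¹ ∂triMeasure ≤ C := by
  obtain ⟨C, hC, H⟩ := exists_lintegral_inv_norm_le h
  exact ⟨C, hC, fun e => (lintegral_mono' triMeasure_le le_rfl).trans (H e)⟩

section Good

variable {F : ℝ → ℝ} {X : Type*} [TopologicalSpace X] [MeasurableSpace X]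
  [OpensMeasurableSpace X] {μ : Measure X} {v : X → E3}

lemma IsKernel.continuous_reg (hF : IsKernel F) {ε : ℝ} (hε : 0 < ε) : Continuous (reg F ε) :=
  hF.continuousOn.comp_continuous (by fun_prop) fun v => Real.sqrt_pos.2 (by positivity)

/-- Nothing is assumed of F at 0, so measurability is obtained from the continuous regularizations,
which converge almost everywhere. -/
lemma IsKernel.aestronglyMeasurable (hF : IsKernel F) (hv : Continuous v)
    (h0 : ∀ᵐ x ∂μ, v x ≠ 0) : AEStronglyMeasurable (fun x => F ‖v x‖) μ := by
  refine aestronglyMeasurable_of_tendsto_ae (u := atTop) (f := fun (k : ℕ) x => reg F (eps k) (v x))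
    (fun k => ((hF.continuous_reg (eps_pos k)).comp hv).aestronglyMeasurable) ?_
  filter_upwards [h0] with x hx using hF.tendsto_reg hx

/-- In the extended reals the inverse of zero is infinite, so finiteness of this single integral
already excludes zeros of v up to a null set. The bound F ≤ 1/R does the rest. -/
lemma IsKernel.good_of_lintegral (hF : IsKernel F) (hv : Continuous v)
    (h : ∫⁻ x, ‖v x‖ₑ⁻¹ ∂μ ≠ ∞) : Good F μ v := by
  have h0 : ∀ᵐ x ∂μ, v x ≠ 0 := by
    filter_upwards [ae_lt_top' (hv.measurable.enorm.inv.aemeasurable) h] with x hx hx0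
    simp [hx0] at hx
  refine ⟨h0, hF.aestronglyMeasurable hv h0, ?_⟩
  rw [hasFiniteIntegral_iff_enorm]
  refine lt_of_le_of_lt (lintegral_mono_ae ?_) h.lt_top
  filter_upwards [h0] with x hx
  have hx' := norm_pos_iff.2 hx
  rw [Real.enorm_eq_ofReal (hF.nonneg _ hx'), ← ofReal_norm, ← ENNReal.ofReal_inv_of_pos hx']
  exact ENNReal.ofReal_le_ofReal (hF.le_inv _ hx')

lemma IsKernel.good_of_le_norm [IsFiniteMeasure μ] (hF : IsKernel F) (hv : Continuous v) {δ : ℝ}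
    (hδ : 0 < δ) (h : ∀ x, δ ≤ ‖v x‖) : Good F μ v := by
  refine hF.good_of_lintegral hv (ne_top_of_le_ne_top ?_ (lintegral_mono
    (g := fun _ => (ENNReal.ofReal δ)⁻¹) fun x => ?_))
  · rw [lintegral_const]
    exact ENNReal.mul_ne_top (by simp [hδ]) (measure_ne_top _ _)
  · rw [← ofReal_norm]
    exact ENNReal.inv_le_inv.2 (ENNReal.ofReal_le_ofReal (h x))

lemma IsKernel.good_of_bounded [IsFiniteMeasure μ] (hF : IsKernel F) (hv : Continuous v)
    (h0 : ∀ᵐ x ∂μ, v x ≠ 0) {M : ℝ} (hM : ∀ P, 0 < P → F P ≤ M) : Good F μ v := by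
  refine ⟨h0, Integrable.of_bound (hF.aestronglyMeasurable hv h0) M ?_⟩
  filter_upwards [h0] with x hx
  have hx' := norm_pos_iff.2 hx
  rw [Real.norm_of_nonneg (hF.nonneg _ hx')]
  exact hM _ hx'

lemma IsKernel.good_tri (hF : IsKernel F) {a b : E3} (h : LinearIndependent ℝ ![a, b]) (e : E3) :
    Good F triMeasure fun p => p.1 • a + p.2 • b + e := by
  obtain ⟨C, hC, H⟩ := exists_lintegral_tri_inv_norm_le h
  exact hF.good_of_lintegral (by fun_prop) (ne_top_of_le_ne_top hC (H e))

lemma IsKernel.good_square (hF : IsKernel F) {a b : E3} (h : LinearIndependent ℝ ![a, b]) (e : E3) :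
    Good F (segMeasure.prod segMeasure) fun p => p.1 • a + p.2 • b + e := by
  obtain ⟨C, hC, H⟩ := exists_lintegral_inv_norm_le h
  exact hF.good_of_lintegral (by fun_prop) (ne_top_of_le_ne_top hC (H e))

/-- The bound over the triangle is uniform in the offset, so the third direction enters only as a
parameter and `g` is unrestricted. -/
lemma IsKernel.good_prism (hF : IsKernel F) {a b : E3} (h : LinearIndependent ℝ ![a, b])
    (g e : E3) :
    Good F (triMeasure.prod segMeasure) fun x => x.1.1 • a + x.1.2 • b + x.2 • g + e := by
  obtain ⟨C, hC, H⟩ := exists_lintegral_tri_inv_norm_le h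
  refine hF.good_of_lintegral (by fun_prop) (ne_top_of_le_ne_top (b := C * segMeasure univ)
    (ENNReal.mul_ne_top hC (measure_ne_top _ _)) ?_)
  have hm : Continuous fun x : (ℝ × ℝ) × ℝ => x.1.1 • a + x.1.2 • b + x.2 • g + e := by fun_prop
  have hm' : Measurable fun x : (ℝ × ℝ) × ℝ => ‖x.1.1 • a + x.1.2 • b + x.2 • g + e‖ₑ⁻¹ :=
    hm.measurable.enorm.inv
  rw [lintegral_prod_symm _ hm'.aemeasurable, ← lintegral_const]
  refine lintegral_mono fun s => ?_
  simp only [add_assoc _ (s • g)]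
  exact H _

lemma IsKernel.good_tri_tri (hF : IsKernel F) {a b : E3} (h : LinearIndependent ℝ ![a, b])
    (a' b' e : E3) :
    Good F (triMeasure.prod triMeasure)
      fun x => x.1.1 • a + x.1.2 • b + x.2.1 • a' + x.2.2 • b' + e := by
  obtain ⟨C, hC, H⟩ := exists_lintegral_tri_inv_norm_le h
  refine hF.good_of_lintegral (by fun_prop) (ne_top_of_le_ne_top (b := C * triMeasure univ)
    (ENNReal.mul_ne_top hC (measure_ne_top _ _)) ?_)
  have hm : Continuous fun x : (ℝ × ℝ) × (ℝ × ℝ) =>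
    x.1.1 • a + x.1.2 • b + x.2.1 • a' + x.2.2 • b' + e := by fun_prop
  have hm' : Measurable fun x : (ℝ × ℝ) × (ℝ × ℝ) =>
    ‖x.1.1 • a + x.1.2 • b + x.2.1 • a' + x.2.2 • b' + e‖ₑ⁻¹ := hm.measurable.enorm.inv
  rw [lintegral_prod_symm _ hm'.aemeasurable, ← lintegral_const]
  refine lintegral_mono fun s => ?_
  have r : ∀ p : ℝ × ℝ, p.1 • a + p.2 • b + s.1 • a' + s.2 • b' + e
      = p.1 • a + p.2 • b + (s.1 • a' + s.2 • b' + e) := fun p => by abel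
  simp only [r]
  exact H _

end Good

lemma ae_seg_ne_zero {a : E3} (ha : a ≠ 0) (e : E3) : ∀ᵐ t ∂segMeasure, t • a + e ≠ 0 := by
  refine ae_restrict_of_ae ?_
  have h : {t : ℝ | t • a + e = 0}.Subsingleton := by
    intro s hs t ht
    have hs : s • a + e = 0 := hs
    have ht : t • a + e = 0 := ht
    have : (s - t) • a = 0 := by rw [sub_smul, eq_neg_of_add_eq_zero_left hs,
      eq_neg_of_add_eq_zero_left ht, sub_self]
    exact sub_eq_zero.1 ((smul_eq_zero.1 this).resolve_right ha)
  rw [ae_iff]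
  simp only [not_not]
  exact h.measure_zero volume

lemma ae_square_ne_zero {a b : E3} (hb : b ≠ 0) (e : E3) :
    ∀ᵐ x ∂segMeasure.prod segMeasure, x.1 • a + x.2 • b + e ≠ 0 := by
  have hm : MeasurableSet {x : ℝ × ℝ | ¬ x.1 • a + x.2 • b + e ≠ 0} := by
    simp only [not_not]
    exact (isClosed_eq (by fun_prop) continuous_const).measurableSet
  rw [ae_iff, Measure.measure_prod_null hm]
  refine Eventually.of_forall fun s => ?_
  have := ae_seg_ne_zero hb (s • a + e)
  rw [ae_iff] at this
  refine Eq.trans (congrArg segMeasure ?_) this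
  ext t
  simp only [mem_preimage, mem_ofPred_eq]
  rw [show t • b + (s • a + e) = s • a + t • b + e by abel]

/-! ### Geometry of the recursion -/

section Geometry

/-- Otherwise a, b, w, v would be four independent vectors in a space of dimension three. This is
what forces heights to vanish and limits the parameters to seven cases. -/
lemma eq_zero_of_orthogonal {a b w v : E3} (h : LinearIndependent ℝ ![a, b]) (hw : w ≠ 0)
    (haw : inner ℝ a w = (0 : ℝ)) (hbw : inner ℝ b w = (0 : ℝ)) (hav : inner ℝ a v = (0 : ℝ))
    (hbv : inner ℝ b v = (0 : ℝ)) (hwv : inner ℝ w v = (0 : ℝ)) : v = 0 := by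
  by_contra hv
  have hli : LinearIndependent ℝ ![a, b, w, v] := by
    rw [Fintype.linearIndependent_iff]
    intro g hg
    simp only [Fin.sum_univ_four, Matrix.cons_val] at hg
    have h1 : g 3 = 0 := by
      have := congrArg (fun z => (inner ℝ z v : ℝ)) hg
      simp only [inner_add_left, inner_smul_left, hav, hbv, hwv, inner_zero_left] at this
      simpa [hv] using this
    have h2 : g 2 = 0 := by
      have := congrArg (fun z => (inner ℝ z w : ℝ)) hg
      simp only [inner_add_left, inner_smul_left, haw, hbw, h1, inner_zero_left] at this
      simpa [hw] using this
    rw [h1, h2, zero_smul, zero_smul, add_zero, add_zero] at hg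
    obtain ⟨h3, h4⟩ := LinearIndependent.pair_iff.1 h _ _ hg
    intro i
    fin_cases i <;> assumption
  have := hli.fintype_card_le_finrank
  simp at this

lemma exists_eq_smul_of_not_linearIndependent {a b : E3} (ha : a ≠ 0)
    (h : ¬ LinearIndependent ℝ ![a, b]) : ∃ t : ℝ, b = t • a := by
  rw [LinearIndependent.pair_iff' ha] at h
  push Not at h
  obtain ⟨t, ht⟩ := h
  exact ⟨t, ht.symm⟩

lemma exists_le_norm_line {a e : E3} (ha : a ≠ 0) (h : ∀ t : ℝ, e ≠ t • a) :
    ∃ δ : ℝ, 0 < δ ∧ ∀ t : ℝ, δ ≤ ‖t • a + e‖ := by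
  set c : ℝ := (inner ℝ a e : ℝ) / inner ℝ a a with hc
  have haa : (inner ℝ a a : ℝ) ≠ 0 := inner_self_ne_zero.2 ha
  have hw : (inner ℝ a (e - c • a) : ℝ) = 0 := by
    rw [inner_sub_right, inner_smul_right, hc, div_mul_cancel₀ _ haa, sub_self]
  refine ⟨‖e - c • a‖, norm_pos_iff.2 (sub_ne_zero.2 (h c)), fun t => ?_⟩
  have e1 : t • a + e = (t + c) • a + (e - c • a) := by module
  have h1 := norm_add_sq_eq_norm_sq_add_norm_sq_of_inner_eq_zero ((t + c) • a) (e - c • a)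
    (by rw [inner_smul_left, hw, mul_zero])
  rw [e1]
  nlinarith [norm_nonneg ((t + c) • a + (e - c • a)), norm_nonneg (e - c • a),
    mul_self_nonneg ‖(t + c) • a‖]

variable {s : CoeffRule}

/-- Pythagoras: e - e_∥ is orthogonal to every combination of the a_i. It brings each integrand into
the form G(√(|v|² + h²)) that the reductions expect. -/
lemma norm_sum_add (hs : IsProjectionRule s) {d : ℕ} (a : Fin d → E3) (e : E3) (t : Fin d → ℝ) :
    ‖∑ i, t i • a i + e‖ = √(‖∑ i, t i • a i + par s a e‖ ^ 2 + height s a e ^ 2) := by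
  have h0 : (inner ℝ (∑ i, t i • a i + par s a e) (e - par s a e) : ℝ) = 0 := by
    rw [par, ← Finset.sum_add_distrib, sum_inner]
    refine Finset.sum_eq_zero fun i _ => ?_
    rw [← add_smul, inner_smul_left, ← par, hs d a e i, mul_zero]
  have h1 := norm_add_sq_eq_norm_sq_add_norm_sq_of_inner_eq_zero _ _ h0
  rw [add_assoc, add_sub_cancel] at h1
  rw [height, eq_comm, Real.sqrt_eq_iff_mul_self_eq (by positivity) (norm_nonneg _), h1]
  ring

end Geometry

/-! ### Integrals as integrals with respect to product measures -/

/-- Independence of the first pair gives joint integrability; independence of the second gives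
integrability on every slice, which is needed to write the inner integrals as iterated ones. -/
lemma I4_eq {n : Node4} (h : LinearIndependent ℝ ![n.a1, n.a2])
    (h' : LinearIndependent ℝ ![n.a3, n.a4]) :
    I4 n = ∫ x, G4 ‖x.1.1 • n.a1 + x.1.2 • n.a2 + x.2.1 • n.a3 + x.2.2 • n.a4 + n.e‖
      ∂triMeasure.prod triMeasure := by
  have h1 := (isKernel_G4.good_tri_tri h n.a3 n.a4 n.e).2
  rw [integral_prod _ h1, integral_triMeasure h1.integral_prod_left, I4]
  refine intervalIntegral.integral_congr fun s1 _ => intervalIntegral.integral_congr fun s2 _ => ?_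
  have h2 : Integrable (fun q : ℝ × ℝ =>
      G4 ‖s1 • n.a1 + s2 • n.a2 + q.1 • n.a3 + q.2 • n.a4 + n.e‖) triMeasure := by
    have r : ∀ q : ℝ × ℝ, s1 • n.a1 + s2 • n.a2 + q.1 • n.a3 + q.2 • n.a4 + n.e
      = q.1 • n.a3 + q.2 • n.a4 + (s1 • n.a1 + s2 • n.a2 + n.e) := fun q => by abel
    simp only [r]
    exact (isKernel_G4.good_tri h' _).2
  exact (integral_triMeasure h2).symm

lemma I3_eq {n : Node3} (h : Good (fun P => F4 P n.h4) (triMeasure.prod segMeasure)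
      fun x => x.1.1 • n.a1 + x.1.2 • n.a2 + x.2 • n.a3 + n.e) :
    I3 n = ∫ x, F4 ‖x.1.1 • n.a1 + x.1.2 • n.a2 + x.2 • n.a3 + n.e‖ n.h4
      ∂triMeasure.prod segMeasure := by
  rw [integral_prod _ h.2, integral_triMeasure h.2.integral_prod_left, I3]
  simp only [integral_segMeasure]

/-- The parameter domain of a two dimensional integral, with its Lebesgue measure. -/
noncomputable def Shape.measure : Shape → Measure (ℝ × ℝ)
  | .square => segMeasure.prod segMeasure
  | .triangle => triMeasure

lemma I2_eq {n : Node2} (h : Good (fun P => F3 P n.h3 n.h4) n.shape.measure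
      fun x => x.1 • n.a1 + x.2 • n.a2 + n.e) :
    I2 n = ∫ x, F3 ‖x.1 • n.a1 + x.2 • n.a2 + n.e‖ n.h3 n.h4 ∂n.shape.measure := by
  obtain ⟨sh, a1, a2, e, h3, h4⟩ := n
  cases sh
  · simp only [Shape.measure] at h ⊢
    rw [integral_prod _ h.2, I2]
    simp only [integral_segMeasure]
  · simp only [Shape.measure] at h ⊢
    rw [integral_triMeasure h.2, I2]

lemma I1_eq (n : Node1) : I1 n = ∫ t, F2 ‖t • n.a1 + n.e‖ n.h2 n.h3 n.h4 ∂segMeasure := by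
  rw [integral_segMeasure, I1]

/-! ### One dimensional integrals -/

/-- The integrand is even in t, so a negative end point gives the same value up to sign; this is the
source of |y|. For y = 0 both sides vanish whatever F is at 0. -/
lemma integral_scaled {h : ℝ} {G F : ℝ → ℝ} (hF : IsPrimitive 0 h G F) {α : ℝ} (hα : 0 < α) (y : ℝ) :
    IntervalIntegrable (fun t => G (√((t * α) ^ 2 + h ^ 2))) volume 0 y ∧
    ∫ t in (0 : ℝ)..y, G (√((t * α) ^ 2 + h ^ 2)) = y * F (|y| * α) := by
  have pos : ∀ y, 0 < y → IntervalIntegrable (fun t => G (√((t * α) ^ 2 + h ^ 2))) volume 0 y ∧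
      ∫ t in (0 : ℝ)..y, G (√((t * α) ^ 2 + h ^ 2)) = y * F (y * α) := by
    intro y hy
    obtain ⟨h1, h2⟩ := hF (y * α) (by positivity)
    simp only [pow_zero, one_mul, zero_add, pow_one] at h1 h2
    constructor
    · have := h1.comp_mul_right (c := α)
      rwa [zero_div, mul_div_cancel_right₀ _ hα.ne'] at this
    · have := intervalIntegral.mul_integral_comp_mul_right (a := 0) (b := y)
        (f := fun p => G (√(p ^ 2 + h ^ 2))) α
      rw [zero_mul, h2] at this
      apply mul_left_cancel₀ hα.ne'
      rw [this]; ring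
  rcases lt_trichotomy y 0 with hy | rfl | hy
  · obtain ⟨h1, h2⟩ := pos (-y) (by linarith)
    constructor
    · have := (IntervalIntegrable.iff_comp_neg).1 h1
      simpa only [neg_mul, neg_sq, neg_zero, neg_neg] using this
    · have := intervalIntegral.integral_comp_neg (a := 0) (b := y)
        (fun t => G (√((t * α) ^ 2 + h ^ 2)))
      simp only [neg_mul, neg_sq, neg_zero] at this
      rw [this, intervalIntegral.integral_symm, h2, abs_of_neg hy]
      ring
  · simp
  · rw [abs_of_pos hy]
    exact pos y hy

theorem reduction_segment {h : ℝ} {G F : ℝ → ℝ} (hF : IsPrimitive 0 h G F) {a e : E3} {c : ℝ}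
    (ha : a ≠ 0) (he : e = c • a) :
    ∫ t in (0 : ℝ)..1, G (√(‖t • a + e‖ ^ 2 + h ^ 2)) =
      (1 + c) * F (|1 + c| * ‖a‖) - c * F (|0 + c| * ‖a‖) := by
  have hα := norm_pos_iff.2 ha
  have e1 : ∀ t : ℝ, G (√(‖t • a + e‖ ^ 2 + h ^ 2))
      = G (√(((t + c) * ‖a‖) ^ 2 + h ^ 2)) := fun t => by
    rw [he, ← add_smul, norm_smul, mul_pow, mul_pow, Real.norm_eq_abs, sq_abs]
  simp only [e1]
  rw [intervalIntegral.integral_comp_add_right (fun t => G (√((t * ‖a‖) ^ 2 + h ^ 2))) c]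
  obtain ⟨i1, v1⟩ := integral_scaled hF hα (1 + c)
  obtain ⟨i2, v2⟩ := integral_scaled hF hα (0 + c)
  rw [← intervalIntegral.integral_interval_sub_left i1 i2, v1, v2]
  ring

lemma hCase_unique {k l : Fin 7} {h1 h2 h3 h4 : ℝ} (hk : hCase k h1 h2 h3 h4)
    (hl : hCase l h1 h2 h3 h4) : k = l := by
  fin_cases k <;> fin_cases l <;> simp only [hCase] at hk hl <;> first | rfl | tauto

/-! ### Admissible parameters -/

/-- The parameters of one dimensional integrals that are reached with nonzero coefficients. -/
structure Admissible1 (n : Node1) : Prop where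
  ne : n.a1 ≠ 0
  h2_nonneg : 0 ≤ n.h2
  h3_nonneg : 0 ≤ n.h3
  h4_nonneg : 0 ≤ n.h4
  mul_eq_zero : n.h3 * n.h4 = 0
  cases : (n.h2 ≠ 0 ∧ ∃ t : ℝ, n.e = t • n.a1) ∨
    ((∀ t : ℝ, n.e ≠ t • n.a1) ∧ (n.h2 = 0 ∨ n.h3 = 0 ∧ n.h4 = 0))

/-- The parameters of two dimensional integrals that are reached with nonzero coefficients. -/
structure Admissible2 (n : Node2) : Prop where
  ne1 : n.a1 ≠ 0
  ne2 : n.a2 ≠ 0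
  h3_nonneg : 0 ≤ n.h3
  h4_nonneg : 0 ≤ n.h4
  mul_eq_zero : n.h3 * n.h4 = 0
  triangle : n.shape = .triangle → LinearIndependent ℝ ![n.a1, n.a2]
  away : ¬ LinearIndependent ℝ ![n.a1, n.a2] → ∀ t : ℝ, n.e ≠ t • n.a1
  normal : n.h3 ≠ 0 ∨ n.h4 ≠ 0 → ∃ w : E3, w ≠ 0 ∧ inner ℝ n.a1 w = (0 : ℝ) ∧
    inner ℝ n.a2 w = (0 : ℝ) ∧ inner ℝ n.e w = (0 : ℝ)

/-- The parameters of three dimensional integrals that are reached. -/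
structure Admissible3 (n : Node3) : Prop where
  li : LinearIndependent ℝ ![n.a1, n.a2]
  ne : n.a3 ≠ 0
  h4_nonneg : 0 ≤ n.h4
  normal : n.h4 ≠ 0 → ∃ w : E3, w ≠ 0 ∧ inner ℝ n.a1 w = (0 : ℝ) ∧
    inner ℝ n.a2 w = (0 : ℝ) ∧ inner ℝ n.a3 w = (0 : ℝ) ∧ inner ℝ n.e w = (0 : ℝ)

variable {s : CoeffRule}

lemma height_nonneg {d : ℕ} (a : Fin d → E3) (e : E3) : 0 ≤ height s a e := norm_nonneg _

/-! ### The last step -/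

lemma Admissible1.kernel {n : Node1} (hn : Admissible1 n) :
    IsKernel fun P => F2 P n.h2 n.h3 n.h4 :=
  isKernel_F2 hn.h2_nonneg hn.h3_nonneg hn.h4_nonneg hn.mul_eq_zero

/-- Either h2 > 0, and F₂ is bounded by F₃ at h2, or the line carrying the edge stays at positive
distance from the origin. -/
lemma Admissible1.good {n : Node1} (hn : Admissible1 n) :
    Good (fun P => F2 P n.h2 n.h3 n.h4) segMeasure fun t => t • n.a1 + n.e := by
  rcases hn.cases with ⟨h2, -⟩ | ⟨he, -⟩
  · refine hn.kernel.good_of_bounded (by fun_prop) (ae_seg_ne_zero hn.ne n.e)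
      (M := F3 n.h2 n.h3 n.h4) fun P hP => ?_
    exact (isPrimitive_F2 hn.h2_nonneg hn.h3_nonneg hn.h4_nonneg hn.mul_eq_zero).le_kernel
      (isKernel_F3 hn.h3_nonneg hn.h4_nonneg hn.mul_eq_zero) hP
      (lt_of_le_of_ne hn.h2_nonneg (Ne.symm h2))
  · obtain ⟨δ, hδ, H⟩ := exists_le_norm_line hn.ne he
    exact hn.kernel.good_of_le_norm (by fun_prop) hδ H

/-- If e lies on the line of a1, then h1 = 0 and h2 ≠ 0, and h3 h4 = 0 leaves three cases. If not,
then h1 ≠ 0, with three cases for h2 = 0 and a single one for h2 ≠ 0. -/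
lemma Admissible1.exists_hCase (hs : IsProjectionRule s) {n : Node1} (hn : Admissible1 n) :
    ∃ k, hCase k (height1 s n) n.h2 n.h3 n.h4 := by
  have hpar : par s ![n.a1] n.e = s 1 ![n.a1] n.e 0 • n.a1 := by simp [par]
  have hor : (inner ℝ n.a1 (n.e - par s ![n.a1] n.e) : ℝ) = 0 := hs 1 ![n.a1] n.e 0
  have h34 := _root_.mul_eq_zero.1 hn.mul_eq_zero
  rcases hn.cases with ⟨h2, t, ht⟩ | ⟨he, h⟩
  · have h1 : height1 s n = 0 := by
      rw [height1, height, norm_eq_zero]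
      have e1 : n.e - par s ![n.a1] n.e = (t - s 1 ![n.a1] n.e 0) • n.a1 := by
        rw [hpar, sub_smul, ← ht]
      rw [e1, inner_smul_right, _root_.mul_eq_zero] at hor
      rw [e1, hor.resolve_right (inner_self_ne_zero.2 hn.ne), zero_smul]
    by_cases h3 : n.h3 = 0
    · by_cases h4 : n.h4 = 0
      · exact ⟨1, h4, h3, h1, h2⟩
      · exact ⟨6, h3, h1, h4, h2⟩
    · exact ⟨4, h34.resolve_left h3, h1, h3, h2⟩
  · have h1 : height1 s n ≠ 0 := by
      rw [height1, height, norm_ne_zero_iff, hpar, sub_ne_zero]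
      exact he _
    by_cases h2 : n.h2 = 0
    · by_cases h3 : n.h3 = 0
      · by_cases h4 : n.h4 = 0
        · exact ⟨0, h4, h3, h2, h1⟩
        · exact ⟨5, h3, h2, h4, h1⟩
      · exact ⟨3, h34.resolve_left h3, h2, h3, h1⟩
    · obtain ⟨h3, h4⟩ := h.resolve_left h2
      exact ⟨2, h4, h3, h2, h1⟩

theorem Admissible1.step (hs : IsProjectionRule s) {n : Node1} (hn : Admissible1 n) :
    Step1 s n := by
  obtain ⟨k, hk⟩ := hn.exists_hCase hs
  refine ⟨⟨k, hk, fun l hl => hCase_unique hl hk⟩, ?_⟩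
  have hpar : par s ![n.a1] n.e = s 1 ![n.a1] n.e 0 • n.a1 := by simp [par]
  have hF := isPrimitive_F1 (height_nonneg _ _) hn.h2_nonneg hn.h3_nonneg hn.h4_nonneg ⟨k, hk⟩
  have := reduction_segment hF hn.ne hpar
  rw [I1, closed1]
  refine Eq.trans (intervalIntegral.integral_congr fun t _ => ?_) this
  have := norm_sum_add hs ![n.a1] n.e ![t]
  simp only [Fin.sum_univ_one, Matrix.cons_val_zero] at this
  simp only [this]

/-! ### Two dimensional integrals -/

instance (sh : Shape) : IsFiniteMeasure sh.measure := by
  cases sh <;> unfold Shape.measure <;> infer_instance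

lemma Admissible2.kernel {n : Node2} (hn : Admissible2 n) : IsKernel fun P => F3 P n.h3 n.h4 :=
  isKernel_F3 hn.h3_nonneg hn.h4_nonneg hn.mul_eq_zero

lemma IsKernel.good_shape {F : ℝ → ℝ} (hF : IsKernel F) (sh : Shape) {a b : E3}
    (h : LinearIndependent ℝ ![a, b]) (e : E3) :
    Good F sh.measure fun p => p.1 • a + p.2 • b + e := by
  cases sh
  · exact hF.good_square h e
  · exact hF.good_tri h e

lemma Admissible2.good {n : Node2} (hn : Admissible2 n) :
    Good (fun P => F3 P n.h3 n.h4) n.shape.measure fun x => x.1 • n.a1 + x.2 • n.a2 + n.e := by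
  by_cases hli : LinearIndependent ℝ ![n.a1, n.a2]
  · exact hn.kernel.good_shape _ hli _
  · obtain ⟨k, hk⟩ := exists_eq_smul_of_not_linearIndependent hn.ne1 hli
    obtain ⟨δ, hδ, H⟩ := exists_le_norm_line hn.ne1 (hn.away hli)
    refine hn.kernel.good_of_le_norm (by fun_prop) hδ fun x => ?_
    have := H (x.1 + x.2 * k)
    rwa [add_smul, mul_smul, ← hk] at this

/-- If the edges are independent and a normal w exists, then a1, a2, w exhaust the space, so e - e_∥
vanishes. If the edges are parallel, a zero height would put e on the line of a1, against `away`. -/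
lemma Admissible2.height_cases (hs : IsProjectionRule s) {n : Node2} (hn : Admissible2 n) :
    (LinearIndependent ℝ ![n.a1, n.a2] →
      height s ![n.a1, n.a2] n.e = 0 ∨ n.h3 = 0 ∧ n.h4 = 0) ∧
    (¬ LinearIndependent ℝ ![n.a1, n.a2] → height s ![n.a1, n.a2] n.e ≠ 0) := by
  have hpar : par s ![n.a1, n.a2] n.e =
      s 2 ![n.a1, n.a2] n.e 0 • n.a1 + s 2 ![n.a1, n.a2] n.e 1 • n.a2 := by
    simp [par, Fin.sum_univ_two]
  constructor
  · intro hli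
    by_contra! h
    obtain ⟨h2, h34⟩ := h
    obtain ⟨w, hw, hw1, hw2, hwe⟩ := hn.normal (by
      by_cases h3 : n.h3 = 0
      · exact Or.inr (h34 h3)
      · exact Or.inl h3)
    refine h2 ?_
    rw [height, norm_eq_zero]
    refine eq_zero_of_orthogonal hli hw hw1 hw2 (hs 2 ![n.a1, n.a2] n.e 0)
      (hs 2 ![n.a1, n.a2] n.e 1) ?_
    rw [real_inner_comm, inner_sub_left, hwe, hpar, inner_add_left, inner_smul_left,
      inner_smul_left, hw1, hw2]
    simp
  · intro hli h2
    rw [height, norm_eq_zero, sub_eq_zero] at h2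
    obtain ⟨k, hk⟩ := exists_eq_smul_of_not_linearIndependent hn.ne1 hli
    refine hn.away hli (s 2 ![n.a1, n.a2] n.e 0 + s 2 ![n.a1, n.a2] n.e 1 * k) ?_
    rw [add_smul, mul_smul, ← hk, ← hpar, ← h2]

/-- Here b is the direction of the edge and b' a transverse direction; c is both the weight of the
edge and the b'-coordinate of its base point p. For independent edges, c ≠ 0 keeps p off the line of
b. For parallel edges p does lie on that line, but then the height h2 is nonzero. -/
lemma Admissible2.face (hs : IsProjectionRule s) {n : Node2} (hn : Admissible2 n) {b b' p : E3}
    {c m : ℝ} (hb : b ≠ 0)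
    (hli : LinearIndependent ℝ ![n.a1, n.a2] → LinearIndependent ℝ ![b, b'])
    (hdep : ¬ LinearIndependent ℝ ![n.a1, n.a2] → ∃ t : ℝ, b' = t • b)
    (hp : p = c • b' + m • b) (hc : c ≠ 0) :
    Admissible1 ⟨b, p, height s ![n.a1, n.a2] n.e, n.h3, n.h4⟩ where
  ne := hb
  h2_nonneg := height_nonneg _ _
  h3_nonneg := hn.h3_nonneg
  h4_nonneg := hn.h4_nonneg
  mul_eq_zero := hn.mul_eq_zero
  cases := by
    by_cases h : LinearIndependent ℝ ![n.a1, n.a2]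
    · refine Or.inr ⟨fun t ht => ?_, (hn.height_cases hs).1 h⟩
      have ht : p = t • b := ht
      refine hc (LinearIndependent.pair_iff.1 (hli h) (m - t) c ?_).2
      rw [sub_smul, ← ht, hp]
      abel
    · obtain ⟨t, ht⟩ := hdep h
      refine Or.inl ⟨(hn.height_cases hs).2 h, c * t + m, ?_⟩
      simp only
      rw [hp, ht]
      module

/-- After projection a degenerate square may pass through the origin along a whole line, yet its
height is positive and F₂ stays bounded. -/
lemma Admissible2.good_par (hs : IsProjectionRule s) {n : Node2} (hn : Admissible2 n) :
    Good (fun P => F2 P (height s ![n.a1, n.a2] n.e) n.h3 n.h4) n.shape.measure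
      fun x => x.1 • n.a1 + x.2 • n.a2 + par s ![n.a1, n.a2] n.e := by
  have hF := isPrimitive_F2 (height_nonneg (s := s) ![n.a1, n.a2] n.e) hn.h3_nonneg hn.h4_nonneg
    hn.mul_eq_zero
  have hK := hF.isKernel one_ne_zero hn.kernel
  by_cases hli : LinearIndependent ℝ ![n.a1, n.a2]
  · exact hK.good_shape _ hli _
  · have h2 := (hn.height_cases hs).2 hli
    refine hK.good_of_bounded (by fun_prop) ?_ (M := F3 (height s ![n.a1, n.a2] n.e) n.h3 n.h4)
      fun P hP => hF.le_kernel hn.kernel hP (lt_of_le_of_ne (height_nonneg _ _) (Ne.symm h2))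
    cases h : n.shape
    · exact ae_square_ne_zero hn.ne2 _
    · exact absurd (hn.triangle h) hli

lemma list_sum_congr {α : Type*} {l : List (ℝ × α)} {f g : α → ℝ}
    (h : ∀ w ∈ l, w.1 ≠ 0 → f w.2 = g w.2) :
    (l.map fun w => w.1 * f w.2).sum = (l.map fun w => w.1 * g w.2).sum := by
  congr 1
  refine List.map_congr_left fun w hw => ?_
  by_cases h0 : w.1 = 0
  · rw [h0, zero_mul, zero_mul]
  · rw [h w hw h0]

lemma linearIndependent_sub {a b : E3} (h : LinearIndependent ℝ ![a, b]) :
    LinearIndependent ℝ ![a - b, b] := by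
  rw [LinearIndependent.pair_iff] at h ⊢
  intro x y hxy
  obtain ⟨h1, h2⟩ := h x (y - x) (by rw [← hxy]; module)
  exact ⟨h1, by linarith⟩

theorem Admissible2.step (hs : IsProjectionRule s) {n : Node2} (hn : Admissible2 n) :
    Step2 s n := by
  have hpar : par s ![n.a1, n.a2] n.e =
      s 2 ![n.a1, n.a2] n.e 0 • n.a1 + s 2 ![n.a1, n.a2] n.e 1 • n.a2 := by
    simp [par, Fin.sum_univ_two]
  have hF := isPrimitive_F2 (height_nonneg (s := s) ![n.a1, n.a2] n.e) hn.h3_nonneg hn.h4_nonneg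
    hn.mul_eq_zero
  have hgp := hn.good_par hs
  have hnorm : ∀ x : ℝ × ℝ, ‖x.1 • n.a1 + x.2 • n.a2 + n.e‖ =
      √(‖x.1 • n.a1 + x.2 • n.a2 + par s ![n.a1, n.a2] n.e‖ ^ 2
        + height s ![n.a1, n.a2] n.e ^ 2) := fun x => by
    have := norm_sum_add hs ![n.a1, n.a2] n.e ![x.1, x.2]
    simpa only [Fin.sum_univ_two, Matrix.cons_val_zero, Matrix.cons_val_one] using this
  have hI := I2_eq hn.good
  simp only [hnorm] at hI
  have hdep1 : ¬ LinearIndependent ℝ ![n.a1, n.a2] → ∃ t : ℝ, n.a2 = t • n.a1 :=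
    exists_eq_smul_of_not_linearIndependent hn.ne1
  have hdep2 : ¬ LinearIndependent ℝ ![n.a1, n.a2] → ∃ t : ℝ, n.a1 = t • n.a2 := fun h =>
    exists_eq_smul_of_not_linearIndependent hn.ne2 fun h' =>
      h (LinearIndependent.pair_symm_iff.1 h')
  have f2 : s 2 ![n.a1, n.a2] n.e 0 ≠ 0 → Admissible1 ⟨n.a2, par s ![n.a1, n.a2] n.e,
      height s ![n.a1, n.a2] n.e, n.h3, n.h4⟩ :=
    hn.face hs hn.ne2 LinearIndependent.pair_symm_iff.1 hdep2 hpar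
  have f4 : s 2 ![n.a1, n.a2] n.e 1 ≠ 0 → Admissible1 ⟨n.a1, par s ![n.a1, n.a2] n.e,
      height s ![n.a1, n.a2] n.e, n.h3, n.h4⟩ :=
    hn.face hs hn.ne1 id hdep1 (by rw [hpar, add_comm])
  have f1 : 1 + s 2 ![n.a1, n.a2] n.e 0 ≠ 0 → Admissible1 ⟨n.a2, par s ![n.a1, n.a2] n.e + n.a1,
      height s ![n.a1, n.a2] n.e, n.h3, n.h4⟩ :=
    hn.face hs (m := s 2 ![n.a1, n.a2] n.e 1) hn.ne2 LinearIndependent.pair_symm_iff.1 hdep2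
      (by rw [hpar]; module)
  have f3 : 1 + s 2 ![n.a1, n.a2] n.e 1 ≠ 0 → Admissible1 ⟨n.a1, par s ![n.a1, n.a2] n.e + n.a2,
      height s ![n.a1, n.a2] n.e, n.h3, n.h4⟩ :=
    hn.face hs (m := s 2 ![n.a1, n.a2] n.e 0) hn.ne1 id hdep1 (by rw [hpar]; module)
  rw [Step2, faces2]
  cases h : n.shape
  · simp only [h, Shape.measure] at hI hgp
    refine ⟨?_, ?_⟩
    · rw [hI, reduction_square hn.kernel hF hpar hgp (fun h => (f1 h).good) (fun h => (f2 h).good)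
        (fun h => (f3 h).good) (fun h => (f4 h).good)]
      simp only [I1_eq, List.map_cons, List.map_nil, List.sum_cons, List.sum_nil]
      ring
    · simp only [List.forall_mem_cons, ne_eq, neg_eq_zero]
      exact ⟨fun h => (f1 h).step hs, fun h => (f2 h).step hs, fun h => (f3 h).step hs,
        fun h => (f4 h).step hs, by simp⟩
  · have hli := hn.triangle h
    have f5 : 1 + s 2 ![n.a1, n.a2] n.e 0 + s 2 ![n.a1, n.a2] n.e 1 ≠ 0 →
        Admissible1 ⟨n.a1 - n.a2, par s ![n.a1, n.a2] n.e + n.a2,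
          height s ![n.a1, n.a2] n.e, n.h3, n.h4⟩ :=
      hn.face hs (m := s 2 ![n.a1, n.a2] n.e 0) (linearIndependent_sub hli |>.ne_zero 0)
        linearIndependent_sub (fun h => absurd hli h) (by rw [hpar]; module)
    simp only [h, Shape.measure] at hI hgp
    refine ⟨?_, ?_⟩
    · rw [hI, reduction_triangle hn.kernel hF hpar hgp (fun h => (f2 h).good)
        (fun h => (f4 h).good) (fun h => (f5 h).good)]
      simp only [I1_eq, List.map_cons, List.map_nil, List.sum_cons, List.sum_nil]
      ring
    · simp only [List.forall_mem_cons, ne_eq, neg_eq_zero]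
      exact ⟨fun h => (f2 h).step hs, fun h => (f4 h).step hs, fun h => (f5 h).step hs, by simp⟩

/-! ### Three dimensional integrals -/

/-- If h4 ≠ 0, all vectors of the node lie in the plane orthogonal to w, and a1, a2 span that plane;
hence e has no component off the span. -/
lemma Admissible3.height_mul_eq_zero (hs : IsProjectionRule s) {n : Node3} (hn : Admissible3 n) :
    height s ![n.a1, n.a2, n.a3] n.e * n.h4 = 0 := by
  rw [_root_.mul_eq_zero, or_iff_not_imp_right]
  intro h4
  obtain ⟨w, hw, h1, h2, h3, he⟩ := hn.normal h4
  rw [height, norm_eq_zero]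
  refine eq_zero_of_orthogonal hn.li hw h1 h2 (hs 3 ![n.a1, n.a2, n.a3] n.e 0)
      (hs 3 ![n.a1, n.a2, n.a3] n.e 1) ?_
  have hpar : par s ![n.a1, n.a2, n.a3] n.e = s 3 ![n.a1, n.a2, n.a3] n.e 0 • n.a1
      + s 3 ![n.a1, n.a2, n.a3] n.e 1 • n.a2 + s 3 ![n.a1, n.a2, n.a3] n.e 2 • n.a3 := by
    simp [par, Fin.sum_univ_three]
  rw [real_inner_comm, inner_sub_left, he, hpar, inner_add_left, inner_add_left, inner_smul_left,
      inner_smul_left, inner_smul_left, h1, h2, h3]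
  simp

lemma Admissible3.exists_normal (hs : IsProjectionRule s) {n : Node3} (hn : Admissible3 n)
    (h : height s ![n.a1, n.a2, n.a3] n.e ≠ 0 ∨ n.h4 ≠ 0) :
    ∃ w : E3, w ≠ 0 ∧ inner ℝ n.a1 w = (0 : ℝ) ∧ inner ℝ n.a2 w = (0 : ℝ) ∧
      inner ℝ n.a3 w = (0 : ℝ) := by
  rcases h with h | h
  · exact ⟨n.e - par s ![n.a1, n.a2, n.a3] n.e, norm_ne_zero_iff.1 h,
      hs 3 ![n.a1, n.a2, n.a3] n.e 0, hs 3 ![n.a1, n.a2, n.a3] n.e 1,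
      hs 3 ![n.a1, n.a2, n.a3] n.e 2⟩
  · obtain ⟨w, hw, h1, h2, h3, -⟩ := hn.normal h
    exact ⟨w, hw, h1, h2, h3⟩

/-- The weight c is the b'-coordinate of p. If a3 is parallel to b the square collapses into the
line of b, and c ≠ 0 keeps p off it, which is exactly `away`. -/
lemma Admissible3.face_square (hs : IsProjectionRule s) {n : Node3} (hn : Admissible3 n)
    {b b' p : E3} {c m k x y x' y' : ℝ} (hli : LinearIndependent ℝ ![b, b'])
    (hb : b = x • n.a1 + y • n.a2) (hb' : b' = x' • n.a1 + y' • n.a2)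
    (hp : p = c • b' + m • b + k • n.a3) (hc : c ≠ 0) :
    Admissible2 ⟨.square, b, n.a3, p, height s ![n.a1, n.a2, n.a3] n.e, n.h4⟩ where
  ne1 := hli.ne_zero 0
  ne2 := hn.ne
  h3_nonneg := height_nonneg _ _
  h4_nonneg := hn.h4_nonneg
  mul_eq_zero := hn.height_mul_eq_zero hs
  triangle := fun h => by cases h
  away := by
    intro h t ht
    obtain ⟨r, hr⟩ := exists_eq_smul_of_not_linearIndependent (hli.ne_zero 0) h
    have hr : n.a3 = r • b := hr
    have ht : p = t • b := ht
    refine hc (LinearIndependent.pair_iff.1 hli (m + k * r - t) c ?_).2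
    rw [sub_smul, add_smul, mul_smul, ← ht, ← hr, hp]
    abel
  normal := by
    intro h
    obtain ⟨w, hw, h1, h2, h3⟩ := hn.exists_normal hs h
    have hbw : (inner ℝ b w : ℝ) = 0 := by
      rw [hb, inner_add_left, inner_smul_left, inner_smul_left, h1, h2]; simp
    have hbw' : (inner ℝ b' w : ℝ) = 0 := by
      rw [hb', inner_add_left, inner_smul_left, inner_smul_left, h1, h2]; simp
    refine ⟨w, hw, hbw, h3, ?_⟩
    simp only
    rw [hp, inner_add_left, inner_add_left, inner_smul_left, inner_smul_left, inner_smul_left, hbw,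
      hbw', h3]
    simp

/-- Triangular faces keep the independent pair a1, a2 and can never degenerate, so no condition on
their weight is needed. -/
lemma Admissible3.face_triangle (hs : IsProjectionRule s) {n : Node3} (hn : Admissible3 n)
    {p : E3} {x y z : ℝ} (hp : p = x • n.a1 + y • n.a2 + z • n.a3) :
    Admissible2 ⟨.triangle, n.a1, n.a2, p, height s ![n.a1, n.a2, n.a3] n.e, n.h4⟩ where
  ne1 := hn.li.ne_zero 0
  ne2 := hn.li.ne_zero 1
  h3_nonneg := height_nonneg _ _
  h4_nonneg := hn.h4_nonneg
  mul_eq_zero := hn.height_mul_eq_zero hs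
  triangle := fun _ => hn.li
  away := fun h => absurd hn.li h
  normal := by
    intro h
    obtain ⟨w, hw, h1, h2, h3⟩ := hn.exists_normal hs h
    refine ⟨w, hw, h1, h2, ?_⟩
    simp only
    rw [hp, inner_add_left, inner_add_left, inner_smul_left, inner_smul_left, inner_smul_left, h1,
      h2, h3]
    simp

theorem Admissible3.step (hs : IsProjectionRule s) {n : Node3} (hn : Admissible3 n) :
    Step3 s n := by
  have hpar : par s ![n.a1, n.a2, n.a3] n.e = s 3 ![n.a1, n.a2, n.a3] n.e 0 • n.a1
      + s 3 ![n.a1, n.a2, n.a3] n.e 1 • n.a2 + s 3 ![n.a1, n.a2, n.a3] n.e 2 • n.a3 := by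
    simp [par, Fin.sum_univ_three]
  have hF := isPrimitive_F3 (height_nonneg (s := s) ![n.a1, n.a2, n.a3] n.e) hn.h4_nonneg
    (hn.height_mul_eq_zero hs)
  have hK := isKernel_F4 hn.h4_nonneg
  have hgp := (hF.isKernel two_ne_zero hK).good_prism hn.li n.a3 (par s ![n.a1, n.a2, n.a3] n.e)
  have hnorm : ∀ x : (ℝ × ℝ) × ℝ, ‖x.1.1 • n.a1 + x.1.2 • n.a2 + x.2 • n.a3 + n.e‖ =
      √(‖x.1.1 • n.a1 + x.1.2 • n.a2 + x.2 • n.a3 + par s ![n.a1, n.a2, n.a3] n.e‖ ^ 2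
        + height s ![n.a1, n.a2, n.a3] n.e ^ 2) := fun x => by
    have := norm_sum_add hs ![n.a1, n.a2, n.a3] n.e ![x.1.1, x.1.2, x.2]
    simpa only [Fin.sum_univ_three, Matrix.cons_val] using this
  have hI := I3_eq (hK.good_prism hn.li n.a3 n.e)
  simp only [hnorm] at hI
  have f1 := hn.face_square hs (b := n.a1 - n.a2) (b' := n.a2)
    (p := par s ![n.a1, n.a2, n.a3] n.e + n.a2)
    (c := 1 + s 3 ![n.a1, n.a2, n.a3] n.e 0 + s 3 ![n.a1, n.a2, n.a3] n.e 1)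
    (m := s 3 ![n.a1, n.a2, n.a3] n.e 0) (k := s 3 ![n.a1, n.a2, n.a3] n.e 2)
    (x := 1) (y := -1) (x' := 0) (y' := 1)
    (linearIndependent_sub hn.li) (by module) (by module) (by rw [hpar]; module)
  have f2 := hn.face_square hs (b := n.a2) (b' := n.a1)
    (p := par s ![n.a1, n.a2, n.a3] n.e)
    (c := s 3 ![n.a1, n.a2, n.a3] n.e 0)
    (m := s 3 ![n.a1, n.a2, n.a3] n.e 1) (k := s 3 ![n.a1, n.a2, n.a3] n.e 2)
    (x := 0) (y := 1) (x' := 1) (y' := 0)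
    (LinearIndependent.pair_symm_iff.1 hn.li) (by module) (by module) hpar
  have f3 := hn.face_square hs (b := n.a1) (b' := n.a2)
    (p := par s ![n.a1, n.a2, n.a3] n.e)
    (c := s 3 ![n.a1, n.a2, n.a3] n.e 1)
    (m := s 3 ![n.a1, n.a2, n.a3] n.e 0) (k := s 3 ![n.a1, n.a2, n.a3] n.e 2)
    (x := 1) (y := 0) (x' := 0) (y' := 1)
    hn.li (by module) (by module) (by rw [hpar]; module)
  have f4 := hn.face_triangle hs (p := par s ![n.a1, n.a2, n.a3] n.e + n.a3)
    (x := s 3 ![n.a1, n.a2, n.a3] n.e 0) (y := s 3 ![n.a1, n.a2, n.a3] n.e 1)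
    (z := 1 + s 3 ![n.a1, n.a2, n.a3] n.e 2) (by rw [hpar]; module)
  have f5 := hn.face_triangle hs hpar
  -- Iterated and product integrals are identified only for admissible nodes; for weight zero both
  -- sides are zero without any claim about the integral.
  have g2 : ∀ (c : ℝ) (b1 b2 p : E3) (sh : Shape),
      (c ≠ 0 → Admissible2 ⟨sh, b1, b2, p, height s ![n.a1, n.a2, n.a3] n.e, n.h4⟩) →
      c * I2 ⟨sh, b1, b2, p, height s ![n.a1, n.a2, n.a3] n.e, n.h4⟩ =
      c * ∫ x, F3 ‖x.1 • b1 + x.2 • b2 + p‖ (height s ![n.a1, n.a2, n.a3] n.e) n.h4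
        ∂sh.measure := by
    intro c b1 b2 p sh h
    rcases eq_or_ne c 0 with rfl | hc
    · simp
    · rw [I2_eq (h hc).good]
  rw [Step3, faces3]
  refine ⟨?_, ?_⟩
  · rw [hI, reduction_prism hK hF hpar hgp (fun h => (f1 h).good) (fun h => (f2 h).good)
        (fun h => (f3 h).good) (fun _ => f4.good) (fun _ => f5.good)]
    simp only [List.map_cons, List.map_nil, List.sum_cons, List.sum_nil]
    rw [g2 _ _ _ _ _ f1, g2 _ _ _ _ _ (f2 ∘ neg_ne_zero.1), g2 _ _ _ _ _ (f3 ∘ neg_ne_zero.1),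
      g2 _ _ _ _ _ (fun _ => f4), g2 _ _ _ _ _ (fun _ => f5)]
    simp only [Shape.measure]
    ring
  · simp only [List.forall_mem_cons, ne_eq, neg_eq_zero]
    exact ⟨fun h => (f1 h).step hs, fun h => (f2 h).step hs, fun h => (f3 h).step hs,
        fun _ => f4.step hs, fun _ => f5.step hs, by simp⟩

/-! ### The four dimensional integral -/

/-- The common normal is e - e_∥ itself: every vector of a face is a combination of the four a_i, so
it is orthogonal to it. -/
lemma admissible3_face (hs : IsProjectionRule s) {n : Node4} {a b g p : E3}
    {x1 x2 x3 x4 y1 y2 y3 y4 z1 z2 z3 z4 t1 t2 t3 t4 : ℝ}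
    (hli : LinearIndependent ℝ ![a, b]) (hg : g ≠ 0)
    (ha : a = x1 • n.a1 + x2 • n.a2 + x3 • n.a3 + x4 • n.a4)
    (hb : b = y1 • n.a1 + y2 • n.a2 + y3 • n.a3 + y4 • n.a4)
    (hg' : g = z1 • n.a1 + z2 • n.a2 + z3 • n.a3 + z4 • n.a4)
    (hp : p = t1 • n.a1 + t2 • n.a2 + t3 • n.a3 + t4 • n.a4) :
    Admissible3 ⟨a, b, g, p, height s ![n.a1, n.a2, n.a3, n.a4] n.e⟩ where
  li := hli
  ne := hg
  h4_nonneg := height_nonneg _ _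
  normal := by
    intro h
    have key : ∀ {v : E3} {x1 x2 x3 x4 : ℝ},
        v = x1 • n.a1 + x2 • n.a2 + x3 • n.a3 + x4 • n.a4 →
        (inner ℝ v (n.e - par s ![n.a1, n.a2, n.a3, n.a4] n.e) : ℝ) = 0 := by
      intro v x1 x2 x3 x4 hv
      have e1 : (inner ℝ n.a1 (n.e - par s ![n.a1, n.a2, n.a3, n.a4] n.e) : ℝ) = 0 := hs 4 _ _ 0
      have e2 : (inner ℝ n.a2 (n.e - par s ![n.a1, n.a2, n.a3, n.a4] n.e) : ℝ) = 0 := hs 4 _ _ 1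
      have e3 : (inner ℝ n.a3 (n.e - par s ![n.a1, n.a2, n.a3, n.a4] n.e) : ℝ) = 0 := hs 4 _ _ 2
      have e4 : (inner ℝ n.a4 (n.e - par s ![n.a1, n.a2, n.a3, n.a4] n.e) : ℝ) = 0 := hs 4 _ _ 3
      rw [hv]
      simp only [inner_add_left, inner_smul_left, e1, e2, e3, e4, mul_zero, add_zero]
    exact ⟨n.e - par s ![n.a1, n.a2, n.a3, n.a4] n.e, norm_ne_zero_iff.1 h, key ha, key hb,
      key hg', key hp⟩

theorem step4_of_linearIndependent (hs : IsProjectionRule s) {n : Node4}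
    (h12 : LinearIndependent ℝ ![n.a1, n.a2]) (h34 : LinearIndependent ℝ ![n.a3, n.a4]) :
    Step4 s n := by
  have hpar : par s ![n.a1, n.a2, n.a3, n.a4] n.e = s 4 ![n.a1, n.a2, n.a3, n.a4] n.e 0 • n.a1
      + s 4 ![n.a1, n.a2, n.a3, n.a4] n.e 1 • n.a2 + s 4 ![n.a1, n.a2, n.a3, n.a4] n.e 2 • n.a3
      + s 4 ![n.a1, n.a2, n.a3, n.a4] n.e 3 • n.a4 := by
    simp [par, Fin.sum_univ_four]
  have hF := isPrimitive_F4 (height_nonneg (s := s) ![n.a1, n.a2, n.a3, n.a4] n.e)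
  have hK := hF.isKernel three_ne_zero isKernel_G4
  have hgp := hK.good_tri_tri h12 n.a3 n.a4 (par s ![n.a1, n.a2, n.a3, n.a4] n.e)
  have hnorm : ∀ x : (ℝ × ℝ) × (ℝ × ℝ),
      ‖x.1.1 • n.a1 + x.1.2 • n.a2 + x.2.1 • n.a3 + x.2.2 • n.a4 + n.e‖ =
      √(‖x.1.1 • n.a1 + x.1.2 • n.a2 + x.2.1 • n.a3 + x.2.2 • n.a4
        + par s ![n.a1, n.a2, n.a3, n.a4] n.e‖ ^ 2
        + height s ![n.a1, n.a2, n.a3, n.a4] n.e ^ 2) := fun x => by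
    have := norm_sum_add hs ![n.a1, n.a2, n.a3, n.a4] n.e ![x.1.1, x.1.2, x.2.1, x.2.2]
    simpa only [Fin.sum_univ_four, Matrix.cons_val] using this
  have hI := I4_eq h12 h34
  simp only [hnorm] at hI
  have hd12 : n.a2 - n.a1 ≠ 0 :=
    (linearIndependent_sub (LinearIndependent.pair_symm_iff.1 h12)).ne_zero 0
  have hd34 : n.a4 - n.a3 ≠ 0 :=
    (linearIndependent_sub (LinearIndependent.pair_symm_iff.1 h34)).ne_zero 0
  have e1 : n.a1 = (1 : ℝ) • n.a1 + (0 : ℝ) • n.a2 + (0 : ℝ) • n.a3 + (0 : ℝ) • n.a4 := by module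
  have e2 : n.a2 = (0 : ℝ) • n.a1 + (1 : ℝ) • n.a2 + (0 : ℝ) • n.a3 + (0 : ℝ) • n.a4 := by module
  have e3 : n.a3 = (0 : ℝ) • n.a1 + (0 : ℝ) • n.a2 + (1 : ℝ) • n.a3 + (0 : ℝ) • n.a4 := by module
  have e4 : n.a4 = (0 : ℝ) • n.a1 + (0 : ℝ) • n.a2 + (0 : ℝ) • n.a3 + (1 : ℝ) • n.a4 := by module
  have d12 : n.a2 - n.a1 = (-1 : ℝ) • n.a1 + (1 : ℝ) • n.a2 + (0 : ℝ) • n.a3 + (0 : ℝ) • n.a4 := by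
    module
  have d34 : n.a4 - n.a3 = (0 : ℝ) • n.a1 + (0 : ℝ) • n.a2 + (-1 : ℝ) • n.a3 + (1 : ℝ) • n.a4 := by
    module
  have p3 : par s ![n.a1, n.a2, n.a3, n.a4] n.e + n.a3 =
      s 4 ![n.a1, n.a2, n.a3, n.a4] n.e 0 • n.a1
      + s 4 ![n.a1, n.a2, n.a3, n.a4] n.e 1 • n.a2
      + (s 4 ![n.a1, n.a2, n.a3, n.a4] n.e 2 + 1) • n.a3
      + s 4 ![n.a1, n.a2, n.a3, n.a4] n.e 3 • n.a4 := by
    rw [hpar]; module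
  have p1 : par s ![n.a1, n.a2, n.a3, n.a4] n.e + n.a1 =
      (s 4 ![n.a1, n.a2, n.a3, n.a4] n.e 0 + 1) • n.a1
      + s 4 ![n.a1, n.a2, n.a3, n.a4] n.e 1 • n.a2 + s 4 ![n.a1, n.a2, n.a3, n.a4] n.e 2 • n.a3
      + s 4 ![n.a1, n.a2, n.a3, n.a4] n.e 3 • n.a4 := by
    rw [hpar]; module
  have n1 : n.a1 ≠ 0 := h12.ne_zero 0
  have n2 : n.a2 ≠ 0 := h12.ne_zero 1
  have n3 : n.a3 ≠ 0 := h34.ne_zero 0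
  have n4 : n.a4 ≠ 0 := h34.ne_zero 1
  have f1 := admissible3_face hs h12 n3 e1 e2 e3 hpar
  have f2 := admissible3_face hs h12 hd34 e1 e2 d34 p3
  have f3 := admissible3_face hs h12 n4 e1 e2 e4 hpar
  have f4 := admissible3_face hs h34 n1 e3 e4 e1 hpar
  have f5 := admissible3_face hs h34 hd12 e3 e4 d12 p1
  have f6 := admissible3_face hs h34 n2 e3 e4 e2 hpar
  have g : ∀ {a b : E3}, LinearIndependent ℝ ![a, b] → ∀ c p : E3,
      I3 ⟨a, b, c, p, height s ![n.a1, n.a2, n.a3, n.a4] n.e⟩ =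
        ∫ x, F4 ‖x.1.1 • a + x.1.2 • b + x.2 • c + p‖ (height s ![n.a1, n.a2, n.a3, n.a4] n.e)
          ∂triMeasure.prod segMeasure :=
    fun h c p => I3_eq (hK.good_prism h c p)
  rw [Step4, faces4]
  refine ⟨?_, ?_⟩
  · rw [hI, reduction_tri_tri isKernel_G4 hF hpar hgp
        (fun _ => hK.good_prism h12 _ _) (fun _ => hK.good_prism h12 _ _)
        (fun _ => hK.good_prism h12 _ _) (fun _ => hK.good_prism h34 _ _)
        (fun _ => hK.good_prism h34 _ _) (fun _ => hK.good_prism h34 _ _)]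
    simp only [List.map_cons, List.map_nil, List.sum_cons, List.sum_nil]
    rw [g h12, g h12, g h12, g h34, g h34, g h34]
    ring
  · simp only [List.forall_mem_cons, ne_eq, neg_eq_zero]
    exact ⟨fun _ => f1.step hs, fun _ => f2.step hs, fun _ => f3.step hs, fun _ => f4.step hs,
      fun _ => f5.step hs, fun _ => f6.step hs, by simp⟩

/-! ### The closed form -/

lemma Step2.closed {n : Node2} (h : Step2 s n) : I2 n = closed2 s n := by
  rw [h.1, closed2]
  exact list_sum_congr fun w hw hw0 => (h.2 w hw hw0).2

lemma Step3.closed {n : Node3} (h : Step3 s n) : I3 n = closed3 s n := by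
  rw [h.1, closed3]
  exact list_sum_congr fun w hw hw0 => (h.2 w hw hw0).closed

lemma Step4.closed {n : Node4} (h : Step4 s n) : I4 n = closed4 s n := by
  rw [h.1, closed4]
  exact list_sum_congr fun w hw hw0 => (h.2 w hw hw0).closed

/-! ### The Gram-Schmidt coefficients -/

section GramSchmidt

open InnerProductSpace Submodule

lemma inner_gramSchmidt_self {d : ℕ} (a : Fin d → E3) (j : Fin d) :
    inner ℝ (gramSchmidt ℝ a j) (a j) = ‖gramSchmidt ℝ a j‖ ^ 2 := by
  conv_lhs => rw [gramSchmidt_def'' ℝ a j]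
  rw [inner_add_right, inner_sum, Finset.sum_eq_zero, add_zero, real_inner_self_eq_norm_sq]
  intro i hi
  rw [inner_smul_right, gramSchmidt_orthogonal ℝ a (Finset.mem_Iio.1 hi).ne', mul_zero]

/-- The pairings of u_j with the a_i form a triangular system, since u_j is orthogonal to a_i for i
< j. Back substitution solves its j-th row, and rows with u_j = 0 are empty conditions. -/
lemma inner_gramSchmidt_sub_par {d : ℕ} (a : Fin d → E3) (e : E3) (j : Fin d) :
    inner ℝ (gramSchmidt ℝ a j) (e - par (fun _ a e => gsCoeff a e) a e) = 0 := by
  by_cases hj : gramSchmidt ℝ a j = 0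
  · rw [hj, inner_zero_left]
  have hne : inner ℝ (gramSchmidt ℝ a j) (a j) ≠ 0 := by
    rw [inner_gramSchmidt_self]
    exact pow_ne_zero 2 (norm_ne_zero_iff.2 hj)
  have hsum : ∑ i, gsCoeff a e i * inner ℝ (gramSchmidt ℝ a j) (a i) =
      gsCoeff a e j * inner ℝ (gramSchmidt ℝ a j) (a j)
      + ∑ i : {i : Fin d // j < i}, inner ℝ (gramSchmidt ℝ a j) (a i.1) * gsCoeff a e i.1 := by
    have h0 : ∀ i ∈ Finset.univ, i ∉ Finset.Ici j →
        gsCoeff a e i * inner ℝ (gramSchmidt ℝ a j) (a i) = 0 := by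
      intro i _ hi
      rw [Finset.mem_Ici, not_le] at hi
      rw [gramSchmidt_inv_triangular ℝ a hi, mul_zero]
    rw [← Finset.sum_subset (Finset.subset_univ (Finset.Ici j)) h0, ← Finset.Ioi_insert,
      Finset.sum_insert (by simp)]
    exact congrArg₂ (· + ·) rfl ((Finset.sum_congr rfl fun i _ => mul_comm _ _).trans
      (Finset.sum_subtype (Finset.Ioi j) (p := fun i => j < i) (fun i => Finset.mem_Ioi) _))
  rw [inner_sub_right, par, inner_sum]
  simp only [inner_smul_right]
  rw [hsum, gsCoeff, if_neg hj, div_mul_cancel₀ _ hne]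
  ring

theorem isProjectionRule_gsCoeff : IsProjectionRule (fun _ a e => gsCoeff a e) := by
  intro d a e j
  -- Orthogonality to the u_i suffices, because they span every a_j, including those that depend on
  -- their predecessors.
  have hj : a j ∈ span ℝ (range (gramSchmidt ℝ a)) :=
    span_mono (image_subset_range _ _) (mem_span_gramSchmidt ℝ a le_rfl)
  generalize a j = w at hj
  induction hj using span_induction with
  | mem v hv => obtain ⟨i, rfl⟩ := hv; exact inner_gramSchmidt_sub_par a e i
  | zero => exact inner_zero_left _
  | add v w _ _ hv hw => rw [inner_add_left, hv, hw, add_zero]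
  | smul c v _ hv => rw [inner_smul_left, hv, mul_zero]

end GramSchmidt

/-! ### Surface integrals over triangles -/

/-- The parametrization of a triangle over the standard triangle. -/
noncomputable def param (x : Fin 3 → E3) (p : ℝ × ℝ) : E3 :=
  p.1 • (x 1 - x 0) + p.2 • (x 2 - x 0) + x 0

/-- The Jacobian of the parametrization. -/
noncomputable def jacobian (x : Fin 3 → E3) : ℝ :=
  ‖WithLp.toLp 2 ((x 1 - x 0).ofLp ⨯₃ (x 2 - x 0).ofLp)‖

lemma jacobian_nonneg (x : Fin 3 → E3) : 0 ≤ jacobian x := norm_nonneg _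

lemma continuous_param (x : Fin 3 → E3) : Continuous (param x) := by
  unfold param; fun_prop

lemma param_image_stdTri (x : Fin 3 → E3) : param x '' stdTri = tri x := by
  apply Subset.antisymm
  · rintro _ ⟨⟨s, t⟩, ⟨h1, h2, h3⟩, rfl⟩
    simp only at h1 h2 h3
    have h := (convex_convexHull ℝ (range x)).sum_mem (t := Finset.univ)
      (w := ![1 - s - t, s, t]) (z := x)
      (by intro i _; fin_cases i <;> simp <;> linarith) (by simp [Fin.sum_univ_three]; ring)
      fun i _ => subset_convexHull ℝ _ (mem_range_self i)
    have e : param x (s, t) = ∑ i, ![1 - s - t, s, t] i • x i := by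
      rw [Fin.sum_univ_three]
      simp only [param, Matrix.cons_val]
      module
    rw [e]
    exact h
  · refine convexHull_min ?_ ?_
    · rintro _ ⟨i, rfl⟩
      fin_cases i
      · exact ⟨(0, 0), by norm_num [stdTri], by simp [param]⟩
      · exact ⟨(1, 0), by norm_num [stdTri], by simp [param]⟩
      · exact ⟨(0, 1), by norm_num [stdTri], by simp [param]⟩
    · rintro _ ⟨⟨s, t⟩, ⟨h1, h2, h3⟩, rfl⟩ _ ⟨⟨s', t'⟩, ⟨h1', h2', h3'⟩, rfl⟩ a b ha hb hab
      simp only at h1 h2 h3 h1' h2' h3'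
      refine ⟨(a * s + b * s', a * t + b * t'), ⟨?_, ?_, ?_⟩, ?_⟩
      · positivity
      · positivity
      · simp only
        nlinarith
      · obtain rfl := eq_sub_of_add_eq hab
        simp only [param]
        module

lemma linearIndependent_edges {x : Fin 3 → E3} (hx : AffineIndependent ℝ x) :
    LinearIndependent ℝ ![x 1 - x 0, x 2 - x 0] := by
  have h := (affineIndependent_iff_linearIndependent_vsub ℝ x 0).1 hx
  have h2 := h.comp (![⟨1, by decide⟩, ⟨2, by decide⟩] : Fin 2 → {i : Fin 3 // i ≠ 0})
    (by intro i j; fin_cases i <;> fin_cases j <;> simp)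
  have e : ![x 1 - x 0, x 2 - x 0] = (fun i : {i : Fin 3 // i ≠ 0} => x i -ᵥ x 0) ∘
      (![⟨1, by decide⟩, ⟨2, by decide⟩] : Fin 2 → {i : Fin 3 // i ≠ 0}) := by
    ext i : 1
    fin_cases i <;> simp
  rw [e]
  exact h2

lemma param_injective {x : Fin 3 → E3} (hx : AffineIndependent ℝ x) :
    Function.Injective (param x) := by
  rintro ⟨s, t⟩ ⟨s', t'⟩ h
  have h1 := LinearIndependent.pair_iff.1 (linearIndependent_edges hx) (s - s') (t - t') (by
    simp only [param] at h
    rw [sub_smul, sub_smul, ← sub_eq_zero.2 h]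
    abel)
  rw [Prod.mk.injEq]
  exact ⟨sub_eq_zero.1 h1.1, sub_eq_zero.1 h1.2⟩

/-- The identification of `ℝ × ℝ` with the Euclidean plane. -/
noncomputable def planeEquiv : ℝ × ℝ ≃ᵐ EuclideanSpace ℝ (Fin 2) :=
  MeasurableEquiv.finTwoArrow.symm.trans (MeasurableEquiv.toLp 2 (Fin 2 → ℝ))

lemma measurePreserving_planeEquiv : MeasurePreserving planeEquiv volume volume :=
  (EuclideanSpace.volume_preserving_symm_measurableEquiv_toLp (Fin 2)).symm.comp
    ((volume_preserving_finTwoArrow ℝ).symm _)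

/-- The linear part of the parametrization of a triangle. -/
noncomputable def edgeMap (a b : E3) : EuclideanSpace ℝ (Fin 2) →ₗ[ℝ] E3 where
  toFun v := v 0 • a + v 1 • b
  map_add' v w := by simp only [PiLp.add_apply]; module
  map_smul' c v := by simp only [PiLp.smul_apply, smul_eq_mul, RingHom.id_apply]; module

/-- The squared volume factor is the Gram determinant of the two edges, which equals |a × b|² by
Lagrange's identity. -/
lemma normDet_edgeMap (a b : E3) :
    (edgeMap a b).normDet = ‖WithLp.toLp 2 (a.ofLp ⨯₃ b.ofLp)‖ := by
  rw [← sq_eq_sq₀ (LinearMap.normDet_nonneg _) (norm_nonneg _)]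
  have h := LinearMap.normDet_sq_eq_det_gram (edgeMap a b) (EuclideanSpace.basisFun (Fin 2) ℝ)
  simp only [RCLike.ofReal_real_eq_id, id_eq] at h
  rw [h, Matrix.det_fin_two, EuclideanSpace.norm_sq_eq]
  simp [Matrix.gram_apply, edgeMap, EuclideanSpace.inner_eq_star_dotProduct, Fin.sum_univ_three,
    cross_apply, dotProduct, EuclideanSpace.norm_sq_eq]
  ring

lemma measure_param_image (x : Fin 3 → E3) (s : Set (ℝ × ℝ)) :
    μHE[2] (param x '' s) = ENNReal.ofReal (jacobian x) * volume s := by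
  have h1 : param x '' s = (fun v => v + x 0) '' (edgeMap (x 1 - x 0) (x 2 - x 0) ''
      (planeEquiv '' s)) := by
    rw [image_image, image_image]
    rfl
  have h2 := LinearMap.euclideanHausdorffMeasure_image_eq_normDet_mul_volume
    (edgeMap (x 1 - x 0) (x 2 - x 0)) (planeEquiv '' s)
  rw [finrank_euclideanSpace_fin, normDet_edgeMap, planeEquiv.image_eq_preimage_symm,
    (measurePreserving_planeEquiv.symm _).measure_preimage_equiv,
    ← planeEquiv.image_eq_preimage_symm] at h2
  rw [h1, (isometry_add_right (x 0)).euclideanHausdorffMeasure_image, h2, jacobian]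

/-- The parametrization is affine, so its Jacobian is constant and surface measure is a multiple of
the image of Lebesgue measure. Surface integrals thereby become integrals over the standard
triangle. -/
lemma restrict_tri (x : Fin 3 → E3) :
    (μHE[2] : Measure E3).restrict (tri x) =
      ENNReal.ofReal (jacobian x) • triMeasure.map (param x) := by
  ext s hs
  have h : s ∩ tri x = param x '' (param x ⁻¹' s ∩ stdTri) := by
    rw [image_preimage_inter, param_image_stdTri]
  rw [Measure.restrict_apply hs, h, measure_param_image, Measure.smul_apply, smul_eq_mul,
    Measure.map_apply (continuous_param x).measurable hs, triMeasure,
    Measure.restrict_apply ((continuous_param x).measurable hs)]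

lemma measurableEmbedding_param {x : Fin 3 → E3} (hx : AffineIndependent ℝ x) :
    MeasurableEmbedding (param x) :=
  (continuous_param x).measurableEmbedding (param_injective hx)

lemma integral_tri {x : Fin 3 → E3} (hx : AffineIndependent ℝ x) (f : E3 → ℝ) :
    ∫ p in tri x, f p ∂μHE[2] = jacobian x * ∫ s, f (param x s) ∂triMeasure := by
  rw [restrict_tri x, integral_smul_measure, (measurableEmbedding_param hx).integral_map,
    ENNReal.toReal_ofReal (jacobian_nonneg x), smul_eq_mul]

lemma integrableOn_tri {x : Fin 3 → E3} (hx : AffineIndependent ℝ x) {f : E3 → ℝ}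
    (hf : Integrable (fun s => f (param x s)) triMeasure) : IntegrableOn f (tri x) μHE[2] := by
  rw [IntegrableOn, restrict_tri x]
  exact ((measurableEmbedding_param hx).integrable_map_iff.2 hf).smul_measure ENNReal.ofReal_ne_top

/-! ### Areas, convergence and the passage from L to I₄ -/

lemma volume_stdTri : volume.real stdTri = 1 / 2 := by
  have h := integral_triMeasure (integrable_const (1 : ℝ) (μ := triMeasure))
  rw [integral_const, triMeasure, measureReal_restrict_apply_univ, smul_eq_mul, mul_one] at h
  rw [h]
  simp only [intervalIntegral.integral_const, sub_zero, smul_eq_mul, mul_one]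
  rw [intervalIntegral.integral_sub (by simp) (by simp)]
  norm_num

lemma jacobian_eq (x : Fin 3 → E3) : jacobian x = 2 * area x := by
  rw [area, ← param_image_stdTri, measure_param_image, ENNReal.toReal_mul,
    ENNReal.toReal_ofReal (jacobian_nonneg x), ← measureReal_def, volume_stdTri]
  ring

lemma param_sub_eq (x : Fin 3 → E3) (q : E3) (s : ℝ × ℝ) :
    param x s - q = s.1 • (x 1 - x 0) + s.2 • (x 2 - x 0) + (x 0 - q) := by
  rw [param, add_sub_assoc]

lemma integrable_param_sub {x : Fin 3 → E3} (hx : AffineIndependent ℝ x) (q : E3) :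
    Integrable (fun s => ‖param x s - q‖⁻¹) triMeasure := by
  simp only [param_sub_eq]
  exact (isKernel_G4.good_tri (linearIndependent_edges hx) (x 0 - q)).2

lemma potential_eq {x : Fin 3 → E3} (hx : AffineIndependent ℝ x) (q : E3) :
    potential x q = jacobian x * ∫ s, ‖param x s - q‖⁻¹ ∂triMeasure :=
  integral_tri hx fun p => ‖p - q‖⁻¹

lemma param_sub_param (x y : Fin 3 → E3) (s t : ℝ × ℝ) :
    param x s - param y t = s.1 • (rootNode x y).a1 + s.2 • (rootNode x y).a2
      + t.1 • (rootNode x y).a3 + t.2 • (rootNode x y).a4 + (rootNode x y).e := by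
  simp only [param, rootNode]
  module

lemma integrable_param_sub_param {x : Fin 3 → E3} (hx : AffineIndependent ℝ x) (y : Fin 3 → E3) :
    Integrable (fun z : (ℝ × ℝ) × (ℝ × ℝ) => ‖param x z.1 - param y z.2‖⁻¹)
      (triMeasure.prod triMeasure) := by
  simp only [param_sub_param]
  exact (isKernel_G4.good_tri_tri (linearIndependent_edges hx) _ _ _).2

lemma integrableOn_potential {x y : Fin 3 → E3} (hx : AffineIndependent ℝ x)
    (hy : AffineIndependent ℝ y) : IntegrableOn (potential x) (tri y) μHE[2] := by
  refine integrableOn_tri hy ?_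
  simp only [potential_eq hx]
  exact (integrable_param_sub_param hx y).integral_prod_right.const_mul _

lemma linearIndependent_root_fst {x : Fin 3 → E3} (hx : AffineIndependent ℝ x) (y : Fin 3 → E3) :
    LinearIndependent ℝ ![(rootNode x y).a1, (rootNode x y).a2] :=
  linearIndependent_edges hx

lemma linearIndependent_root_snd (x : Fin 3 → E3) {y : Fin 3 → E3} (hy : AffineIndependent ℝ y) :
    LinearIndependent ℝ ![(rootNode x y).a3, (rootNode x y).a4] := by
  have h := (linearIndependent_edges hy).neg
  have e : ![(rootNode x y).a3, (rootNode x y).a4] = -![y 1 - y 0, y 2 - y 0] := by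
    ext i : 1
    fin_cases i <;> rfl
  rw [e]
  exact h

lemma singleLayer_eq {x y : Fin 3 → E3} (hx : AffineIndependent ℝ x)
    (hy : AffineIndependent ℝ y) :
    singleLayer x y = 4 * area x * area y * I4 (rootNode x y) := by
  rw [I4_eq (linearIndependent_root_fst hx y) (linearIndependent_root_snd x hy), singleLayer,
    integral_tri hy]
  simp only [potential_eq hx, ← param_sub_param, G4]
  -- The outer surface integral runs over the second triangle, hence the symmetric form of Fubini.
  -- The two Jacobians, each twice an area, give the factor 4.
  rw [integral_prod_symm _ (integrable_param_sub_param hx y), integral_const_mul, jacobian_eq,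
    jacobian_eq]
  ring

end GalerkinBEM

theorem mainTheorem3 (x y : Fin 3 → GalerkinBEM.E3)
    (hx : AffineIndependent ℝ x) (hy : AffineIndependent ℝ y) :
    -- the closed formulas are the primitive boundary functions
    GalerkinBEM.PBFRelations ∧
    -- the Gram-Schmidt coefficients are an admissible choice of coefficients
    GalerkinBEM.IsProjectionRule (fun _ a e => GalerkinBEM.gsCoeff a e) ∧
    -- the Jacobians of the parametrizations are twice the areas
    ‖WithLp.toLp 2 ((x 1 - x 0).ofLp ⨯₃ (x 2 - x 0).ofLp)‖ = 2 * GalerkinBEM.area x ∧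
    ‖WithLp.toLp 2 ((y 1 - y 0).ofLp ⨯₃ (y 2 - y 0).ofLp)‖ = 2 * GalerkinBEM.area y ∧
    -- the double integral converges, for all relative positions
    (∀ q : GalerkinBEM.E3, IntegrableOn (fun p => ‖p - q‖⁻¹) (GalerkinBEM.tri x) μHE[2]) ∧
    IntegrableOn (GalerkinBEM.potential x) (GalerkinBEM.tri y) μHE[2] ∧
    -- transformation to standard triangles
    GalerkinBEM.singleLayer x y =
      4 * GalerkinBEM.area x * GalerkinBEM.area y * GalerkinBEM.I4 (GalerkinBEM.rootNode x y) ∧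
    -- the recursive reduction and the closed form, for every admissible choice of coefficients
    ∀ s : GalerkinBEM.CoeffRule, GalerkinBEM.IsProjectionRule s →
      GalerkinBEM.Step4 s (GalerkinBEM.rootNode x y) ∧
      GalerkinBEM.I4 (GalerkinBEM.rootNode x y) =
        GalerkinBEM.closed4 s (GalerkinBEM.rootNode x y) ∧
      GalerkinBEM.singleLayer x y =
        4 * GalerkinBEM.area x * GalerkinBEM.area y *
          GalerkinBEM.closed4 s (GalerkinBEM.rootNode x y) := by
  have hL := GalerkinBEM.singleLayer_eq hx hy
  refine ⟨GalerkinBEM.pbfRelations, GalerkinBEM.isProjectionRule_gsCoeff,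
    GalerkinBEM.jacobian_eq x, GalerkinBEM.jacobian_eq y,
    fun q => GalerkinBEM.integrableOn_tri hx (GalerkinBEM.integrable_param_sub hx q),
    GalerkinBEM.integrableOn_potential hx hy, hL, fun s hs => ?_⟩
  have h4 := GalerkinBEM.step4_of_linearIndependent hs (GalerkinBEM.linearIndependent_root_fst hx y)
    (GalerkinBEM.linearIndependent_root_snd x hy)
  exact ⟨h4, h4.closed, hL.trans (by rw [h4.closed])⟩
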